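/- All knots are unoriented polygonal (piecewise linear) knots in $\mathbb{R}^3$, considered up to isotopy (equivalently, up to finite sequences of $\Delta$-moves and their inverses). A based oriented diagram $\tilde K$ of a knot $K$ is a diagram of $K$ (a regular projection to the plane with over/under information at its crossings), together with an orientation and a basepoint that is not a crossing point. Its descending diagram $d(\tilde K)$ is obtained by starting at the basepoint, following the orientation, and changing crossings as necessary so that each crossing is first encountered as an over-crossing. The ascending number $a(\tilde K)$ is the number of crossings in which $\tilde K$ and $d(\tilde K)$ differ, and the ascending number $a(K)$ of the knot is the minimum of $a(\tilde K)$ over all based oriented diagrams $\tilde K$ of $K$. A knot $K$ is a connected sum of knots $K_1$ and $K_2$, written $K=K_1\#K_2$, if $K$ is equivalent to a knot $k$ that meets some plane $E$ in exactly two points $P,Q$, where $k$ passes from one side of $E$ to the other, such that the arc of $k$ on one side of $E$ together with the segment $PQ$ is a knot equivalent to $K_1$, and the arc on the other side together with the segment $PQ$ is a knot equivalent to $K_2$. (All choices of orientations of $K_1$ and $K_2$ are thus admitted.) Proposition 2.4. The ascending number is subadditive with respect to connected sum: for all knots $K_1,K_2$ and every connected sum $K_1\#K_2$ of them, $$a(K_1\#K_2)\le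 a(K_1)+a(K_2).$$ -/

import Mathlib

namespace KnotTheory

/-! Polygonal knots in `ℝ³`, their diagrams in `ℝ²`, and the ascending number.
Only the affine structure of `ℝ³` and `ℝ²` is used. -/

/-- The three-dimensional space `ℝ³`. -/
abbrev Space : Type := Fin 3 → ℝ

/-- The plane `ℝ²` that carries the diagrams. -/
abbrev Plane : Type := Fin 2 → ℝ

/-- The vertical projection `(x, y, z) ↦ (x, y)`. -/
def proj (p : Space) : Plane := ![p 0, p 1]

/-! ### Closed polygons -/

section Polygon

variable {E : Type*} [AddCommGroup E] [Module ℝ E]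

/-- The `i`-th vertex of the closed polygon with vertex list `l`; indices are read cyclically. -/
def vertex (l : List E) (i : ℕ) : E := l.getD (i % l.length) 0

/-- The `i`-th edge of the closed polygon with vertex list `l`. It runs from vertex `i` to vertex
`i + 1` and contains its starting point but not its end point, so that the edges
`0, …, l.length - 1` together traverse the closed polygon exactly once. -/
def edge (l : List E) (i : ℕ) : Set E :=
  AffineMap.lineMap (vertex l i) (vertex l (i + 1)) '' Set.Ico (0 : ℝ) 1

/-- The point set of the closed polygon. -/
def carrier (l : List E) : Set E := ⋃ i, edge l i

/-- The closed polygon is a simple closed curve: it passes through each of its points once. -/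
def IsSimple (l : List E) : Prop :=
  3 ≤ l.length ∧ ∀ i j, i < j → j < l.length → Disjoint (edge l i) (edge l j)

end Polygon

/-! ### Knots and their equivalence -/

/-- A polygonal knot in `ℝ³`, presented by the cyclic list of its vertices. Consecutive collinear
edges are allowed, i.e. edges may be subdivided. The presentation also carries a starting vertex
and a direction; both are forgotten by `Equivalent`. -/
structure Knot where
  verts : List Space
  simple : IsSimple verts

/-- The elementary steps between presentations of polygonal knots. -/
inductive Step : Knot → Knot → Prop
  /-- change of the starting vertex -/
  | rotate (K K' : Knot) : K'.verts = K.verts.rotate 1 → Step K K'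
  /-- change of the direction -/
  | reverse (K K' : Knot) : K'.verts = K.verts.reverse → Step K K'
  /-- the `Δ`-move: an edge `ab` is replaced by the two edges `ac`, `cb`, where the triangle `abc`
  meets the knot in the edge `ab` only. (If the triangle is degenerate, simplicity of `K'` forces
  `c` to be an inner point of `ab`, and the move is a subdivision of the edge.) -/
  | delta (K K' : Knot) (a b c : Space) (l : List Space) :
      K.verts = a :: b :: l → K'.verts = a :: c :: b :: l →
      convexHull ℝ {a, b, c} ∩ carrier K.verts = segment ℝ a b → Step K K'

/-- Equivalence (isotopy) of unoriented polygonal knots in `ℝ³`: a finite sequence of `Δ`-moves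
and inverse `Δ`-moves. -/
def Equivalent : Knot → Knot → Prop := Relation.EqvGen Step

/-! ### Diagrams -/

/-- The closed plane polygon is a regular projection: no vertex is a multiple point, and no point
is passed more than twice. (Hence there are finitely many multiple points, and each of them is a
transversal crossing of two edges.) -/
def IsRegular (l : List Plane) : Prop :=
  3 ≤ l.length ∧
  (∀ i j, i < l.length → j < l.length → i ≠ j → vertex l i ∉ edge l j) ∧
  (∀ i j k, i < j → j < k → k < l.length → edge l i ∩ edge l j ∩ edge l k = ∅)

/-- A based oriented knot diagram: a regular closed plane polygon with over/under information.
The basepoint is the first vertex of the list (as edges may be subdivided, every point that is not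
a crossing can be made the first vertex), and the orientation is the direction of the list.
A crossing is given by the pair `(i, j)` with `i < j` of the edges that cross: starting from the
basepoint and following the orientation, it is first encountered on edge `i` and then on edge `j`.
`firstOver (i, j)` says that the first encounter is the over-crossing; it has a meaning only for
pairs that are crossings. -/
structure Diagram where
  verts : List Plane
  regular : IsRegular verts
  firstOver : ℕ × ℕ → Prop

namespace Diagram

open Classical in
/-- The crossings of a diagram. -/
noncomputable def crossings (D : Diagram) : Finset (ℕ × ℕ) :=
  (Finset.range D.verts.length ×ˢ Finset.range D.verts.length).filter
    fun c => c.1 < c.2 ∧ (edge D.verts c.1 ∩ edge D.verts c.2).Nonempty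

/-- The descending diagram of `D`: the crossings are changed as necessary so that each of them is
first encountered as an over-crossing. -/
def descending (D : Diagram) : Diagram := { D with firstOver := fun _ => True }

open Classical in
/-- The ascending number of a based oriented diagram: the number of crossings in which it differs
from its descending diagram. -/
noncomputable def ascendingNumber (D : Diagram) : ℕ :=
  (D.crossings.filter fun c => ¬ (D.firstOver c ↔ D.descending.firstOver c)).card

/-- `D` is obtained from the polygonal knot `K`, with its starting vertex and direction, by
vertical projection, where the strand with the larger third coordinate is the over-crossing. -/
def IsProjectionOf (D : Diagram) (K : Knot) : Prop :=
  D.verts = K.verts.map proj ∧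
  ∀ c ∈ D.crossings, ∀ x ∈ edge K.verts c.1, ∀ y ∈ edge K.verts c.2,
    proj x = proj y → (D.firstOver c ↔ y 2 < x 2)

/-- `D` is a based oriented diagram of the knot (type) `K`: it is the projection of a polygonal
knot that is equivalent to `K`. -/
def IsDiagramOf (D : Diagram) (K : Knot) : Prop :=
  ∃ K' : Knot, Equivalent K' K ∧ D.IsProjectionOf K'

end Diagram

/-- The ascending number of a knot: the minimum of the ascending numbers of all its based oriented
diagrams. -/
noncomputable def ascendingNumber (K : Knot) : ℕ :=
  sInf {n | ∃ D : Diagram, D.IsDiagramOf K ∧ D.ascendingNumber = n}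

/-! ### Connected sum -/

/-- `K` is a connected sum of `K₁` and `K₂`. Up to equivalence, `K` is a polygonal knot `k` that
meets a plane `{f = c}` in exactly two points `P` and `Q`; the part of `k` on one side of the plane,
closed by the segment `QP` in the plane, is `K₁`, and the part on the other side, closed by the
segment `PQ`, is `K₂`. As `K₁` and `K₂` are not oriented, this comprises the connected sums for all
choices of orientations of `K₁` and `K₂`. -/
def IsConnectedSum (K K₁ K₂ : Knot) : Prop :=
  ∃ (f : Space →ₗ[ℝ] ℝ) (c : ℝ) (P Q : Space) (A B : List Space) (k k₁ k₂ : Knot),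
    f P = c ∧ f Q = c ∧ (∀ a ∈ A, c < f a) ∧ (∀ b ∈ B, f b < c) ∧
    k.verts = P :: (A ++ Q :: B) ∧ k₁.verts = P :: (A ++ [Q]) ∧ k₂.verts = Q :: (B ++ [P]) ∧
    Equivalent K k ∧ Equivalent K₁ k₁ ∧ Equivalent K₂ k₂

end KnotTheory

/-! Diagrams that realize the ascending numbers of the two summands can be joined so that no
crossing arises between them and the order of passage inside each is kept. The first diagram is
based at an edge `ab` without crossings. In the second, a piece of a crossing-free edge next to the
basepoint is pulled to an apex `w` that is extremal in the first coordinate and so high that the two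
new edges pass over the rest of the knot. Cutting the polygon near `w` leaves an arc from `Q` to `P`
whose inner vertices all lie strictly on one side of a vertical plane through `Q` and `P`
(`exists_extremal_tangle`). A tiny copy of it, turned by a similarity of the plane, replaces a piece
of `ab` (`exists_insertedInto_regular`). The new basepoint is the foot `e` of the edge that climbs
to `P`: the walk climbs to `P`, runs through the first diagram, descends from `Q` and runs through
the second. The climbing and the descending edge are over-crossings at their first encounters, so
every ascending crossing comes from one of the two minimal diagrams.

The count uses pairs of points (`bad`) instead of pairs of edge indices, so that it does not notice
subdivisions. In the same spirit, simplicity and regularity are expressed by `passes`, the number of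
edges through a point.

A minimal diagram may carry the wrong orientation. A half-turn about a horizontal axis together with
a reversal of direction exchanges over with under and first with second, so it adds no ascending
crossing (`bad_turn_subset`, `exists_isotopic_ascendingNumber`).

It remains to see that the joined polygon has the right knot type. Nearby simple polygons are
isotopic (`exists_ball_isotopic`), hence a continuous family of simple polygons is an isotopy
(`isotopic_of_family`). An inserted arc can be made small, turned about its edge, slid around
corners and kept away from a `Δ`-move. Therefore the result of an insertion depends only on the
oriented isotopy class of the polygon (`Tangle.InsertedInto.isotopic`). Conversely, an arc separated
from the rest by a plane can be shrunk to an inserted copy (`Tangle.InsertedInto.isotopic_closed`).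
In a connected sum with arcs `A` and `B`, one shrinks `A` into an edge of the closed arc `B`,
deforms that polygon into the closed second diagram, and then shrinks the arc `T` of this diagram
into the polygon that contains `A`. That polygon is isotopic to the closed arc `A`, hence to the
first diagram (`isotopic_insertedInto_of_connectedSum`). -/

namespace KnotTheory

/-! ### Half-open polygonal paths -/

section Start

variable {E : Type*}

/-- The first vertex of a path through `l` with end point `e`. -/
def start : List E → E → E
  | [], e => e
  | a :: _, _ => a

/-- The indicator of a set, with values in `ℕ`. -/
noncomputable def through (s : Set E) (x : E) : ℕ := s.indicator (fun _ => 1) x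

@[simp] theorem start_nil (e : E) : start [] e = e := rfl

@[simp] theorem start_cons (a : E) (l : List E) (e : E) : start (a :: l) e = a := rfl

theorem through_of_mem {s : Set E} {x : E} (h : x ∈ s) : through s x = 1 :=
  Set.indicator_of_mem h _

theorem through_of_notMem {s : Set E} {x : E} (h : x ∉ s) : through s x = 0 :=
  Set.indicator_of_notMem h _

theorem through_le_one (s : Set E) (x : E) : through s x ≤ 1 := by
  by_cases h : x ∈ s
  · exact (through_of_mem h).le
  · rw [through_of_notMem h]; exact zero_le_one

open Classical in
theorem through_eq_ite (s : Set E) (x : E) : through s x = if x ∈ s then 1 else 0 := by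
  split_ifs with h
  · exact through_of_mem h
  · exact through_of_notMem h

theorem through_image {F : Type*} {g : E → F} (hg : Function.Injective g) (s : Set E) (x : E) :
    through (g '' s) (g x) = through s x := by
  classical
  rw [through_eq_ite, through_eq_ite, hg.mem_set_image]

theorem start_map {F : Type*} (g : E → F) (l : List E) (e : E) : start (l.map g) (g e) = g (start l e) := by
  cases l <;> simp

end Start

section Path

variable {E : Type*} [AddCommGroup E] [Module ℝ E]

/-- The half-open segment from `a` to `b`, containing `a` but not `b`. -/
def hseg (a b : E) : Set E := AffineMap.lineMap a b '' Set.Ico (0 : ℝ) 1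

/-- The half-open polygonal path through the vertices `l` that ends at (and excludes) `e`. -/
def path : List E → E → Set E
  | [], _ => ∅
  | a :: l, e => hseg a (start l e) ∪ path l e

/-- The number of edges of the path through `l` with end point `e` that contain `x`. -/
noncomputable def passes : List E → E → E → ℕ
  | [], _, _ => 0
  | a :: l, e, x => through (hseg a (start l e)) x + passes l e x

@[simp] theorem path_nil (e : E) : path [] e = ∅ := rfl

@[simp] theorem path_cons (a : E) (l : List E) (e : E) :
    path (a :: l) e = hseg a (start l e) ∪ path l e := rfl

@[simp] theorem passes_nil (e x : E) : passes [] e x = 0 := rfl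

@[simp] theorem passes_cons (a : E) (l : List E) (e x : E) :
    passes (a :: l) e x = through (hseg a (start l e)) x + passes l e x := rfl

theorem mem_hseg {a b x : E} : x ∈ hseg a b ↔ ∃ t : ℝ, 0 ≤ t ∧ t < 1 ∧ x = a + t • (b - a) := by
  constructor
  · rintro ⟨t, ⟨h0, h1⟩, rfl⟩
    exact ⟨t, h0, h1, by simp [AffineMap.lineMap_apply, add_comm]⟩
  · rintro ⟨t, h0, h1, rfl⟩
    exact ⟨t, ⟨h0, h1⟩, by simp [AffineMap.lineMap_apply, add_comm]⟩

theorem left_mem_hseg (a b : E) : a ∈ hseg a b := mem_hseg.2 ⟨0, le_rfl, one_pos, by simp⟩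

theorem right_notMem_hseg {a b : E} (h : a ≠ b) : b ∉ hseg a b := by
  intro hb
  obtain ⟨t, -, h1, ht⟩ := mem_hseg.1 hb
  have : (1 - t) • (b - a) = 0 := by
    rw [sub_smul, one_smul, sub_eq_zero]; nth_rewrite 1 [ht]; abel
  rcases smul_eq_zero.1 this with h2 | h2
  · linarith
  · exact h (sub_eq_zero.1 h2).symm

theorem mem_segment_iff {a b x : E} :
    x ∈ segment ℝ a b ↔ ∃ t : ℝ, 0 ≤ t ∧ t ≤ 1 ∧ x = a + t • (b - a) := by
  rw [segment_eq_image']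
  constructor
  · rintro ⟨t, ⟨h0, h1⟩, rfl⟩; exact ⟨t, h0, h1, rfl⟩
  · rintro ⟨t, h0, h1, rfl⟩; exact ⟨t, ⟨h0, h1⟩, rfl⟩

theorem segment_eq_hseg_union (a b : E) : segment ℝ a b = hseg a b ∪ {b} := by
  ext x
  rw [mem_segment_iff, Set.mem_union, mem_hseg, Set.mem_singleton_iff]
  constructor
  · rintro ⟨t, h0, h1, rfl⟩
    rcases h1.lt_or_eq with h | rfl
    · exact Or.inl ⟨t, h0, h, rfl⟩
    · right; simp
  · rintro (⟨t, h0, h1, rfl⟩ | rfl)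
    · exact ⟨t, h0, h1.le, rfl⟩
    · exact ⟨1, zero_le_one, le_rfl, by simp⟩

theorem hseg_subset_segment (a b : E) : hseg a b ⊆ segment ℝ a b := by
  rw [segment_eq_hseg_union]; exact Set.subset_union_left

theorem mem_path_iff {l : List E} {e x : E} : x ∈ path l e ↔ 0 < passes l e x := by
  induction l with
  | nil => simp
  | cons a l ih =>
    simp only [path_cons, Set.mem_union, passes_cons, ih]
    by_cases h : x ∈ hseg a (start l e)
    · simp [h, through_of_mem]
    · simp [h, through_of_notMem]

theorem passes_eq_zero {l : List E} {e x : E} : passes l e x = 0 ↔ x ∉ path l e := by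
  rw [mem_path_iff]; omega

theorem passes_append (l₁ l₂ : List E) (b e x : E) :
    passes (l₁ ++ b :: l₂) e x = passes l₁ b x + passes (b :: l₂) e x := by
  induction l₁ with
  | nil => simp
  | cons a l ih =>
    rw [List.cons_append, passes_cons, ih, passes_cons]
    cases l <;> simp [add_assoc]

theorem path_append (l₁ l₂ : List E) (b e : E) :
    path (l₁ ++ b :: l₂) e = path l₁ b ∪ path (b :: l₂) e := by
  ext x
  rw [Set.mem_union, mem_path_iff, mem_path_iff, mem_path_iff, passes_append]; omega

/-- The path passes through each of its points once. -/
def SimplePath (l : List E) (e : E) : Prop := ∀ x, passes l e x ≤ 1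

theorem simplePath_append {l₁ l₂ : List E} {b e : E} :
    SimplePath (l₁ ++ b :: l₂) e ↔
      SimplePath l₁ b ∧ SimplePath (b :: l₂) e ∧ Disjoint (path l₁ b) (path (b :: l₂) e) := by
  constructor
  · intro h
    refine ⟨fun x => ?_, fun x => ?_, Set.disjoint_left.2 fun x h1 h2 => ?_⟩
    · have := h x; rw [passes_append] at this; omega
    · have := h x; rw [passes_append] at this; omega
    · have := h x
      rw [passes_append] at this; rw [mem_path_iff] at h1 h2; omega
  · rintro ⟨h1, h2, h3⟩ x
    have e1 := h1 x
    have e2 := h2 x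
    rw [passes_append]
    by_cases hx : x ∈ path l₁ b
    · have := passes_eq_zero.2 (Set.disjoint_left.1 h3 hx); omega
    · have := passes_eq_zero.2 hx; omega

theorem simplePath_singleton (a e : E) : SimplePath [a] e := fun x => by
  simpa using through_le_one _ _

theorem simplePath_cons {a b e : E} {l : List E} :
    SimplePath (a :: b :: l) e ↔ SimplePath (b :: l) e ∧ Disjoint (hseg a b) (path (b :: l) e) := by
  have := simplePath_append (l₁ := [a]) (l₂ := l) (b := b) (e := e)
  simpa [simplePath_singleton] using this

theorem passes_eq_sum (l : List E) (e x : E) :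
    passes l e x = ∑ i ∈ Finset.range l.length,
      through (hseg ((l ++ [e]).getD i 0) ((l ++ [e]).getD (i + 1) 0)) x := by
  induction l with
  | nil => simp
  | cons a l ih =>
    rw [List.length_cons, Finset.sum_range_succ', passes_cons, ih, add_comm]
    congr 1
    cases l <;> simp

omit [Module ℝ E] in
theorem vertex_eq {l : List E} {i : ℕ} (hl : l ≠ []) (hi : i ≤ l.length) :
    vertex l i = (l ++ [start l 0]).getD i 0 := by
  rcases hi.lt_or_eq with h | rfl
  · rw [vertex, Nat.mod_eq_of_lt h, List.getD_append _ _ _ _ h]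
  · rw [vertex, Nat.mod_self, List.getD_append_right _ _ _ _ le_rfl]
    cases l <;> simp_all

-- This connects the indexed edges of the statement with the recursive count, which is additive
-- under concatenation and therefore easy to follow through rotations, subdivisions and insertions.
open Classical in
theorem passes_closed {l : List E} (hl : l ≠ []) (x : E) :
    passes l (start l 0) x = ((Finset.range l.length).filter fun i => x ∈ edge l i).card := by
  rw [passes_eq_sum, Finset.card_filter]
  simp only [through_eq_ite]
  refine Finset.sum_congr rfl fun i hi => ?_
  have hi' := Finset.mem_range.1 hi
  rw [edge, vertex_eq hl hi'.le, vertex_eq hl (Nat.succ_le_of_lt hi')]; rfl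

theorem edge_mod (l : List E) (i : ℕ) : edge l (i % l.length) = edge l i := by
  simp [edge, vertex, Nat.add_mod]

theorem carrier_eq {l : List E} (hl : l ≠ []) : carrier l = path l (start l 0) := by
  classical
  ext x
  rw [mem_path_iff, passes_closed hl, Finset.card_pos, carrier, Set.mem_iUnion]
  constructor
  · rintro ⟨i, hi⟩
    refine ⟨i % l.length, Finset.mem_filter.2 ⟨Finset.mem_range.2 (Nat.mod_lt _ ?_), ?_⟩⟩
    · exact List.length_pos_iff.2 hl
    · rwa [edge_mod]
  · rintro ⟨i, hi⟩
    exact ⟨i, (Finset.mem_filter.1 hi).2⟩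

theorem isSimple_iff {l : List E} : IsSimple l ↔ 3 ≤ l.length ∧ SimplePath l (start l 0) := by
  classical
  refine and_congr_right fun h3 => ?_
  have hl : l ≠ [] := by rintro rfl; simp at h3
  simp only [SimplePath, passes_closed hl, Finset.card_le_one_iff, Finset.mem_filter,
    Finset.mem_range]
  constructor
  · intro h x i j ⟨hi, xi⟩ ⟨hj, xj⟩
    by_contra hne
    rcases lt_or_gt_of_ne hne with hij | hij
    · exact Set.disjoint_left.1 (h i j hij hj) xi xj
    · exact Set.disjoint_left.1 (h j i hij hi) xj xi
  · intro h i j hij hj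
    exact Set.disjoint_left.2 fun x xi xj => hij.ne (h x ⟨hij.trans hj, xi⟩ ⟨hj, xj⟩)

theorem isSimple_cons_iff {a : E} {l : List E} :
    IsSimple (a :: l) ↔ 2 ≤ l.length ∧ SimplePath (a :: l) a := by
  rw [isSimple_iff]; simp

/-- Both regularity conditions only depend on how often points are passed, so they can be
transported along every operation whose effect on `passes` is known: subdivision, rotation,
reversal, injective affine maps. -/
theorem isRegular_iff {l : List Plane} :
    IsRegular l ↔ 3 ≤ l.length ∧ (∀ x, passes l (start l 0) x ≤ 2) ∧
      ∀ v ∈ l, passes l (start l 0) v ≤ 1 := by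
  classical
  refine and_congr_right fun h3 => ?_
  have hl : l ≠ [] := by rintro rfl; simp at h3
  have hv : ∀ i, vertex l i ∈ edge l i := fun i => left_mem_hseg _ _
  have hvm : ∀ v, v ∈ l ↔ ∃ i < l.length, vertex l i = v := by
    intro v
    rw [List.mem_iff_getElem]
    constructor
    · rintro ⟨i, hi, rfl⟩
      exact ⟨i, hi, by rw [vertex, Nat.mod_eq_of_lt hi, List.getD_eq_getElem _ _ hi]⟩
    · rintro ⟨i, hi, rfl⟩
      exact ⟨i, hi, by rw [vertex, Nat.mod_eq_of_lt hi, List.getD_eq_getElem _ _ hi]⟩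
  rw [and_comm]
  refine and_congr ?_ ?_
  · simp only [passes_closed hl]
    constructor
    · intro h x
      by_contra hc
      rw [not_le, Finset.two_lt_card] at hc
      obtain ⟨i, hi, j, hj, k, hk, hij, hik, hjk⟩ := hc
      simp only [Finset.mem_filter, Finset.mem_range] at hi hj hk
      have key : ∀ i j k, i < j → j < k → k < l.length → x ∈ edge l i → x ∈ edge l j →
          x ∈ edge l k → False := fun i j k h1 h2 h3 a b c =>
        (h i j k h1 h2 h3).le ⟨⟨a, b⟩, c⟩
      rcases lt_or_gt_of_ne hij with a | a <;> rcases lt_or_gt_of_ne hik with b | b <;>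
        rcases lt_or_gt_of_ne hjk with c | c
      · exact key i j k a c hk.1 hi.2 hj.2 hk.2
      · exact key i k j b c hj.1 hi.2 hk.2 hj.2
      · omega
      · exact key k i j b a hj.1 hk.2 hi.2 hj.2
      · exact key j i k a b hk.1 hj.2 hi.2 hk.2
      · omega
      · exact key j k i c b hi.1 hj.2 hk.2 hi.2
      · exact key k j i c a hi.1 hk.2 hj.2 hi.2
    · intro h i j k hij hjk hk
      by_contra hc
      obtain ⟨x, ⟨xi, xj⟩, xk⟩ := Set.nonempty_iff_ne_empty.2 hc
      have := h x
      rw [← not_lt, Finset.two_lt_card] at this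
      apply this
      refine ⟨i, ?_, j, ?_, k, ?_, hij.ne, (hij.trans hjk).ne, hjk.ne⟩ <;>
        simp only [Finset.mem_filter, Finset.mem_range]
      · exact ⟨by omega, xi⟩
      · exact ⟨by omega, xj⟩
      · exact ⟨by omega, xk⟩
  · simp only [passes_closed hl, hvm, Finset.card_le_one_iff, Finset.mem_filter, Finset.mem_range]
    constructor
    · rintro h v ⟨k, hk, rfl⟩ i j ⟨hi, xi⟩ ⟨hj, xj⟩
      have e1 : k = i := by by_contra hne; exact h k i hk hi hne xi
      have e2 : k = j := by by_contra hne; exact h k j hk hj hne xj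
      omega
    · intro h i j hi hj hij hc
      exact hij (h _ ⟨i, hi, rfl⟩ ⟨hi, hv i⟩ ⟨hj, hc⟩)

/-! Rotations and subdivisions. -/

theorem passes_rotate (a : E) (l : List E) (x : E) (hl : l ≠ []) :
    passes (l ++ [a]) (start l a) x = passes (a :: l) a x := by
  cases l with
  | nil => simp at hl
  | cons b l =>
    rw [passes_append, passes_cons a]; simp [add_comm]

theorem hseg_subdivide {a b c : E} (h : c ∈ openSegment ℝ a b) :
    hseg a b = hseg a c ∪ hseg c b ∧ Disjoint (hseg a c) (hseg c b) ∨ a = b := by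
  by_cases hab : a = b
  · exact Or.inr hab
  left
  rw [openSegment_eq_image'] at h
  obtain ⟨s, ⟨hs0, hs1⟩, rfl⟩ := h
  have hba : b - a ≠ 0 := sub_ne_zero.2 (Ne.symm hab)
  constructor
  · ext x
    rw [Set.mem_union, mem_hseg, mem_hseg, mem_hseg]
    constructor
    · rintro ⟨t, h0, h1, rfl⟩
      rcases lt_or_ge t s with hts | hts
      · left
        refine ⟨t / s, by positivity, (div_lt_one hs0).2 hts, ?_⟩
        rw [add_sub_cancel_left, smul_smul, div_mul_cancel₀ _ hs0.ne']
      · right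
        have h1s : 0 < 1 - s := by linarith
        refine ⟨(t - s) / (1 - s), div_nonneg (by linarith) h1s.le,
          (div_lt_one h1s).2 (by linarith), ?_⟩
        have : b - (a + s • (b - a)) = (1 - s) • (b - a) := by rw [sub_smul, one_smul]; abel
        rw [this, smul_smul, div_mul_cancel₀ _ h1s.ne', add_assoc, ← add_smul]; congr 2; ring
    · rintro (⟨t, h0, h1, rfl⟩ | ⟨t, h0, h1, rfl⟩)
      · refine ⟨t * s, by positivity, by nlinarith, ?_⟩
        rw [add_sub_cancel_left, smul_smul]
      · refine ⟨s + t * (1 - s), by nlinarith, by nlinarith, ?_⟩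
        have : b - (a + s • (b - a)) = (1 - s) • (b - a) := by rw [sub_smul, one_smul]; abel
        rw [this, smul_smul, add_assoc, ← add_smul]
  · rw [Set.disjoint_left]
    intro x h1 h2
    obtain ⟨t, h0, h1, rfl⟩ := mem_hseg.1 h1
    obtain ⟨u, h2, h3, hu⟩ := mem_hseg.1 h2
    have e : b - (a + s • (b - a)) = (1 - s) • (b - a) := by rw [sub_smul, one_smul]; abel
    rw [e, add_sub_cancel_left, smul_smul, smul_smul, add_assoc, ← add_smul, add_right_inj] at hu
    have := smul_left_injective ℝ hba hu
    nlinarith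

theorem through_hseg_subdivide {a b c : E} (h : c ∈ openSegment ℝ a b) (hab : a ≠ b) (x : E) :
    through (hseg a b) x = through (hseg a c) x + through (hseg c b) x := by
  classical
  obtain ⟨h1, h2⟩ := (hseg_subdivide h).resolve_right hab
  simp only [h1, through_eq_ite]
  by_cases ha : x ∈ hseg a c
  · have := Set.disjoint_left.1 h2 ha; simp [ha, this]
  · simp [ha]

theorem passes_subdivide {a b c : E} (h : c ∈ openSegment ℝ a b) (hab : a ≠ b) (l : List E)
    (e x : E) : passes (a :: c :: b :: l) e x = passes (a :: b :: l) e x := by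
  rw [passes_cons, passes_cons c, passes_cons a (b :: l)]
  simp only [start_cons]
  rw [through_hseg_subdivide h hab]; ring

/-! Images under injective affine maps, and position relative to a half space. -/

section Map

variable {F : Type*} [AddCommGroup F] [Module ℝ F]

theorem hseg_map (φ : E →ᵃ[ℝ] F) (a b : E) : hseg (φ a) (φ b) = φ '' hseg a b := by
  rw [hseg, hseg, Set.image_image]
  refine Set.image_congr fun t _ => ?_
  rw [AffineMap.apply_lineMap]

theorem path_map (φ : E →ᵃ[ℝ] F) (l : List E) (e : E) :
    path (l.map φ) (φ e) = φ '' path l e := by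
  induction l with
  | nil => simp
  | cons a l ih => rw [List.map_cons, path_cons, ih, start_map, hseg_map, path_cons, Set.image_union]

theorem passes_map {φ : E →ᵃ[ℝ] F} (hφ : Function.Injective φ) (l : List E) (e x : E) :
    passes (l.map φ) (φ e) (φ x) = passes l e x := by
  induction l with
  | nil => simp
  | cons a l ih =>
    rw [List.map_cons, passes_cons, ih, start_map, hseg_map, passes_cons,
      through_image hφ]

theorem SimplePath.map {φ : E →ᵃ[ℝ] F} (hφ : Function.Injective φ) {l : List E} {e : E}
    (h : SimplePath l e) : SimplePath (l.map φ) (φ e) := by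
  intro x
  by_cases hx : x ∈ path (l.map φ) (φ e)
  · rw [path_map] at hx
    obtain ⟨y, -, rfl⟩ := hx
    rw [passes_map hφ]; exact h y
  · rw [passes_eq_zero.2 hx]; exact zero_le_one

theorem IsSimple.map {φ : E →ᵃ[ℝ] F} (hφ : Function.Injective φ) {l : List E}
    (h : IsSimple l) : IsSimple (l.map φ) := by
  cases l with
  | nil => exact absurd h.1 (by simp)
  | cons a l =>
    rw [List.map_cons, isSimple_cons_iff, List.length_map]
    rw [isSimple_cons_iff] at h
    exact ⟨h.1, h.2.map hφ⟩

end Map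

theorem path_subset_convex {s : Set E} (hs : Convex ℝ s) {l : List E} {e : E}
    (hl : ∀ a ∈ l, a ∈ s) (he : e ∈ s) : path l e ⊆ s := by
  induction l with
  | nil => simp
  | cons a l ih =>
    rw [path_cons]
    refine Set.union_subset ?_ (ih fun b hb => hl b (by simp [hb]))
    refine (hseg_subset_segment _ _).trans (hs.segment_subset (hl a (by simp)) ?_)
    cases l with
    | nil => exact he
    | cons b l => exact hl b (by simp)

theorem lt_of_mem_hseg {f : E →ₗ[ℝ] ℝ} {a b x : E} {c : ℝ} (ha : c < f a) (hb : c ≤ f b)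
    (hx : x ∈ hseg a b) : c < f x := by
  obtain ⟨t, h0, h1, rfl⟩ := mem_hseg.1 hx
  rw [map_add, map_smul, map_sub, smul_eq_mul]; nlinarith

theorem lt_of_mem_hseg' {f : E →ₗ[ℝ] ℝ} {a b x : E} {c : ℝ} (ha : c ≤ f a) (hb : c < f b)
    (hx : x ∈ hseg a b) : c < f x ∨ x = a := by
  obtain ⟨t, h0, h1, rfl⟩ := mem_hseg.1 hx
  rcases h0.lt_or_eq with h | rfl
  · left; rw [map_add, map_smul, map_sub, smul_eq_mul]; nlinarith
  · right; simp

theorem lt_of_mem_path {f : E →ₗ[ℝ] ℝ} {l : List E} {e x : E} {c : ℝ} (hl : ∀ a ∈ l, c < f a)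
    (he : c ≤ f e) (hx : x ∈ path l e) : c < f x := by
  induction l with
  | nil => simp at hx
  | cons a l ih =>
    rcases hx with hx | hx
    · refine lt_of_mem_hseg (hl a (by simp)) ?_ hx
      cases l with
      | nil => exact he
      | cons b l => exact (hl b (by simp)).le
    · exact ih (fun b hb => hl b (by simp [hb])) hx

/-- Half-open edges contain their start and not their end, so if only `P` and the excluded end `e`
may touch the plane, then `P` is the only possible point of contact. For empty `l` the single edge
`Pe` could lie in the plane. -/
theorem lt_or_eq_of_mem_path {f : E →ₗ[ℝ] ℝ} {P : E} {l : List E} {e x : E} {c : ℝ} (hne : l ≠ [])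
    (hP : c ≤ f P) (hl : ∀ a ∈ l, c < f a) (he : c ≤ f e) (hx : x ∈ path (P :: l) e) :
    c < f x ∨ x = P := by
  rcases hx with hx | hx
  · cases l with
    | nil => simp at hne
    | cons b l => exact lt_of_mem_hseg' hP (hl b (by simp)) hx
  · exact Or.inl (lt_of_mem_path hl he hx)

theorem gt_or_eq_of_mem_path {f : E →ₗ[ℝ] ℝ} {P : E} {l : List E} {e x : E} {c : ℝ} (hne : l ≠ [])
    (hP : f P ≤ c) (hl : ∀ a ∈ l, f a < c) (he : f e ≤ c) (hx : x ∈ path (P :: l) e) :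
    f x < c ∨ x = P := by
  have := lt_or_eq_of_mem_path (f := -f) (c := -c) hne (by simpa) (by simpa using hl) (by simpa) hx
  simpa using this

theorem mem_path_of_mem {l : List E} {e v : E} (h : v ∈ l) : v ∈ path l e := by
  induction l with
  | nil => simp at h
  | cons a l ih =>
    rcases List.mem_cons.1 h with rfl | h
    · exact Or.inl (left_mem_hseg _ _)
    · exact Or.inr (ih h)

/-- Removing an initial piece of an edge, or a final piece, leaves a subset. -/
theorem hseg_subset_hseg {a b p q : E} {s t : ℝ} (hs : 0 ≤ s) (hst : s ≤ t) (ht : t ≤ 1)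
    (hs1 : s < 1) (hp : p = a + s • (b - a)) (hq : q = a + t • (b - a)) :
    hseg p q ⊆ hseg a b := by
  rintro x hx
  obtain ⟨u, h0, h1, rfl⟩ := mem_hseg.1 hx
  rw [mem_hseg]
  refine ⟨s + u * (t - s), by nlinarith, ?_, ?_⟩
  · rcases hst.lt_or_eq with h | rfl
    · nlinarith
    · simpa
  · have : q - p = (t - s) • (b - a) := by rw [hp, hq, sub_smul]; abel
    rw [this, hp, smul_smul, add_assoc, ← add_smul]

end Path

end KnotTheory


namespace KnotTheory

/-! ### Oriented isotopy of closed polygons -/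

/-- The elementary steps between simple closed polygons that preserve the orientation. -/
inductive OrientedStep : List Space → List Space → Prop
  | rotate (a : Space) (l : List Space) : IsSimple (a :: l) → OrientedStep (a :: l) (l ++ [a])
  | delta (a b c : Space) (l : List Space) : IsSimple (a :: b :: l) → IsSimple (a :: c :: b :: l) →
      convexHull ℝ {a, b, c} ∩ carrier (a :: b :: l) = segment ℝ a b →
      OrientedStep (a :: b :: l) (a :: c :: b :: l)

/-- Oriented isotopy of closed polygons. -/
def Isotopic : List Space → List Space → Prop := Relation.EqvGen OrientedStep

theorem Isotopic.refl (l : List Space) : Isotopic l l := Relation.EqvGen.refl l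

theorem Isotopic.symm {l l' : List Space} (h : Isotopic l l') : Isotopic l' l :=
  Relation.EqvGen.symm _ _ h

theorem Isotopic.trans {l l' l'' : List Space} (h : Isotopic l l') (h' : Isotopic l' l'') :
    Isotopic l l'' := Relation.EqvGen.trans _ _ _ h h'

theorem IsSimple.rotate {E : Type*} [AddCommGroup E] [Module ℝ E] {a : E} {l : List E}
    (h : IsSimple (a :: l)) : IsSimple (l ++ [a]) := by
  cases l with
  | nil => exact absurd h.1 (by simp)
  | cons b l =>
    rw [isSimple_cons_iff] at h
    rw [List.cons_append, isSimple_cons_iff]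
    refine ⟨by simpa using h.1, fun x => ?_⟩
    have := passes_rotate a (b :: l) x (by simp)
    rw [start_cons, List.cons_append] at this
    rw [this]; exact h.2 x

theorem OrientedStep.isSimple_left {l l' : List Space} (h : OrientedStep l l') : IsSimple l := by
  cases h <;> assumption

theorem OrientedStep.isSimple_right {l l' : List Space} (h : OrientedStep l l') : IsSimple l' := by
  cases h with
  | rotate a l h => exact h.rotate
  | delta a b c l h h' _ => exact h'

/-- Only an equivalence can hold, since reflexivity relates non-simple lists to themselves as well.
-/
theorem Isotopic.isSimple_iff {l l' : List Space} (h : Isotopic l l') :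
    IsSimple l ↔ IsSimple l' := by
  induction h with
  | rel _ _ h => exact iff_of_true h.isSimple_left h.isSimple_right
  | refl => rfl
  | symm _ _ _ ih => exact ih.symm
  | trans _ _ _ _ _ h1 h2 => exact h1.trans h2

theorem Isotopic.equivalent {l l' : List Space} (h : Isotopic l l') (hl : IsSimple l)
    (hl' : IsSimple l') : Equivalent ⟨l, hl⟩ ⟨l', hl'⟩ := by
  induction h with
  | rel _ _ h =>
    refine Relation.EqvGen.rel _ _ ?_
    cases h with
    | rotate a l h => exact Step.rotate _ _ (by simp)
    | delta a b c l _ _ h => exact Step.delta _ _ a b c l rfl rfl h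
  | refl => exact Relation.EqvGen.refl _
  | symm _ _ _ ih => exact Relation.EqvGen.symm _ _ (ih hl' hl)
  | trans _ _ _ h1 _ ih1 ih2 =>
    have := (Isotopic.isSimple_iff h1).1 hl
    exact Relation.EqvGen.trans _ _ _ (ih1 hl this) (ih2 this hl')

theorem isotopic_append_comm {l₁ l₂ : List Space} (h : IsSimple (l₁ ++ l₂)) :
    Isotopic (l₁ ++ l₂) (l₂ ++ l₁) := by
  induction l₁ generalizing l₂ with
  | nil => rw [List.append_nil, List.nil_append]; exact Isotopic.refl _
  | cons a l ih =>
    have h1 : Isotopic (a :: l ++ l₂) (l ++ (l₂ ++ [a])) := by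
      rw [← List.append_assoc]
      exact Relation.EqvGen.rel _ _ (OrientedStep.rotate a (l ++ l₂) h)
    have := ih ((Isotopic.isSimple_iff h1).1 h)
    rw [List.append_assoc] at this
    exact h1.trans this

theorem isotopic_rotate {a : Space} {l : List Space} (h : IsSimple (a :: l)) :
    Isotopic (a :: l) (l ++ [a]) := isotopic_append_comm (l₁ := [a]) h

theorem mem_triangle {E : Type*} [AddCommGroup E] [Module ℝ E] {a b c x : E}
    (h : x ∈ convexHull ℝ {a, b, c}) :
    ∃ u v : ℝ, 0 ≤ u ∧ 0 ≤ v ∧ u + v ≤ 1 ∧ x = a + u • (b - a) + v • (c - a) := by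
  rw [convexHull_insert (by simp), convexHull_pair] at h
  simp only [convexJoin_singleton_left, Set.mem_iUnion] at h
  obtain ⟨y, hy, hx⟩ := h
  obtain ⟨t, ht0, ht1, rfl⟩ := mem_segment_iff.1 hy
  obtain ⟨s, hs0, hs1, rfl⟩ := mem_segment_iff.1 hx
  refine ⟨s * (1 - t), s * t, mul_nonneg hs0 (by linarith), by positivity, by nlinarith, ?_⟩
  module

theorem segment_subset_triangle {E : Type*} [AddCommGroup E] [Module ℝ E] (a b c : E) :
    segment ℝ a b ⊆ convexHull ℝ {a, b, c} ∧ segment ℝ a c ⊆ convexHull ℝ {a, b, c} ∧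
      segment ℝ c b ⊆ convexHull ℝ {a, b, c} := by
  have hc := convex_convexHull ℝ ({a, b, c} : Set E)
  have ha : a ∈ convexHull ℝ ({a, b, c} : Set E) := subset_convexHull _ _ (by simp)
  have hb : b ∈ convexHull ℝ ({a, b, c} : Set E) := subset_convexHull _ _ (by simp)
  have hc' : c ∈ convexHull ℝ ({a, b, c} : Set E) := subset_convexHull _ _ (by simp)
  exact ⟨hc.segment_subset ha hb, hc.segment_subset ha hc', hc.segment_subset hc' hb⟩

theorem IsSimple.ne {E : Type*} [AddCommGroup E] [Module ℝ E] {a b : E} {l : List E}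
    (h : IsSimple (a :: b :: l)) : a ≠ b := by
  rw [isSimple_cons_iff, simplePath_cons] at h
  rintro rfl
  exact Set.disjoint_left.1 h.2.2 (left_mem_hseg _ _) (mem_path_of_mem (by simp))

theorem coeff_eq_zero {E : Type*} [AddCommGroup E] [Module ℝ E] {a b c : E}
    (hc : ∀ t : ℝ, a + t • (b - a) ≠ c) {u v : ℝ} (h : u • (b - a) + v • (c - a) = 0) :
    v = 0 := by
  by_contra hv
  refine hc (-u / v) ?_
  have : c - a = (-u / v) • (b - a) := by
    have h2 : v • (c - a) = (-u) • (b - a) := by rw [neg_smul]; exact eq_neg_of_add_eq_zero_right h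
    rw [div_eq_inv_mul, mul_smul, ← h2, smul_smul, inv_mul_cancel₀ hv, one_smul]
  rw [← this]; abel

/-- A `Δ`-move over a nondegenerate triangle. -/
theorem isotopic_insert {a b c : Space} {l : List Space} (h : IsSimple (a :: b :: l))
    (hc : ∀ t : ℝ, a + t • (b - a) ≠ c)
    (htri : ∀ x ∈ convexHull ℝ {a, b, c}, x ∈ path (b :: l) a → x = b) :
    Isotopic (a :: b :: l) (a :: c :: b :: l) := by
  have hab := h.ne
  have h' := h
  rw [isSimple_cons_iff, simplePath_cons] at h
  obtain ⟨hl, hs, hd⟩ := h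
  obtain ⟨t1, t2, t3⟩ := segment_subset_triangle a b c
  have hcb : c ≠ b := fun e => hc 1 (by rw [e]; simp)
  have hac : a ≠ c := fun e => hc 0 (by rw [e]; simp)
  have ha : a ∉ path (b :: l) a := Set.disjoint_left.1 hd (left_mem_hseg _ _)
  refine Relation.EqvGen.rel _ _ (OrientedStep.delta a b c l h' ?_ ?_)
  · rw [isSimple_cons_iff, simplePath_cons, simplePath_cons]
    refine ⟨by simp, ⟨hs, Set.disjoint_left.2 fun x hx hx' => ?_⟩,
      Set.disjoint_left.2 fun x hx hx' => ?_⟩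
    · rw [htri x (t3 (hseg_subset_segment _ _ hx)) hx'] at hx
      exact right_notMem_hseg hcb hx
    · rw [path_cons, start_cons] at hx'
      obtain ⟨t, ht0, ht1, rfl⟩ := mem_hseg.1 hx
      rcases hx' with hx' | hx'
      · obtain ⟨s, hs0, hs1, e⟩ := mem_hseg.1 hx'
        have : (-s) • (b - a) + (t - (1 - s)) • (c - a) = 0 := by
          have : (-s) • (b - a) + (t - (1 - s)) • (c - a) =
            (a + t • (c - a)) - (c + s • (b - c)) := by module
          rw [this, e, sub_self]
        have h1 := coeff_eq_zero hc this
        rw [h1, zero_smul, add_zero, neg_smul, neg_eq_zero, smul_eq_zero] at this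
        rcases this with h2 | h2
        · linarith
        · exact hab (sub_eq_zero.1 h2).symm
      · have e := htri _ (t2 (hseg_subset_segment _ _ hx)) hx'
        have : (-1 : ℝ) • (b - a) + t • (c - a) = 0 := by
          have : (-1 : ℝ) • (b - a) + t • (c - a) = (a + t • (c - a)) - b := by module
          rw [this, e, sub_self]
        have h1 := coeff_eq_zero hc this
        rw [h1, zero_smul, add_zero] at e
        exact hab e
  · rw [carrier_eq (by simp), start_cons, path_cons, start_cons]
    refine Set.Subset.antisymm ?_ ?_
    · rintro x ⟨hx, hx' | hx'⟩
      · exact hseg_subset_segment _ _ hx'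
      · rw [htri x hx hx']; exact right_mem_segment _ _ _
    · intro x hx
      refine ⟨t1 hx, ?_⟩
      rw [segment_eq_hseg_union] at hx
      rcases hx with hx | hx
      · exact Or.inl hx
      · rw [Set.mem_singleton_iff.1 hx]; exact Or.inr (mem_path_of_mem (by simp))

/-- The triangle degenerates to the edge itself, so the condition on the `Δ`-move is automatic. -/
theorem isotopic_subdivide {a b c : Space} {l : List Space} (h : IsSimple (a :: b :: l))
    (hc : c ∈ openSegment ℝ a b) : Isotopic (a :: b :: l) (a :: c :: b :: l) := by
  have hab := h.ne
  have h' := h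
  rw [isSimple_cons_iff] at h
  have htri : convexHull ℝ {a, b, c} = segment ℝ a b := by
    rw [← convexHull_pair]
    refine Set.Subset.antisymm (convexHull_min ?_ (convex_convexHull _ _))
      (convexHull_mono (by intro x; simp; tauto))
    intro x hx
    rcases hx with rfl | rfl | rfl
    · exact subset_convexHull _ _ (by simp)
    · exact subset_convexHull _ _ (by simp)
    · rw [convexHull_pair]; exact openSegment_subset_segment _ _ _ hc
  refine Relation.EqvGen.rel _ _ (OrientedStep.delta a b c l h' ?_ ?_)
  · rw [isSimple_cons_iff]
    exact ⟨by simp, fun x => by rw [passes_subdivide hc hab]; exact h.2 x⟩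
  · rw [htri, Set.inter_eq_left, carrier_eq (by simp), segment_eq_hseg_union]
    rintro x (hx | hx)
    · exact Or.inl hx
    · rw [Set.mem_singleton_iff.1 hx]; exact Or.inr (mem_path_of_mem (by simp))

/-- Insertion of a vertex into an inner edge of the vertex list. -/
theorem isotopic_subdivide_append {l₁ l₂ : List Space} {a b c : Space}
    (h : IsSimple (l₁ ++ a :: b :: l₂)) (hc : c ∈ openSegment ℝ a b) :
    Isotopic (l₁ ++ a :: b :: l₂) (l₁ ++ a :: c :: b :: l₂) := by
  have h1 := isotopic_append_comm h
  have h2 : Isotopic (a :: b :: (l₂ ++ l₁)) (a :: c :: b :: (l₂ ++ l₁)) :=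
    isotopic_subdivide (h1.isSimple_iff.1 h) hc
  have h3 := h2.isSimple_iff.1 (h1.isSimple_iff.1 h)
  exact h1.trans (h2.trans (isotopic_append_comm (l₁ := a :: c :: b :: l₂) h3))

/-- Subdivision of the edge that closes the polygon. -/
theorem isotopic_subdivide_last {l : List Space} {a b c : Space}
    (h : IsSimple (b :: l ++ [a])) (hc : c ∈ openSegment ℝ a b) :
    Isotopic (b :: l ++ [a]) (b :: l ++ [a, c]) := by
  have h1 := isotopic_append_comm h
  have h2 : Isotopic (a :: b :: l) (a :: c :: b :: l) :=
    isotopic_subdivide (h1.isSimple_iff.1 h) hc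
  have h3 := h2.isSimple_iff.1 (h1.isSimple_iff.1 h)
  exact h1.trans (h2.trans (isotopic_append_comm (l₁ := [a, c]) h3))

/-! ### Generic points -/

/-- A nonempty open set is not covered by finitely many proper affine subspaces. -/
theorem exists_mem_avoiding {n : ℕ} {O : Set (Fin n → ℝ)} (hO : IsOpen O) (hne : O.Nonempty)
    {ι : Type*} (S : Set ι) (hS : S.Finite) (A : ι → AffineSubspace ℝ (Fin n → ℝ))
    (hA : ∀ i ∈ S, A i ≠ ⊤) : ∃ x ∈ O, ∀ i ∈ S, x ∉ A i := by
  by_contra hcon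
  push Not at hcon
  have h0 : MeasureTheory.volume (⋃ i ∈ S, (A i : Set (Fin n → ℝ))) = 0 := by
    rw [MeasureTheory.measure_biUnion_null_iff hS.countable]
    exact fun i hi => MeasureTheory.Measure.addHaar_affineSubspace _ _ (hA i hi)
  have h1 : O ⊆ ⋃ i ∈ S, (A i : Set (Fin n → ℝ)) := fun x hx => by
    obtain ⟨i, hi, hx⟩ := hcon x hx
    exact Set.mem_biUnion hi hx
  exact (hO.measure_pos MeasureTheory.volume hne).ne' (MeasureTheory.measure_mono_null h1 h0)

theorem affineSpan_ne_top {n : ℕ} (s : Finset (Fin n → ℝ)) (hs : s.card ≤ n) :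
    affineSpan ℝ (s : Set (Fin n → ℝ)) ≠ ⊤ := by
  intro h
  rcases s.eq_empty_or_nonempty with rfl | hne
  · simp at h
  · have h1 := finrank_vectorSpan_image_finset_le ℝ (id : (Fin n → ℝ) → _) s (n := s.card - 1)
      (by have := hne.card_pos; omega)
    rw [← direction_affineSpan, Finset.image_id, h, AffineSubspace.direction_top, finrank_top,
      Module.finrank_fin_fun] at h1
    have := hne.card_pos
    omega

end KnotTheory


namespace KnotTheory

/-! ### Moving one vertex -/

/-- The vertex is moved by two `Δ`-moves: `w` is inserted into the edge `av`, then `v` is removed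
between `w` and `b`. The two triangles are swept by the edges that join `a` and `b` to the points
between `v` and `w`, and these edges belong to simple polygons. As `w` is off the plane `avb`, the
triangles do not interfere with each other's edges. -/
theorem isotopic_move_generic {a v b w : Space} {r : List Space}
    (hall : ∀ t : ℝ, 0 ≤ t → t ≤ 1 → IsSimple (a :: (v + t • (w - v)) :: b :: r))
    (gen : ∀ x y : ℝ, a + x • (v - a) + y • (b - a) ≠ w) :
    Isotopic (a :: v :: b :: r) (a :: w :: b :: r) := by
  have gen' : ∀ s x y : ℝ, s • (w - a) = x • (v - a) + y • (b - a) → s = 0 := by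
    intro s x y h
    by_contra hs
    refine gen (x / s) (y / s) ?_
    have : w - a = s⁻¹ • (x • (v - a) + y • (b - a)) := by
      rw [← h, smul_smul, inv_mul_cancel₀ hs, one_smul]
    have e : w = a + (w - a) := by abel
    rw [e, this, div_eq_inv_mul, div_eq_inv_mul]; module
  have hv : IsSimple (a :: v :: b :: r) := by simpa using hall 0 le_rfl zero_le_one
  have hw : IsSimple (a :: w :: b :: r) := by simpa using hall 1 zero_le_one le_rfl
  have hav := hv.ne
  have hav' := hv
  rw [isSimple_cons_iff, simplePath_cons, simplePath_cons] at hav'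
  obtain ⟨-, ⟨-, hd2⟩, hd1⟩ := hav'
  have hd : ∀ t : ℝ, 0 ≤ t → t ≤ 1 → ∀ x ∈ path (b :: r) a,
      x ∉ hseg a (v + t • (w - v)) ∧ x ∉ hseg (v + t • (w - v)) b := by
    intro t h0 h1 x hx
    have := hall t h0 h1
    rw [isSimple_cons_iff, simplePath_cons, simplePath_cons] at this
    obtain ⟨-, ⟨-, h2⟩, h1⟩ := this
    exact ⟨fun h => Set.disjoint_left.1 h1 h (Or.inr hx), fun h => Set.disjoint_left.1 h2 h hx⟩
  have ha : a ∉ path (b :: r) a := fun h => (hd 0 le_rfl zero_le_one a h).1 (left_mem_hseg _ _)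
  have step1 : Isotopic (a :: v :: b :: r) (a :: w :: v :: b :: r) := by
    refine isotopic_insert hv (fun t h => gen t 0 (by rw [zero_smul, add_zero, h])) ?_
    intro x hx hx'
    obtain ⟨u, s, hu, hs, hus, rfl⟩ := mem_triangle hx
    rcases hx' with hx' | hx'
    · rw [start_cons] at hx'
      obtain ⟨q, hq0, hq1, e⟩ := mem_hseg.1 hx'
      have h0 : s = 0 := gen' s (1 - q - u) q (by
        have : s • (w - a) = (a + u • (v - a) + s • (w - a)) - a - u • (v - a) := by abel
        rw [this, e]; module)
      subst h0
      rw [zero_smul, add_zero] at hx' ⊢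
      rcases lt_or_ge u 1 with h1 | h1
      · exact absurd (Or.inl hx') (Set.disjoint_left.1 hd1 (mem_hseg.2 ⟨u, hu, h1, rfl⟩))
      · have : u = 1 := by linarith
        rw [this]; module
    · exfalso
      rcases (add_nonneg hu hs).lt_or_eq with h0 | h0
      -- A point of the triangle `avw` other than `a` lies on the segment from `a` to the moving
      -- vertex at time `s / (u + s)`.
      · have e : a + u • (v - a) + s • (w - a) =
            a + (u + s) • ((v + (s / (u + s)) • (w - v)) - a) := by
          have : u + s ≠ 0 := h0.ne'
          have e1 : (u + s) * (s / (u + s)) = s := by field_simp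
          rw [smul_sub (u + s), smul_add (u + s), smul_smul, e1]; module
        have ht0 : 0 ≤ s / (u + s) := by positivity
        have ht1 : s / (u + s) ≤ 1 := by rw [div_le_one h0]; linarith
        rcases hus.lt_or_eq with h1 | h1
        · exact (hd _ ht0 ht1 _ hx').1 (mem_hseg.2 ⟨u + s, h0.le, h1, e⟩)
        · refine (hd _ ht0 ht1 _ hx').2 ?_
          rw [e, h1, one_smul, add_sub_cancel]
          exact left_mem_hseg _ _
      · have e1 : u = 0 := by linarith
        have e2 : s = 0 := by linarith
        rw [e1, e2] at hx'
        simp only [zero_smul, add_zero] at hx'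
        exact ha hx'
  have hw' : IsSimple (w :: b :: (r ++ [a])) := hw.rotate
  have step2 : Isotopic (w :: b :: (r ++ [a])) (w :: v :: b :: (r ++ [a])) := by
    have hvb : v ≠ b := by
      rintro rfl
      exact Set.disjoint_left.1 hd2 (left_mem_hseg _ _) (mem_path_of_mem (by simp))
    refine isotopic_insert hw' (fun t h => ?_) ?_
    · have h1 : (1 - t) = 0 := gen' (1 - t) 1 (-t) (by
        have : (1 - t) • (w - a) = (w + t • (b - w)) - a + (-t) • (b - a) := by module
        rw [this, h]; module)
      have : t = 1 := by linarith
      rw [this, one_smul, add_sub_cancel] at h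
      exact hvb h.symm
    intro x hx hx'
    obtain ⟨u, s, hu, hs, hus, rfl⟩ := mem_triangle hx
    rw [← List.cons_append, path_append] at hx'
    rcases hx' with hx' | hx'
    · rcases (show u ≤ 1 by linarith).lt_or_eq with h1 | h1
      · exfalso
        have h1' : 0 < 1 - u := by linarith
        -- Likewise, a point of the triangle `wbv` other than `b` lies on the edge to `b` from the
        -- moving vertex at time `1 - s / (1 - u)`.
        have e1 : (1 - u) * (1 - s / (1 - u)) = 1 - u - s := by field_simp
        refine (hd (1 - s / (1 - u)) ?_ ?_ _ hx').2 (mem_hseg.2 ⟨u, hu, h1, ?_⟩)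
        · rw [sub_nonneg, div_le_one h1']; linarith
        · have : 0 ≤ s / (1 - u) := by positivity
          linarith
        · have : v + (1 - s / (1 - u)) • (w - v) + u • (b - (v + (1 - s / (1 - u)) • (w - v))) =
              (1 - u) • v + ((1 - u) * (1 - s / (1 - u))) • (w - v) + u • b := by module
          rw [this, e1]; module
      · have : s = 0 := by linarith
        rw [this, h1]; module
    · exfalso
      simp only [path_cons, start_nil, path_nil, Set.union_empty] at hx'
      obtain ⟨q, hq0, hq1, e⟩ := mem_hseg.1 hx'
      -- The coefficient of `w` vanishes because `w` is off the plane `avb`; this puts `a` on the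
      -- segment `vb`, which is impossible in a simple polygon.
      have h0 : 1 - u - s - q = 0 := gen' _ (-s) (-u) (by
        have : (1 - u - s - q) • (w - a) = (w + u • (b - w) + s • (v - w)) - (a + q • (w - a))
          + (-s) • (v - a) + (-u) • (b - a) := by module
        rw [this, e]; module)
      have hq : 0 < 1 - q := by linarith
      have hsu : (1 - q) = u + s := by linarith
      have ea : a = v + (u / (1 - q)) • (b - v) := by
        have e3 : (1 - q) • a = s • v + u • b := by
          have : (1 - q) • a = (a + q • (w - a)) - q • w := by module
          rw [this, ← e, show q = 1 - u - s by linarith]; module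
        have e4 : (1 - q) • a = (1 - q) • (v + (u / (1 - q)) • (b - v)) := by
          rw [e3, smul_add, smul_smul, mul_div_cancel₀ _ hq.ne', hsu]; module
        have := congrArg ((1 - q)⁻¹ • ·) e4
        simpa only [smul_smul, inv_mul_cancel₀ hq.ne', one_smul] using this
      rcases (show u / (1 - q) ≤ 1 by rw [div_le_one hq]; linarith).lt_or_eq with h1 | h1
      · exact Set.disjoint_left.1 hd1 (left_mem_hseg a v)
          (Or.inl (mem_hseg.2 ⟨_, by positivity, h1, ea⟩))
      · rw [h1, one_smul, add_sub_cancel] at ea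
        rw [ea] at ha
        exact ha (mem_path_of_mem (by simp))
  have r1 : Isotopic (a :: w :: b :: r) (w :: b :: (r ++ [a])) := isotopic_rotate hw
  have r2 : Isotopic (a :: w :: v :: b :: r) (w :: v :: b :: (r ++ [a])) :=
    isotopic_rotate (step1.isSimple_iff.1 hv)
  exact step1.trans (r2.trans (step2.symm.trans r1.symm))

/-- Both positions are joined to a third one off the planes `axb` and `ax'b`, so that the generic
case applies twice. -/
theorem isotopic_move_second {a x x' b : Space} {r : List Space} {O : Set Space} (hO : IsOpen O)
    (hc : Convex ℝ O) (hx : x ∈ O) (hx' : x' ∈ O) (h : ∀ y ∈ O, IsSimple (a :: y :: b :: r)) :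
    Isotopic (a :: x :: b :: r) (a :: x' :: b :: r) := by
  classical
  obtain ⟨w, hw, hS⟩ := exists_mem_avoiding hO ⟨x, hx⟩ ({x, x'} : Set Space) (by simp)
    (fun y => affineSpan ℝ (({a, y, b} : Finset Space) : Set Space))
    (fun y _ => affineSpan_ne_top _ Finset.card_le_three)
  have key : ∀ y ∈ O, w ∉ affineSpan ℝ (({a, y, b} : Finset Space) : Set Space) →
      Isotopic (a :: y :: b :: r) (a :: w :: b :: r) := by
    intro y hy hwy
    refine isotopic_move_generic (fun t h0 h1 => h _ ?_) ?_
    · have := hc.segment_subset hy hw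
      exact this (mem_segment_iff.2 ⟨t, h0, h1, rfl⟩)
    · rintro s t rfl
      apply hwy
      have m : ∀ z ∈ ({a, y, b} : Finset Space),
          z ∈ affineSpan ℝ (({a, y, b} : Finset Space) : Set Space) :=
        fun z hz => subset_affineSpan _ _ hz
      have e := (affineSpan ℝ (({a, y, b} : Finset Space) : Set Space)).smul_vsub_vadd_mem s
        (m y (by simp)) (m a (by simp)) (m a (by simp))
      have e2 := (affineSpan ℝ (({a, y, b} : Finset Space) : Set Space)).smul_vsub_vadd_mem t
        (m b (by simp)) (m a (by simp)) e
      convert e2 using 1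
      simp only [vsub_eq_sub, vadd_eq_add]; abel
  exact (key x hx (hS x (by simp))).trans (key x' hx' (hS x' (by simp))).symm

theorem isotopic_move_vertex {l₁ l₂ : List Space} {x x' : Space} {O : Set Space} (hO : IsOpen O)
    (hc : Convex ℝ O) (hx : x ∈ O) (hx' : x' ∈ O) (h : ∀ y ∈ O, IsSimple (l₁ ++ y :: l₂)) :
    Isotopic (l₁ ++ x :: l₂) (l₁ ++ x' :: l₂) := by
  have hlen : 2 ≤ (l₂ ++ l₁).length := by
    have := (h x hx).1; simp at this ⊢; omega
  obtain ⟨b, r, a, hbr⟩ : ∃ b r a, l₂ ++ l₁ = b :: r ++ [a] := by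
    rcases List.eq_nil_or_concat (l₂ ++ l₁) with h0 | ⟨m, a, h0⟩
    · rw [h0] at hlen; simp at hlen
    · cases m with
      | nil => rw [h0] at hlen; simp at hlen
      | cons b r => exact ⟨b, r, a, by simpa using h0⟩
  have key : ∀ y ∈ O, Isotopic (l₁ ++ y :: l₂) (a :: y :: b :: r) := by
    intro y hy
    have h1 := isotopic_append_comm (h y hy)
    have e : y :: l₂ ++ l₁ = y :: b :: r ++ [a] := by rw [List.cons_append, hbr]; simp
    rw [e] at h1
    exact h1.trans (isotopic_append_comm (h1.isSimple_iff.1 (h y hy)))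
  refine (key x hx).trans ((isotopic_move_second hO hc hx hx' fun y hy => ?_).trans
    (key x' hx').symm)
  exact (key y hy).isSimple_iff.1 (h y hy)

/-! ### Openness of simplicity, and isotopies of polygons -/

/-- Disjoint compact segments have disjoint thickenings, and these are convex, so a perturbed
segment stays in its thickening as soon as its ends do. -/
theorem eventually_disjoint_segment {X : Type*} {F : Filter X} {p q r s : X → Space}
    {p₀ q₀ r₀ s₀ : Space} (hp : Filter.Tendsto p F (nhds p₀)) (hq : Filter.Tendsto q F (nhds q₀))
    (hr : Filter.Tendsto r F (nhds r₀)) (hs : Filter.Tendsto s F (nhds s₀))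
    (h : Disjoint (segment ℝ p₀ q₀) (segment ℝ r₀ s₀)) :
    ∀ᶠ x in F, Disjoint (segment ℝ (p x) (q x)) (segment ℝ (r x) (s x)) := by
  have hcomp : ∀ a b : Space, IsCompact (segment ℝ a b) := fun a b => by
    rw [segment_eq_image_lineMap]
    exact isCompact_Icc.image (AffineMap.lineMap_continuous)
  obtain ⟨δ, hδ, hd⟩ := h.exists_thickenings (hcomp _ _) (hcomp _ _).isClosed
  have conv : ∀ a b : Space, Convex ℝ (Metric.thickening δ (segment ℝ a b)) :=
    fun a b => (convex_segment a b).thickening δ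
  have nb : ∀ a b c : Space, c ∈ segment ℝ a b → Metric.thickening δ (segment ℝ a b) ∈ nhds c :=
    fun a b c hc => Metric.isOpen_thickening.mem_nhds (Metric.self_subset_thickening hδ _ hc)
  filter_upwards [hp (nb p₀ q₀ p₀ (left_mem_segment _ _ _)),
    hq (nb p₀ q₀ q₀ (right_mem_segment _ _ _)), hr (nb r₀ s₀ r₀ (left_mem_segment _ _ _)),
    hs (nb r₀ s₀ s₀ (right_mem_segment _ _ _))] with x h1 h2 h3 h4
  exact hd.mono ((conv _ _).segment_subset h1 h2) ((conv _ _).segment_subset h3 h4)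

theorem isSimple_ofFn_iff {n : ℕ} [NeZero n] (v : Fin n → Space) :
    IsSimple (List.ofFn v) ↔
      3 ≤ n ∧ ∀ i j, i ≠ j → Disjoint (hseg (v i) (v (i + 1))) (hseg (v j) (v (j + 1))) := by
  have hv : ∀ i : ℕ, vertex (List.ofFn v) i = v (Fin.ofNat n i) := by
    intro i
    have : i % n < n := Nat.mod_lt _ (Nat.pos_of_neZero n)
    rw [vertex, List.length_ofFn, List.getD_eq_getElem _ _ (by simpa using this),
      List.getElem_ofFn]
    rfl
  have he : ∀ i : Fin n, edge (List.ofFn v) i = hseg (v i) (v (i + 1)) := by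
    intro i
    rw [edge, hv, hv, hseg]
    have e1 : Fin.ofNat n (i : ℕ) = i := by ext; simp
    have e2 : Fin.ofNat n ((i : ℕ) + 1) = i + 1 := by
      ext; simp [Fin.val_add]
    rw [e1, e2]
  rw [IsSimple, List.length_ofFn]
  refine and_congr_right fun _ => ⟨fun h i j hij => ?_, fun h i j hij hj => ?_⟩
  · rw [← he, ← he]
    rcases lt_or_gt_of_ne hij with h1 | h1
    · exact h i j h1 j.2
    · exact (h j i h1 i.2).symm
  · have := h ⟨i, hij.trans hj⟩ ⟨j, hj⟩ (by simpa using hij.ne)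
    rwa [← he, ← he] at this

/-- Half-open edges are not compact, and adjacent ones come arbitrarily close, so simplicity is
rewritten by conditions that are visibly stable: non-adjacent closed edges are disjoint, and at no
vertex does the path turn back on itself. The latter is phrased as disjointness from the segment
`00`, so that the same perturbation lemma covers both. -/
theorem isSimple_ofFn_iff_segments {n : ℕ} [NeZero n] (v : Fin n → Space) :
    IsSimple (List.ofFn v) ↔ 3 ≤ n ∧
      (∀ i j, i ≠ j → j ≠ i + 1 → i ≠ j + 1 →
        Disjoint (segment ℝ (v i) (v (i + 1))) (segment ℝ (v j) (v (j + 1)))) ∧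
      ∀ i, Disjoint (segment ℝ (v i - v (i + 1)) (v (i + 1) - v (i + 1 + 1)))
        (segment ℝ (0 : Space) 0) := by
  rw [isSimple_ofFn_iff]
  refine and_congr_right fun h3 => ⟨fun h => ?_, fun h => ?_⟩
  · have hne : ∀ i : Fin n, i ≠ i + 1 := by
      intro i e
      have : (1 : Fin n) = 0 := by simpa using e.symm
      have := congrArg Fin.val this
      simp [Nat.mod_eq_of_lt (show 1 < n by omega)] at this
    have hne2 : ∀ i : Fin n, i ≠ i + 1 + 1 := by
      intro i e
      have : (1 : Fin n) + 1 = 0 := by rw [add_assoc] at e; simpa using e.symm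
      have := congrArg Fin.val this
      simp [Fin.val_add, Nat.mod_eq_of_lt (show 1 < n by omega),
        Nat.mod_eq_of_lt (show 2 < n by omega)] at this
    have hd : ∀ i j x, i ≠ j → x ∈ hseg (v i) (v (i + 1)) → x ∈ hseg (v j) (v (j + 1)) → False :=
      fun i j x hij h1 h2 => Set.disjoint_left.1 (h i j hij) h1 h2
    have vne : ∀ i j, i ≠ j → v i ≠ v j := fun i j hij e =>
      hd i j (v i) hij (left_mem_hseg _ _) (e ▸ left_mem_hseg _ _)
    constructor
    · intro i j hij h1 h2
      rw [Set.disjoint_left]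
      intro x hx hy
      rw [segment_eq_hseg_union] at hx hy
      rcases hx with hx | hx <;> rcases hy with hy | hy
      · exact hd i j x hij hx hy
      · rw [Set.mem_singleton_iff.1 hy] at hx
        exact hd i (j + 1) _ h2 hx (left_mem_hseg _ _)
      · rw [Set.mem_singleton_iff.1 hx] at hy
        exact hd j (i + 1) _ h1 hy (left_mem_hseg _ _)
      · refine vne (i + 1) (j + 1) (by simpa using hij) ?_
        rw [← Set.mem_singleton_iff.1 hx, ← Set.mem_singleton_iff.1 hy]
    · intro i
      rw [segment_same, Set.disjoint_singleton_right, mem_segment_iff]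
      rintro ⟨s, hs0, hs1, e⟩
      set a := v i
      set w := v (i + 1)
      set b := v (i + 1 + 1)
      have e' : (1 - s) • (a - w) = s • (b - w) := by
        have : (1 - s) • (a - w) - s • (b - w) = a - w + s • (w - b - (a - w)) := by module
        rw [← sub_eq_zero, this, ← e]
      have haw : a ≠ w := vne _ _ (hne i)
      have hwb : w ≠ b := vne _ _ (hne (i + 1))
      rcases le_or_gt (1 - s) s with hle | hlt
      · have hs : 0 < s := by linarith
        refine hd i (i + 1 + 1) b (hne2 i) (mem_hseg.2 ⟨1 - (1 - s) / s, ?_, ?_, ?_⟩)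
          (left_mem_hseg _ _)
        · rw [sub_nonneg, div_le_one hs]; exact hle
        · rcases hs1.lt_or_eq with h1 | h1
          · have : 0 < (1 - s) / s := div_pos (by linarith) hs
            linarith
          · rw [h1] at e'
            simp only [sub_self, zero_smul, one_smul] at e'
            exact absurd (sub_eq_zero.1 e'.symm).symm hwb
        · have : b - w = ((1 - s) / s) • (a - w) := by
            rw [div_eq_inv_mul, mul_smul, e', smul_smul, inv_mul_cancel₀ hs.ne', one_smul]
          have h2 : b = w + ((1 - s) / s) • (a - w) := by rw [← this]; abel
          rw [h2]; module
      · have hs : 0 < 1 - s := by linarith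
        refine hd i (i + 1) a (hne i) (left_mem_hseg _ _) (mem_hseg.2 ⟨s / (1 - s), ?_, ?_, ?_⟩)
        · positivity
        · rw [div_lt_one hs]; exact hlt
        · have : a - w = (s / (1 - s)) • (b - w) := by
            rw [div_eq_inv_mul, mul_smul, ← e', smul_smul, inv_mul_cancel₀ hs.ne', one_smul]
          change a = w + (s / (1 - s)) • (b - w)
          rw [← this]; abel
  · have adj : ∀ i, Disjoint (hseg (v i) (v (i + 1))) (hseg (v (i + 1)) (v (i + 1 + 1))) := by
      intro i
      rw [Set.disjoint_left]
      intro x hx hy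
      obtain ⟨t, ht0, ht1, rfl⟩ := mem_hseg.1 hx
      obtain ⟨s, hs0, hs1, e⟩ := mem_hseg.1 hy
      have := h.2 i
      rw [segment_same, Set.disjoint_singleton_right, mem_segment_iff] at this
      apply this
      have hpos : 0 < 1 - t + s := by linarith
      refine ⟨s / (1 - t + s), by positivity, by rw [div_le_one hpos]; linarith, ?_⟩
      set a := v i
      set w := v (i + 1)
      set b := v (i + 1 + 1)
      have e1 : (1 - t + s) • (a - w + (s / (1 - t + s)) • (w - b - (a - w))) =
          (a + t • (w - a)) - (w + s • (b - w)) := by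
        rw [smul_add, smul_smul, mul_div_cancel₀ _ hpos.ne']; module
      rw [e, sub_self, smul_eq_zero] at e1
      exact (e1.resolve_left hpos.ne').symm
    intro i j hij
    by_cases h1 : j = i + 1
    · rw [h1]; exact adj i
    by_cases h2 : i = j + 1
    · rw [h2]; exact (adj j).symm
    exact (h.1 i j hij h1 h2).mono (hseg_subset_segment _ _) (hseg_subset_segment _ _)

theorem isOpen_isSimple (n : ℕ) : IsOpen {v : Fin n → Space | IsSimple (List.ofFn v)} := by
  rcases Nat.eq_zero_or_pos n with rfl | hn
  · convert isOpen_empty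
    ext v
    simp [IsSimple]
  have : NeZero n := ⟨hn.ne'⟩
  rw [isOpen_iff_mem_nhds]
  intro v hv
  obtain ⟨h3, hA, hB⟩ := (isSimple_ofFn_iff_segments v).1 hv
  have cont : ∀ i : Fin n, Filter.Tendsto (fun w : Fin n → Space => w i) (nhds v) (nhds (v i)) :=
    fun i => (continuous_apply i).tendsto v
  have e1 : ∀ᶠ w in nhds v, ∀ i j : Fin n, i ≠ j → j ≠ i + 1 → i ≠ j + 1 →
      Disjoint (segment ℝ (w i) (w (i + 1))) (segment ℝ (w j) (w (j + 1))) := by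
    simp only [Filter.eventually_all]
    exact fun i j h1 h2 h3 => eventually_disjoint_segment (cont _) (cont _) (cont _) (cont _)
      (hA i j h1 h2 h3)
  have e2 : ∀ᶠ w in nhds v, ∀ i : Fin n, Disjoint
      (segment ℝ (w i - w (i + 1)) (w (i + 1) - w (i + 1 + 1))) (segment ℝ (0 : Space) 0) := by
    simp only [Filter.eventually_all]
    exact fun i => eventually_disjoint_segment ((cont _).sub (cont _)) ((cont _).sub (cont _))
      tendsto_const_nhds tendsto_const_nhds (hB i)
  filter_upwards [e1, e2] with w h1 h2
  exact (isSimple_ofFn_iff_segments w).2 ⟨h3, h1, h2⟩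

/-- Small perturbations of a simple closed polygon are simple and isotopic to it. -/
theorem exists_ball_isotopic {n : ℕ} {v : Fin n → Space} (hv : IsSimple (List.ofFn v)) :
    ∃ ε > 0, ∀ w, dist w v < ε → IsSimple (List.ofFn w) ∧
      Isotopic (List.ofFn v) (List.ofFn w) := by
  classical
  obtain ⟨ε, hε, hball⟩ := Metric.isOpen_iff.1 (isOpen_isSimple n) v hv
  refine ⟨ε, hε, fun w hw => ⟨hball hw, ?_⟩⟩
  -- The vertices are moved one after another. All intermediate polygons lie in the same ball for
  -- the supremum distance and are therefore simple.
  have key : ∀ s : Finset (Fin n), Isotopic (List.ofFn v) (List.ofFn (s.piecewise w v)) := by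
    intro s
    induction s using Finset.induction_on with
    | empty => simpa using Isotopic.refl _
    | insert i s hi ih =>
      refine ih.trans ?_
      rw [Finset.piecewise_insert]
      set u := s.piecewise w v with hu
      have hset : ∀ y, List.ofFn (Function.update u i y) =
          (List.ofFn u).take i ++ y :: (List.ofFn u).drop (i + 1) := by
        intro y
        rw [← List.set_eq_take_cons_drop _ (by simp)]
        apply List.ext_getElem
        · simp
        · intro k h1 h2
          rw [List.getElem_ofFn, List.getElem_set, List.getElem_ofFn, Function.update_apply]
          by_cases hk : k = i
          · simp [hk]
          · have h1 : (⟨k, by simpa using h1⟩ : Fin n) ≠ i := fun e => hk (by rw [← e])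
            have h2 : (i : ℕ) ≠ k := fun e => hk e.symm
            simp [h1, h2]
      have hui : u = Function.update u i (u i) := by simp
      nth_rewrite 1 [hui]
      rw [hset, hset]
      refine isotopic_move_vertex (O := Metric.ball (v i) ε) Metric.isOpen_ball
        (convex_ball _ _) ?_ ?_ ?_
      · rw [hu]
        simp only [Finset.piecewise, hi, if_false]
        exact Metric.mem_ball_self hε
      · exact (dist_le_pi_dist w v i).trans_lt hw
      · intro y hy
        rw [← hset]
        apply hball
        rw [Metric.mem_ball, dist_pi_lt_iff hε]
        intro j
        rw [Function.update_apply]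
        split_ifs with hj
        · rw [hj]; exact hy
        · rw [hu]
          simp only [Finset.piecewise]
          split_ifs
          · exact (dist_le_pi_dist w v j).trans_lt hw
          · simpa using hε
  simpa using key Finset.univ

/-- A continuous family of simple closed polygons is an isotopy. -/
theorem isotopic_of_family {l : List (ℝ → Space)} (hl : ∀ g ∈ l, ContinuousOn g (Set.Icc 0 1))
    (hs : ∀ t ∈ Set.Icc (0 : ℝ) 1, IsSimple (l.map (· t))) :
    Isotopic (l.map (· 0)) (l.map (· 1)) := by
  set γ : ℝ → Fin l.length → Space := fun t i => l.get i t with hγ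
  have hof : ∀ t, l.map (· t) = List.ofFn (γ t) := by
    intro t
    apply List.ext_getElem <;> simp [hγ]
  have hcont : ContinuousOn γ (Set.Icc 0 1) :=
    continuousOn_pi.2 fun i => hl _ (List.get_mem _ _)
  simp only [hof] at hs ⊢
  have hpre : IsPreconnected (Set.Icc (0 : ℝ) 1) := isPreconnected_Icc
  have : PreconnectedSpace (Set.Icc (0 : ℝ) 1) := Subtype.preconnectedSpace hpre
  have hloc : ∀ t : Set.Icc (0 : ℝ) 1, ∀ᶠ s : Set.Icc (0 : ℝ) 1 in nhds t,
      Isotopic (List.ofFn (γ t)) (List.ofFn (γ s)) := by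
    intro t
    obtain ⟨ε, hε, hb⟩ := exists_ball_isotopic (hs t t.2)
    have hc : Continuous fun s : Set.Icc (0 : ℝ) 1 => γ s :=
      continuousOn_iff_continuous_domRestrict.1 hcont
    have : ∀ᶠ s : Set.Icc (0 : ℝ) 1 in nhds t, dist (γ s) (γ t) < ε :=
      (hc.tendsto t) (Metric.ball_mem_nhds _ hε)
    filter_upwards [this] with s hs
    exact (hb _ hs).2
  -- The times at which the polygon is isotopic to the initial one form a set that is open and
  -- closed in a connected interval.
  have hclopen : IsClopen {t : Set.Icc (0 : ℝ) 1 |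
      Isotopic (List.ofFn (γ (0 : ℝ))) (List.ofFn (γ t))} := by
    constructor
    · rw [← isOpen_compl_iff, isOpen_iff_mem_nhds]
      intro t ht
      filter_upwards [hloc t] with s hs hs'
      exact ht (Isotopic.trans hs' hs.symm)
    · rw [isOpen_iff_mem_nhds]
      intro t ht
      filter_upwards [hloc t] with s hs
      exact Isotopic.trans ht hs
  have huniv := hclopen.eq_univ ⟨⟨0, by simp⟩, Isotopic.refl _⟩
  have : (⟨1, by simp⟩ : Set.Icc (0 : ℝ) 1) ∈ {t : Set.Icc (0 : ℝ) 1 |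
      Isotopic (List.ofFn (γ (0 : ℝ))) (List.ofFn (γ t))} := by rw [huniv]; trivial
  exact this

end KnotTheory


namespace KnotTheory

/-! ### Paths of linear maps -/

/-- The invertible real `2 × 2`-matrices with positive determinant are connected by paths to the
identity. -/
theorem exists_path_two_by_two {a b c d : ℝ} (h : 0 < a * d - b * c) :
    ∃ p q r s : ℝ → ℝ, Continuous p ∧ Continuous q ∧ Continuous r ∧ Continuous s ∧
      (p 0 = 1 ∧ q 0 = 0 ∧ r 0 = 0 ∧ s 0 = 1) ∧ (p 1 = a ∧ q 1 = b ∧ r 1 = c ∧ s 1 = d) ∧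
      ∀ t ∈ Set.Icc (0 : ℝ) 1, 0 < p t * s t - q t * r t := by
  -- On `ℂ`, the matrix acts as `z ↦ αz + βz̄`, with determinant `|α|² - |β|²`. Below, `A` is a path
  -- from `1` to `α` without zeros, and `B` is a path from `0` to `β` with `|B| < |A|` throughout.
  set α : ℂ := ⟨(a + d) / 2, (c - b) / 2⟩ with hα
  set β : ℂ := ⟨(a - d) / 2, (c + b) / 2⟩ with hβ
  have hαβ : Complex.normSq β < Complex.normSq α := by
    rw [Complex.normSq_apply, Complex.normSq_apply]; simp only [hα, hβ]; nlinarith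
  have hα0 : α ≠ 0 := by
    intro e
    rw [e, map_zero] at hαβ
    exact (Complex.normSq_nonneg β).not_gt hαβ
  set A : ℝ → ℂ := fun t => Complex.exp (t * Complex.log α) with hA
  set B : ℝ → ℂ := fun t => t * (β / α) * A t with hB
  have hAc : Continuous A := by fun_prop
  have hBc : Continuous B := by fun_prop
  have A0 : A 0 = 1 := by simp [hA]
  have B0 : B 0 = 0 := by simp [hB]
  have A1 : A 1 = α := by simp [hA, Complex.exp_log hα0]
  have B1 : B 1 = β := by simp [hB, A1, div_mul_cancel₀ _ hα0]
  have reC := Complex.continuous_re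
  have imC := Complex.continuous_im
  refine ⟨fun t => (A t).re + (B t).re, fun t => (B t).im - (A t).im,
    fun t => (A t).im + (B t).im, fun t => (A t).re - (B t).re, by fun_prop, by fun_prop,
    by fun_prop, by fun_prop, ?_, ?_, ?_⟩
  · simp [A0, B0]
  · simp only [A1, B1, hα, hβ]; refine ⟨?_, ?_, ?_, ?_⟩ <;> ring
  · intro t ht
    have h1 : Complex.normSq (B t) < Complex.normSq (A t) := by
      have hpos : 0 < Complex.normSq (A t) := Complex.normSq_pos.2 (Complex.exp_ne_zero _)
      have h2 : Complex.normSq (β / α) < 1 := by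
        rw [map_div₀, div_lt_one (Complex.normSq_pos.2 hα0)]; exact hαβ
      have h3 : Complex.normSq (B t) = t * t * Complex.normSq (β / α) * Complex.normSq (A t) := by
        simp only [hB, map_mul, Complex.normSq_ofReal]
      rw [h3]
      have h4 : t * t ≤ 1 := by nlinarith [ht.1, ht.2]
      have h5 : t * t * Complex.normSq (β / α) < 1 := by
        have := Complex.normSq_nonneg (β / α)
        nlinarith [mul_self_nonneg t]
      nlinarith
    rw [Complex.normSq_apply, Complex.normSq_apply] at h1
    nlinarith

/-- Linear maps of positive determinant that stretch a given vector are joined to the identity. -/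
theorem exists_path_id {G : Space →ₗ[ℝ] Space} {h : Space} {μ : ℝ} (h0 : h ≠ 0) (hμ : 0 < μ)
    (hG : G h = μ • h) (hdet : 0 < LinearMap.det G) :
    ∃ N : ℝ → Space →ₗ[ℝ] Space, (∀ x, Continuous fun t => N t x) ∧ N 0 = LinearMap.id ∧ N 1 = G ∧
      ∀ t ∈ Set.Icc (0 : ℝ) 1, Function.Injective (N t) ∧ ∃ ν : ℝ, 0 < ν ∧ N t h = ν • h := by
  set e₀ : Space := Pi.single 0 1 with he0
  have he0' : e₀ ≠ 0 := by
    intro e; have := congrFun e 0; simp [he0] at this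
  obtain ⟨E, hE⟩ := SeparatingDual.exists_continuousLinearEquiv_apply_eq (R := ℝ) he0' h0
  set E' : Space ≃ₗ[ℝ] Space := E.toLinearEquiv with hE'
  have hEe : E' e₀ = h := hE
  -- After conjugation the stretched vector is the first basis vector, so the matrix is block
  -- triangular with corner `μ` and a lower block of positive determinant.
  set G' : Space →ₗ[ℝ] Space := E'.symm.toLinearMap ∘ₗ G ∘ₗ E'.toLinearMap with hG'
  set A := LinearMap.toMatrix' G' with hA
  have hcol : G' e₀ = μ • e₀ := by
    simp only [hG', LinearMap.comp_apply, LinearEquiv.coe_coe, hEe, hG, map_smul]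
    rw [← hEe, LinearEquiv.symm_apply_apply]
  have A0 : ∀ i, A i 0 = μ * e₀ i := by
    intro i
    have : A i 0 = G' e₀ i := by
      rw [hA, LinearMap.toMatrix'_apply]
    rw [this, hcol]; rfl
  have A00 : A 0 0 = μ := by rw [A0]; simp [he0]
  have A10 : A 1 0 = 0 := by rw [A0]; simp [he0]
  have A20 : A 2 0 = 0 := by rw [A0]; simp [he0]
  have hdetA : A.det = LinearMap.det G := by
    rw [hA, LinearMap.det_toMatrix', hG']
    have := LinearMap.det_conj G E'.symm
    simpa using this
  have hpos : 0 < A 1 1 * A 2 2 - A 1 2 * A 2 1 := by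
    rw [← hdetA, Matrix.det_fin_three, A00, A10, A20] at hdet
    have : 0 < μ * (A 1 1 * A 2 2 - A 1 2 * A 2 1) := by linarith
    exact (pos_iff_pos_of_mul_pos this).1 hμ
  obtain ⟨p, q, r, s, hp, hq, hr, hs, ⟨p0, q0, r0, s0⟩, ⟨p1, q1, r1, s1⟩, hdt⟩ :=
    exists_path_two_by_two hpos
  -- The first row is interpolated linearly and the lower block along the path of two-by-two
  -- matrices; both diagonal blocks keep positive determinant.
  set D : ℝ → Matrix (Fin 3) (Fin 3) ℝ := fun t =>
    !![1 - t + t * μ, t * A 0 1, t * A 0 2; 0, p t, q t; 0, r t, s t] with hD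
  have hDdet : ∀ t ∈ Set.Icc (0 : ℝ) 1, 0 < (1 - t + t * μ) ∧ 0 < (D t).det := by
    intro t ht
    have h1 : 0 < 1 - t + t * μ := by
      rcases ht.1.lt_or_eq with h | h
      · have := mul_pos h hμ; linarith [ht.2]
      · rw [← h]; norm_num
    refine ⟨h1, ?_⟩
    rw [Matrix.det_fin_three]
    simp [hD]
    have := mul_pos h1 (hdt t ht)
    linarith
  refine ⟨fun t => E'.toLinearMap ∘ₗ Matrix.toLin' (D t) ∘ₗ E'.symm.toLinearMap, ?_, ?_, ?_, ?_⟩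
  · intro x
    have hEc : Continuous E' := E.continuous
    simp only [LinearMap.comp_apply, LinearEquiv.coe_coe, Matrix.toLin'_apply]
    refine hEc.comp ?_
    have hDc : Continuous D := by
      refine continuous_matrix fun i j => ?_
      fin_cases i <;> fin_cases j <;> simp [hD] <;> fun_prop
    exact hDc.matrix_mulVec continuous_const
  · have : D 0 = 1 := by
      ext i j; fin_cases i <;> fin_cases j <;> simp [hD, p0, q0, r0, s0]
    simp only [this, Matrix.toLin'_one]
    ext x; simp
  · have : D 1 = A := by
      ext i j; fin_cases i <;> fin_cases j <;> simp [hD, p1, q1, r1, s1, A00, A10, A20]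
    simp only [this, hA, Matrix.toLin'_toMatrix', hG']
    ext x; simp
  · intro t ht
    obtain ⟨h1, h2⟩ := hDdet t ht
    refine ⟨?_, 1 - t + t * μ, h1, ?_⟩
    · simp only [LinearMap.coe_comp, LinearEquiv.coe_coe]
      refine E'.injective.comp (Function.Injective.comp ?_ E'.symm.injective)
      have := Matrix.mulVec_injective_of_isUnit
        ((Matrix.isUnit_iff_isUnit_det (D t)).2 (isUnit_iff_ne_zero.2 h2.ne'))
      exact this
    · have : E'.symm h = e₀ := by rw [← hEe, LinearEquiv.symm_apply_apply]
      simp only [LinearMap.comp_apply, LinearEquiv.coe_coe, this]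
      have h3 : Matrix.toLin' (D t) e₀ = (1 - t + t * μ) • e₀ := by
        rw [Matrix.toLin'_apply, he0]
        ext i; fin_cases i <;> simp [hD]
      rw [h3, map_smul, hEe]

theorem injective_of_det_pos {M : Space →ₗ[ℝ] Space} (h : 0 < LinearMap.det M) :
    Function.Injective M :=
  (LinearMap.equivOfDetNeZero M h.ne').injective

/-- Two frames with the same first direction are joined by a path of such frames. -/
theorem exists_path_frames {M M' : Space →ₗ[ℝ] Space} {h d : Space} (hd : d ≠ 0) {r r' : ℝ}
    (hr : 0 < r) (hr' : 0 < r') (hM : M h = r • d) (hM' : M' h = r' • d)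
    (hdet : 0 < LinearMap.det M) (hdet' : 0 < LinearMap.det M') :
    ∃ N : ℝ → Space →ₗ[ℝ] Space, (∀ x, Continuous fun t => N t x) ∧ N 0 = M ∧ N 1 = M' ∧
      ∀ t ∈ Set.Icc (0 : ℝ) 1, Function.Injective (N t) ∧ ∃ ν : ℝ, 0 < ν ∧ N t h = ν • d := by
  have h0 : h ≠ 0 := by
    rintro rfl
    rw [map_zero] at hM
    exact smul_ne_zero hr.ne' hd hM.symm
  set e := LinearMap.equivOfDetNeZero M hdet.ne' with he
  have heM : ∀ x, e x = M x := fun x => rfl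
  have heM' : e.toLinearMap = M := rfl
  -- Composition with the inverse of `M` reduces the problem to a path that starts at the identity.
  set G : Space →ₗ[ℝ] Space := e.symm.toLinearMap ∘ₗ M' with hG
  have hMG : M ∘ₗ G = M' := by
    ext x; simp [hG, ← heM]
  have hdG : 0 < LinearMap.det G := by
    have : LinearMap.det M * LinearMap.det G = LinearMap.det M' := by
      have := LinearMap.det_comp M G
      rw [hMG] at this; exact this.symm
    rw [← this] at hdet'
    exact (pos_iff_pos_of_mul_pos hdet').1 hdet
  have hGh : G h = (r' / r) • h := by
    apply e.injective
    rw [map_smul, heM, heM, hM, ← LinearMap.comp_apply, hMG, hM', smul_smul,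
      div_mul_cancel₀ _ hr.ne']
  obtain ⟨N, hc, N0, N1, hN⟩ := exists_path_id h0 (div_pos hr' hr) hGh hdG
  refine ⟨fun t => M ∘ₗ N t, fun x => ?_, by simp [N0], by simp only [N1, hMG], fun t ht => ?_⟩
  · exact (LinearMap.continuous_of_finiteDimensional M).comp (hc x)
  · obtain ⟨h1, ν, hν, h2⟩ := hN t ht
    refine ⟨(injective_of_det_pos hdet).comp h1, ν * r, mul_pos hν hr, ?_⟩
    rw [LinearMap.comp_apply, h2, map_smul, hM, smul_smul]

end KnotTheory


namespace KnotTheory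

/-! ### Inserting a tangle into an edge of a polygon -/

/-- A polygonal arc from `Q` to `P` whose inner vertices lie strictly on one side of a plane through
`Q` and `P`. -/
structure Tangle where
  f : Space →ₗ[ℝ] ℝ
  Q : Space
  B : List Space
  P : Space
  level : f P = f Q
  below : ∀ b ∈ B, f b < f Q
  ne_nil : B ≠ []
  simple : SimplePath (Q :: B) P
  ne : P ≠ Q

namespace Tangle

/-- The vertices of the arc. -/
def verts (T : Tangle) : List Space := T.Q :: T.B ++ [T.P]

/-- The affine map with linear part `M` that maps the initial point of the arc to `m`. -/
def place (T : Tangle) (m : Space) (M : Space →ₗ[ℝ] Space) : Space →ᵃ[ℝ] Space where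
  toFun x := m + M (x - T.Q)
  linear := M
  map_vadd' p v := by simp only [vadd_eq_add, map_sub, map_add]; abel

theorem place_apply (T : Tangle) (m : Space) (M : Space →ₗ[ℝ] Space) (x : Space) :
    T.place m M x = m + M (x - T.Q) := rfl

theorem place_Q (T : Tangle) (m : Space) (M : Space →ₗ[ℝ] Space) : T.place m M T.Q = m := by
  rw [place_apply, sub_self, map_zero, add_zero]

theorem place_injective (T : Tangle) (m : Space) {M : Space →ₗ[ℝ] Space}
    (hM : Function.Injective M) : Function.Injective (T.place m M) := by
  intro x y h
  rw [place_apply, place_apply, add_right_inj] at h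
  exact sub_left_inj.1 (hM h)

/-- The closed polygon obtained from `a :: l` by inserting a copy of the arc into the first edge. -/
def insert (T : Tangle) (a : Space) (l : List Space) (m : Space) (M : Space →ₗ[ℝ] Space) :
    List Space := a :: T.verts.map (T.place m M) ++ l

theorem insert_eq (T : Tangle) (a : Space) (l : List Space) (m : Space) (M : Space →ₗ[ℝ] Space) :
    T.insert a l m M = a :: T.place m M T.Q :: (T.B.map (T.place m M) ++ T.place m M T.P :: l) := by
  simp [insert, verts]

/-- The copy of the arc is so small that it does not interfere with the rest of the polygon. -/
structure Fits (T : Tangle) (a b : Space) (l : List Space) (m : Space)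
    (M : Space →ₗ[ℝ] Space) : Prop where
  simple : IsSimple (a :: b :: l)
  inj : Function.Injective M
  dir : ∃ r : ℝ, 0 < r ∧ M (T.P - T.Q) = r • (b - a)
  mem : m ∈ openSegment ℝ a b
  ball : ∃ r : ℝ, 0 < r ∧ (∀ x ∈ T.verts, T.place m M x ∈ Metric.ball m r) ∧
    ∀ z ∈ Metric.ball m r, z ∉ path (b :: l) a ∧ z ≠ a

theorem mem_openSegment_iff {E : Type*} [AddCommGroup E] [Module ℝ E] {a b x : E} :
    x ∈ openSegment ℝ a b ↔ ∃ t : ℝ, 0 < t ∧ t < 1 ∧ x = a + t • (b - a) := by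
  rw [openSegment_eq_image']
  constructor
  · rintro ⟨t, ⟨h0, h1⟩, rfl⟩; exact ⟨t, h0, h1, rfl⟩
  · rintro ⟨t, h0, h1, rfl⟩; exact ⟨t, ⟨h0, h1⟩, rfl⟩

/-- The end `P` has the same level as `Q`, but the half-open path excludes it. -/
theorem eq_Q_of_mem {T : Tangle} {x : Space} (hx : x ∈ path (T.Q :: T.B) T.P)
    (h : T.f x = T.f T.Q) : x = T.Q :=
  (gt_or_eq_of_mem_path T.ne_nil le_rfl T.below T.level.le hx).resolve_left (by rw [h]; simp)

/-- The positions, on the edge, of the end points of an inserted arc. -/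
theorem Fits.positions {T : Tangle} {a b : Space} {l : List Space} {m : Space}
    {M : Space →ₗ[ℝ] Space} (h : T.Fits a b l m M) :
    ∃ s r : ℝ, 0 < s ∧ 0 < r ∧ s + r < 1 ∧ m = a + s • (b - a) ∧
      T.place m M T.P = a + (s + r) • (b - a) ∧ M (T.P - T.Q) = r • (b - a) := by
  obtain ⟨r, hr, hM⟩ := h.dir
  obtain ⟨s, hs0, hs1, hm⟩ := mem_openSegment_iff.1 h.mem
  obtain ⟨ρ, hρ, hball, hdisj⟩ := h.ball
  have hP : T.place m M T.P = m + r • (b - a) := by rw [place_apply, hM]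
  refine ⟨s, r, hs0, hr, ?_, hm, ?_, hM⟩
  -- Otherwise `b` would lie between `m` and the image of `P`, hence in the ball that avoids the
  -- vertex `b`.
  · by_contra hcon
    have hb : b ∈ Metric.ball m ρ := by
      have h1 : T.place m M T.P ∈ Metric.ball m ρ := hball _ (by simp [verts])
      refine (convex_ball m ρ).segment_subset (Metric.mem_ball_self hρ) h1
        (mem_segment_iff.2 ⟨(1 - s) / r, div_nonneg (by linarith) hr.le,
          (div_le_one hr).2 (by linarith), ?_⟩)
      rw [hP, add_sub_cancel_left, smul_smul, div_mul_cancel₀ _ hr.ne', hm]; module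
    exact (hdisj b hb).1 (mem_path_of_mem (by simp))
  · rw [hP, hm]; module

theorem arc_subset {T : Tangle} {m : Space} {M : Space →ₗ[ℝ] Space} {r : ℝ} (hball : ∀ x ∈ T.verts, T.place m M x ∈ Metric.ball m r) :
    path ((T.Q :: T.B).map (T.place m M)) (T.place m M T.P) ⊆ Metric.ball m r := by
  refine path_subset_convex (convex_ball m r) ?_ (hball _ (by simp [verts]))
  intro x hx
  obtain ⟨y, hy, rfl⟩ := List.mem_map.1 hx
  exact hball y (by simp only [verts, List.mem_append]; exact Or.inl hy)

/-- The ball keeps the copy away from the rest of the polygon, and the functional `f` keeps it off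
the line `ab` except at its initial point. -/
theorem Fits.isSimple {T : Tangle} {a b : Space} {l : List Space} {m : Space}
    {M : Space →ₗ[ℝ] Space} (h : T.Fits a b l m M) : IsSimple (T.insert a (b :: l) m M) := by
  obtain ⟨s, r, hs, hr, hsr, hm, hP, hM⟩ := h.positions
  obtain ⟨ρ, hρ, hball, hdisj⟩ := h.ball
  have hψ := T.place_injective m h.inj
  have hab : b - a ≠ 0 := sub_ne_zero.2 h.simple.ne.symm
  have h' := h.simple
  rw [isSimple_cons_iff, simplePath_cons] at h'
  obtain ⟨hlen, hrest, hd⟩ := h'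
  have hmQ : T.place m M T.Q = m := T.place_Q m M
  have harc := arc_subset hball
  have hk : IsSimple (T.insert a (b :: l) m M) ↔ SimplePath (a :: T.place m M T.Q ::
      (T.B.map (T.place m M) ++ T.place m M T.P :: b :: l)) a := by
    rw [insert_eq, isSimple_cons_iff]
    exact and_iff_right (by simp; omega)
  -- The linear part maps the direction `QP` to `ab`, so a point of the copy on the line `ab` comes
  -- from a point of the arc at the level of `Q`, which is `Q` itself.
  have line : ∀ x ∈ path ((T.Q :: T.B).map (T.place m M)) (T.place m M T.P), ∀ t : ℝ,
      x = m + t • (b - a) → t = 0 := by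
    intro x hx t ht
    rw [path_map] at hx
    obtain ⟨y, hy, rfl⟩ := hx
    have hy' : y = T.Q + (t / r) • (T.P - T.Q) := by
      apply hψ
      rw [ht, place_apply, add_sub_cancel_left, map_smul, hM, smul_smul, div_mul_cancel₀ _ hr.ne']
    have := eq_Q_of_mem hy (by rw [hy', map_add, map_smul, map_sub, T.level]; simp)
    rw [this, hmQ, left_eq_add] at ht
    exact (smul_eq_zero.1 ht).resolve_right hab
  have line1 : hseg a m ⊆ hseg a b :=
    hseg_subset_hseg le_rfl hs.le (by linarith) one_pos (by simp) hm
  have line2 : hseg (T.place m M T.P) b ⊆ hseg a b :=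
    hseg_subset_hseg (by linarith) hsr.le le_rfl hsr hP (by simp)
  rw [hk, simplePath_cons]
  have happ : T.place m M T.Q :: (T.B.map (T.place m M) ++ T.place m M T.P :: b :: l) =
      (T.Q :: T.B).map (T.place m M) ++ T.place m M T.P :: b :: l := by simp
  rw [happ]
  refine ⟨simplePath_append.2 ⟨T.simple.map hψ, simplePath_cons.2 ⟨hrest, ?_⟩, ?_⟩, ?_⟩
  · exact hd.mono_left line2
  · rw [Set.disjoint_left]
    rintro x hx (hx' | hx')
    · obtain ⟨t, ht0, ht1, rfl⟩ := mem_hseg.1 hx'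
      have := line _ hx (r + t * (1 - (s + r))) (by rw [hP, hm, start_cons]; module)
      nlinarith
    · exact (hdisj x (harc hx)).1 hx'
  · rw [path_append, hmQ, Set.disjoint_left]
    rintro x hx (hx' | hx' | hx')
    · obtain ⟨t, ht0, ht1, rfl⟩ := mem_hseg.1 hx
      have := line _ hx' (-(1 - t) * s) (by rw [hm]; module)
      nlinarith
    · obtain ⟨t, ht0, ht1, rfl⟩ := mem_hseg.1 hx
      obtain ⟨u, hu0, hu1, hu⟩ := mem_hseg.1 hx'
      rw [start_cons, hP, hm] at hu
      have : (t * s - (s + r + u * (1 - (s + r)))) • (b - a) = 0 := by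
        have h2 : (t * s - (s + r + u * (1 - (s + r)))) • (b - a) =
          (a + t • (a + s • (b - a) - a)) -
            (a + (s + r) • (b - a) + u • (b - (a + (s + r) • (b - a)))) := by module
        rw [h2, hu, sub_self]
      have := (smul_eq_zero.1 this).resolve_right hab
      nlinarith
    · exact Set.disjoint_left.1 hd (line1 hx) hx'

/-- A copy of the arc can be shrunk. -/
theorem Fits.smul {T : Tangle} {a b : Space} {l : List Space} {m : Space}
    {M : Space →ₗ[ℝ] Space} (h : T.Fits a b l m M) {s : ℝ} (hs : 0 < s) (hs1 : s ≤ 1) :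
    T.Fits a b l m (s • M) := by
  obtain ⟨r, hr, hM⟩ := h.dir
  obtain ⟨ρ, hρ, hball, hdisj⟩ := h.ball
  refine ⟨h.simple, fun x y e => ?_, ⟨s * r, by positivity, ?_⟩, h.mem, ρ, hρ, fun x hx => ?_, hdisj⟩
  · rw [LinearMap.smul_apply, LinearMap.smul_apply] at e
    exact h.inj (smul_right_injective _ hs.ne' e)
  · rw [LinearMap.smul_apply, hM, smul_smul]
  · have := hball x hx
    rw [place_apply, mem_ball_iff_norm, add_sub_cancel_left] at this ⊢
    rw [LinearMap.smul_apply, norm_smul, Real.norm_of_nonneg hs.le]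
    nlinarith [norm_nonneg (M (x - T.Q))]

theorem isotopic_of_fits_family {T : Tangle} {x y m : ℝ → Space} {l : List (ℝ → Space)}
    {M : ℝ → Space →ₗ[ℝ] Space} (hx : ContinuousOn x (Set.Icc 0 1))
    (hl : ∀ g ∈ y :: l, ContinuousOn g (Set.Icc 0 1))
    (hm : ContinuousOn m (Set.Icc 0 1)) (hM : ∀ z, ContinuousOn (fun t => M t z) (Set.Icc 0 1))
    (h : ∀ t ∈ Set.Icc (0 : ℝ) 1, T.Fits (x t) (y t) (l.map (· t)) (m t) (M t)) :
    Isotopic (T.insert (x 0) (y 0 :: l.map (· 0)) (m 0) (M 0))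
      (T.insert (x 1) (y 1 :: l.map (· 1)) (m 1) (M 1)) := by
  have e : ∀ t, T.insert (x t) (y t :: l.map (· t)) (m t) (M t) =
      (x :: T.verts.map (fun z t => T.place (m t) (M t) z) ++ y :: l).map (· t) := by
    intro t; simp [insert, Function.comp_def]
  rw [e, e]
  refine isotopic_of_family (fun g hg => ?_) (fun t ht => by rw [← e]; exact (h t ht).isSimple)
  rw [List.cons_append, List.mem_cons, List.mem_append, List.mem_map] at hg
  rcases hg with rfl | ⟨z, -, rfl⟩ | hg
  · exact hx
  · exact hm.add (hM _)
  · exact hl g hg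

theorem Fits.isotopic_smul {T : Tangle} {a b : Space} {l : List Space} {m : Space}
    {M : Space →ₗ[ℝ] Space} (h : T.Fits a b l m M) {s : ℝ} (hs : 0 < s) (hs1 : s ≤ 1) :
    Isotopic (T.insert a (b :: l) m M) (T.insert a (b :: l) m (s • M)) := by
  have := isotopic_of_fits_family (T := T) (x := fun _ => a) (y := fun _ => b) (m := fun _ => m)
    (l := l.map fun z _ => z) (M := fun t => (1 - t + t * s) • M) continuousOn_const
    (by simp only [List.mem_cons, List.mem_map]
        rintro g (rfl | ⟨z, -, rfl⟩) <;> exact continuousOn_const)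
    continuousOn_const (fun z => by simp only [LinearMap.smul_apply]; fun_prop)
    (fun t ht => by
      simp only [List.map_map, Function.comp_def, List.map_id']
      exact h.smul (by nlinarith [ht.1, ht.2]) (by nlinarith [ht.1, ht.2]))
  simpa [Function.comp_def] using this

/-! Uniform smallness along a continuous family. -/

/-- The distance from `m t` to the point of the segment with parameter `s` is a continuous function
of `(t, s)` on a compact square, so its minimum is attained and positive. -/
theorem exists_uniform_ball_segment {a b m : ℝ → Space} (ha : ContinuousOn a (Set.Icc 0 1))
    (hb : ContinuousOn b (Set.Icc 0 1)) (hm : ContinuousOn m (Set.Icc 0 1))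
    (h : ∀ t ∈ Set.Icc (0 : ℝ) 1, m t ∉ segment ℝ (a t) (b t)) :
    ∃ r : ℝ, 0 < r ∧ ∀ t ∈ Set.Icc (0 : ℝ) 1, ∀ z ∈ Metric.ball (m t) r,
      z ∉ segment ℝ (a t) (b t) := by
  have hK : IsCompact ((Set.Icc (0 : ℝ) 1) ×ˢ (Set.Icc (0 : ℝ) 1)) := isCompact_Icc.prod isCompact_Icc
  have hfst : Set.MapsTo Prod.fst ((Set.Icc (0 : ℝ) 1) ×ˢ (Set.Icc (0 : ℝ) 1)) (Set.Icc (0 : ℝ) 1) :=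
    fun p hp => hp.1
  have hcont : ContinuousOn (fun p : ℝ × ℝ => dist (m p.1) (a p.1 + p.2 • (b p.1 - a p.1)))
      ((Set.Icc (0 : ℝ) 1) ×ˢ (Set.Icc (0 : ℝ) 1)) := by
    have ha' := ha.comp continuousOn_fst hfst
    have hb' := hb.comp continuousOn_fst hfst
    have hm' := hm.comp continuousOn_fst hfst
    exact continuous_dist.comp_continuousOn
      (hm'.prodMk (ha'.add (continuousOn_snd.smul (hb'.sub ha'))))
  obtain ⟨⟨t₀, s₀⟩, hmem, hmin⟩ := hK.exists_isMinOn ⟨(0, 0), by simp⟩ hcont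
  refine ⟨dist (m t₀) (a t₀ + s₀ • (b t₀ - a t₀)), dist_pos.2 fun e => ?_, ?_⟩
  · exact h t₀ hmem.1 (mem_segment_iff.2 ⟨s₀, hmem.2.1, hmem.2.2, e⟩)
  · intro t ht z hz hz'
    obtain ⟨s, hs0, hs1, rfl⟩ := mem_segment_iff.1 hz'
    rw [Metric.mem_ball, dist_comm] at hz
    exact (hmin (show (t, s) ∈ _ from ⟨ht, hs0, hs1⟩)).not_gt hz

theorem exists_uniform_ball_path {m e : ℝ → Space} {l : List (ℝ → Space)}
    (hm : ContinuousOn m (Set.Icc 0 1)) (he : ContinuousOn e (Set.Icc 0 1))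
    (hl : ∀ g ∈ l, ContinuousOn g (Set.Icc 0 1))
    (h : ∀ t ∈ Set.Icc (0 : ℝ) 1, m t ∉ path (l.map (· t)) (e t) ∧ m t ≠ e t) :
    ∃ r : ℝ, 0 < r ∧ ∀ t ∈ Set.Icc (0 : ℝ) 1, ∀ z ∈ Metric.ball (m t) r,
      z ∉ path (l.map (· t)) (e t) ∧ z ≠ e t := by
  induction l with
  | nil =>
    obtain ⟨r, hr, hr'⟩ := exists_uniform_ball_segment he he hm (by
      intro t ht; rw [segment_same]; exact (h t ht).2)
    exact ⟨r, hr, fun t ht z hz => ⟨by simp, by simpa using hr' t ht z hz⟩⟩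
  | cons a l ih =>
    obtain ⟨r₁, hr₁, h₁⟩ := ih (fun g hg => hl g (by simp [hg])) (fun t ht =>
      ⟨fun h' => (h t ht).1 (Or.inr h'), (h t ht).2⟩)
    have hst : ∀ t, start (l.map (· t)) (e t) = (start l e) t := by
      intro t; cases l <;> rfl
    have hstc : ContinuousOn (start l e) (Set.Icc 0 1) := by
      cases l with
      | nil => exact he
      | cons b l => exact hl b (by simp)
    obtain ⟨r₂, hr₂, h₂⟩ := exists_uniform_ball_segment (hl a (by simp)) hstc hm (by
      intro t ht hmem
      rw [segment_eq_hseg_union] at hmem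
      rcases hmem with hmem | hmem
      · exact (h t ht).1 (Or.inl (by rw [hst]; exact hmem))
      · cases l with
        | nil => exact (h t ht).2 hmem
        | cons b l =>
          have h3 := (h t ht).1
          rw [Set.mem_singleton_iff.1 hmem] at h3
          exact h3 (mem_path_of_mem (by simp)))
    refine ⟨min r₁ r₂, lt_min hr₁ hr₂, fun t ht z hz => ?_⟩
    have hz1 := h₁ t ht z (Metric.ball_subset_ball (min_le_left _ _) hz)
    have hz2 := h₂ t ht z (Metric.ball_subset_ball (min_le_right _ _) hz)
    refine ⟨?_, hz1.2⟩
    rintro (h3 | h3)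
    · rw [hst] at h3; exact hz2 (hseg_subset_segment _ _ h3)
    · exact hz1.1 h3

theorem exists_uniform_bound {M : ℝ → Space →ₗ[ℝ] Space}
    (hM : ∀ z, ContinuousOn (fun t => M t z) (Set.Icc 0 1)) (l : List Space) :
    ∃ C : ℝ, 0 < C ∧ ∀ t ∈ Set.Icc (0 : ℝ) 1, ∀ z ∈ l, ‖M t z‖ ≤ C := by
  induction l with
  | nil => exact ⟨1, one_pos, by simp⟩
  | cons a l ih =>
    obtain ⟨C, hC, h⟩ := ih
    obtain ⟨D, hD⟩ := isCompact_Icc.exists_bound_of_continuousOn (hM a)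
    refine ⟨max C D, lt_max_of_lt_left hC, fun t ht z hz => ?_⟩
    rcases List.mem_cons.1 hz with rfl | hz
    · exact (hD t ht).trans (le_max_right _ _)
    · exact (h t ht z hz).trans (le_max_left _ _)

/-- Along a continuous family of polygons and frames, all sufficiently small copies of the arc
fit. -/
theorem exists_fits_family (T : Tangle) {x y m : ℝ → Space} {l : List (ℝ → Space)}
    {M : ℝ → Space →ₗ[ℝ] Space} (hx : ContinuousOn x (Set.Icc 0 1))
    (hl : ∀ g ∈ y :: l, ContinuousOn g (Set.Icc 0 1))
    (hm : ContinuousOn m (Set.Icc 0 1)) (hM : ∀ z, ContinuousOn (fun t => M t z) (Set.Icc 0 1))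
    (hs : ∀ t ∈ Set.Icc (0 : ℝ) 1, IsSimple (x t :: y t :: l.map (· t)))
    (hinj : ∀ t ∈ Set.Icc (0 : ℝ) 1, Function.Injective (M t))
    (hdir : ∀ t ∈ Set.Icc (0 : ℝ) 1, ∃ r : ℝ, 0 < r ∧ M t (T.P - T.Q) = r • (y t - x t))
    (hmem : ∀ t ∈ Set.Icc (0 : ℝ) 1, m t ∈ openSegment ℝ (x t) (y t)) :
    ∃ s₀ : ℝ, 0 < s₀ ∧ ∀ s, 0 < s → s ≤ s₀ → ∀ t ∈ Set.Icc (0 : ℝ) 1,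
      T.Fits (x t) (y t) (l.map (· t)) (m t) (s • M t) := by
  obtain ⟨r, hr, hball⟩ := exists_uniform_ball_path (m := m) (e := x) (l := y :: l) hm hx hl (by
    intro t ht
    have h1 := hs t ht
    have hne := h1.ne
    rw [isSimple_cons_iff, simplePath_cons] at h1
    obtain ⟨s, h0, h1', e⟩ := mem_openSegment_iff.1 (hmem t ht)
    refine ⟨Set.disjoint_left.1 h1.2.2 (mem_hseg.2 ⟨s, h0.le, h1', e⟩), fun e' => ?_⟩
    rw [e', left_eq_add, smul_eq_zero] at e
    rcases e with e | e
    · exact h0.ne' e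
    · exact hne (sub_eq_zero.1 e).symm)
  obtain ⟨C, hC, hbd⟩ := exists_uniform_bound hM (T.verts.map fun z => z - T.Q)
  refine ⟨r / (2 * C), by positivity, fun s hs0 hs1 t ht => ⟨hs t ht, fun p q e => ?_, ?_, hmem t ht,
    r, hr, fun z hz => ?_, hball t ht⟩⟩
  · rw [LinearMap.smul_apply, LinearMap.smul_apply] at e
    exact hinj t ht (smul_right_injective _ hs0.ne' e)
  · obtain ⟨q, hq, e⟩ := hdir t ht
    exact ⟨s * q, by positivity, by rw [LinearMap.smul_apply, e, smul_smul]⟩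
  · rw [place_apply, mem_ball_iff_norm, add_sub_cancel_left, LinearMap.smul_apply, norm_smul,
      Real.norm_of_nonneg hs0.le]
    have h1 := hbd t ht (z - T.Q) (List.mem_map_of_mem hz)
    have h2 : s * (2 * C) ≤ r := by rwa [le_div_iff₀ (by positivity)] at hs1
    nlinarith [norm_nonneg (M t (z - T.Q))]

end Tangle

end KnotTheory


/-! ### Well-definedness of the insertion of an arc on oriented isotopy classes -/

namespace KnotTheory

theorem exists_frame {h d : Space} (hh : h ≠ 0) (hd : d ≠ 0) :
    ∃ M : Space →ₗ[ℝ] Space, 0 < LinearMap.det M ∧ M h = d := by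
  set e₀ : Space := Pi.single 0 1 with he0
  have he0' : e₀ ≠ 0 := by
    intro e; have := congrFun e 0; simp [he0] at this
  obtain ⟨E₁, hE₁⟩ := SeparatingDual.exists_continuousLinearEquiv_apply_eq (R := ℝ) he0' hh
  obtain ⟨E₂, hE₂⟩ := SeparatingDual.exists_continuousLinearEquiv_apply_eq (R := ℝ) he0' hd
  set S := E₁.toLinearEquiv.symm.toLinearMap with hS
  set F := E₂.toLinearEquiv.toLinearMap with hF
  have hSh : S h = e₀ := by
    change E₁.symm h = e₀
    rw [← hE₁, ContinuousLinearEquiv.symm_apply_apply]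
  have hFe : F e₀ = d := hE₂
  have hdS : LinearMap.det S ≠ 0 := (LinearEquiv.isUnit_det' E₁.toLinearEquiv.symm).ne_zero
  have hdF : LinearMap.det F ≠ 0 := (LinearEquiv.isUnit_det' E₂.toLinearEquiv).ne_zero
  rcases lt_or_gt_of_ne (mul_ne_zero hdF hdS) with hlt | hgt
  -- A reflection that fixes `e₀` corrects the sign of the determinant.
  · set D : Matrix (Fin 3) (Fin 3) ℝ := Matrix.diagonal ![1, 1, -1] with hD
    refine ⟨F ∘ₗ Matrix.toLin' D ∘ₗ S, ?_, ?_⟩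
    · have : D.det = -1 := by simp [hD, Fin.prod_univ_three]
      rw [LinearMap.det_comp, LinearMap.det_comp, LinearMap.det_toLin', this]; linarith
    · have : Matrix.toLin' D e₀ = e₀ := by
        rw [Matrix.toLin'_apply, hD, he0]
        ext i; fin_cases i <;> simp
      rw [LinearMap.comp_apply, LinearMap.comp_apply, hSh, this, hFe]
  · exact ⟨F ∘ₗ S, by rw [LinearMap.det_comp]; exact hgt, by rw [LinearMap.comp_apply, hSh, hFe]⟩

theorem det_smul_pos {M : Space →ₗ[ℝ] Space} (h : 0 < LinearMap.det M) {s : ℝ} (hs : 0 < s) :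
    0 < LinearMap.det (s • M) := by
  rw [LinearMap.det_smul]; positivity

/-- At a vertex of a simple polygon, some linear functional increases along both adjacent edges. -/
theorem IsSimple.exists_increasing {a b c : Space} {l : List Space} (h : IsSimple (a :: b :: c :: l)) :
    ∃ g : Space →ₗ[ℝ] ℝ, 0 < g (b - a) ∧ 0 < g (c - b) := by
  have hab := h.ne
  rw [isSimple_cons_iff, simplePath_cons, simplePath_cons] at h
  obtain ⟨-, ⟨-, h2⟩, h1⟩ := h
  -- Zero lies between the two edge vectors only if an edge vanishes or the path turns back on
  -- itself. Separating zero from this compact convex set then yields the functional.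
  have h0 : (0 : Space) ∉ segment ℝ (b - a) (c - b) := by
    intro h0
    obtain ⟨s, hs0, hs1, e⟩ := mem_segment_iff.1 h0
    have e' : (1 - s) • (a - b) = s • (c - b) := by
      have : (1 - s) • (a - b) = s • (c - b) - (b - a + s • (c - b - (b - a))) := by module
      rw [this, ← e, sub_zero]
    rcases le_or_gt (1 - s) s with hle | hlt
    · have hs : 0 < s := by linarith
      have hc : c = b + ((1 - s) / s) • (a - b) := by
        rw [div_eq_inv_mul, mul_smul, e', smul_smul, inv_mul_cancel₀ hs.ne', one_smul]; abel
      rcases hs1.lt_or_eq with h3 | h3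
      · have hq : 0 < (1 - s) / s := div_pos (by linarith) hs
        refine Set.disjoint_left.1 h1 (mem_hseg.2 ⟨1 - (1 - s) / s, ?_, by linarith, ?_⟩)
          (mem_path_of_mem (l := b :: c :: l) (v := c) (by simp))
        · rw [sub_nonneg, div_le_one hs]; exact hle
        · rw [hc]; module
      · have : c = b := by rw [hc, h3]; simp
        rw [this] at h2
        exact Set.disjoint_left.1 h2 (left_mem_hseg _ _) (mem_path_of_mem (by simp))
    · have hs : 0 < 1 - s := by linarith
      refine Set.disjoint_left.1 h1 (left_mem_hseg a b)
        (Or.inl (mem_hseg.2 ⟨s / (1 - s), by positivity, ?_, ?_⟩))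
      · rw [div_lt_one hs]; exact hlt
      · have : a - b = (s / (1 - s)) • (c - b) := by
          rw [div_eq_inv_mul, mul_smul, ← e', smul_smul, inv_mul_cancel₀ hs.ne', one_smul]
        rw [start_cons, ← this]; abel
  obtain ⟨f, u, hu, hf⟩ := geometric_hahn_banach_point_closed (convex_segment (b - a) (c - b))
    (by rw [segment_eq_image_lineMap]
        exact (isCompact_Icc.image AffineMap.lineMap_continuous).isClosed) h0
  rw [map_zero] at hu
  exact ⟨f.toLinearMap, hu.trans (hf _ (left_mem_segment _ _ _)),
    hu.trans (hf _ (right_mem_segment _ _ _))⟩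

theorem continuous_getD_append (l₁ l₂ : List Space) (i : ℕ) :
    Continuous fun y : Space => (l₁ ++ y :: l₂).getD i 0 := by
  induction l₁ generalizing i with
  | nil =>
    cases i with
    | zero => exact continuous_id
    | succ i => simpa using continuous_const
  | cons a l ih =>
    cases i with
    | zero => simpa using continuous_const
    | succ i => simpa using ih i

/-- A simple polygon remains simple when one vertex is moved slightly. -/
theorem IsSimple.exists_ball {l₁ l₂ : List Space} {x : Space} (h : IsSimple (l₁ ++ x :: l₂)) :
    ∃ ε : ℝ, 0 < ε ∧ ∀ y ∈ Metric.ball x ε, IsSimple (l₁ ++ y :: l₂) := by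
  set n := l₁.length + (l₂.length + 1) with hn
  set γ : Space → Fin n → Space := fun y i => (l₁ ++ y :: l₂).getD i 0 with hγ
  have hof : ∀ y, List.ofFn (γ y) = l₁ ++ y :: l₂ := by
    intro y
    apply List.ext_getElem
    · simp [hn, add_assoc]
    · intro i h1 h2
      rw [List.getElem_ofFn]
      exact List.getD_eq_getElem _ _ h2
  have hc : Continuous γ := continuous_pi fun i => continuous_getD_append l₁ l₂ i
  have ho := (isOpen_isSimple n).preimage hc
  obtain ⟨ε, hε, hb⟩ := Metric.isOpen_iff.1 ho x (by
    rw [Set.mem_preimage, Set.mem_ofPred_eq, hof]; exact h)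
  refine ⟨ε, hε, fun y hy => ?_⟩
  have := hb hy
  rwa [Set.mem_preimage, Set.mem_ofPred_eq, hof] at this

namespace Tangle

/-- `k` is obtained from the oriented polygon `J` by inserting a small copy of the arc into the first
edge. -/
def InsertedInto (T : Tangle) (J k : List Space) : Prop :=
  ∃ (a b : Space) (l : List Space) (m : Space) (M : Space →ₗ[ℝ] Space), J = a :: b :: l ∧
    0 < LinearMap.det M ∧ T.Fits a b l m M ∧ k = T.insert a (b :: l) m M

theorem InsertedInto.isSimple_left {T : Tangle} {J k : List Space} (h : T.InsertedInto J k) :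
    IsSimple J := by
  obtain ⟨a, b, l, m, M, rfl, -, h, -⟩ := h; exact h.simple

theorem InsertedInto.isSimple_right {T : Tangle} {J k : List Space} (h : T.InsertedInto J k) :
    IsSimple k := by
  obtain ⟨a, b, l, m, M, -, -, h, rfl⟩ := h; exact h.isSimple

/-- Small copies fit. -/
theorem exists_fits (T : Tangle) {a b : Space} {l : List Space} {m : Space}
    {M : Space →ₗ[ℝ] Space} (hs : IsSimple (a :: b :: l)) (hinj : Function.Injective M)
    (hdir : ∃ r : ℝ, 0 < r ∧ M (T.P - T.Q) = r • (b - a)) (hm : m ∈ openSegment ℝ a b) :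
    ∃ s₀ : ℝ, 0 < s₀ ∧ ∀ s, 0 < s → s ≤ s₀ → T.Fits a b l m (s • M) := by
  obtain ⟨s₀, h0, h⟩ := T.exists_fits_family (x := fun _ => a) (y := fun _ => b) (m := fun _ => m)
    (l := l.map fun z _ => z) (M := fun _ => M) continuousOn_const
    (by simp only [List.mem_cons, List.mem_map]
        rintro g (rfl | ⟨z, -, rfl⟩) <;> exact continuousOn_const)
    continuousOn_const (fun z => continuousOn_const)
    (fun t ht => by simpa [Function.comp_def] using hs) (fun _ _ => hinj) (fun _ _ => hdir)
    (fun _ _ => hm)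
  refine ⟨s₀, h0, fun s h1 h2 => ?_⟩
  simpa [Function.comp_def] using h s h1 h2 0 (by simp)

theorem midpoint_mem_openSegment {a b : Space} : a + (1 / 2 : ℝ) • (b - a) ∈ openSegment ℝ a b :=
  mem_openSegment_iff.2 ⟨1 / 2, by norm_num, by norm_num, rfl⟩

theorem exists_insertedInto (T : Tangle) {J : List Space} (hJ : IsSimple J) :
    ∃ k, T.InsertedInto J k := by
  match J, hJ with
  | [], h => exact absurd h.1 (by simp)
  | [a], h => exact absurd h.1 (by simp)
  | a :: b :: l, h =>
    obtain ⟨M, hM, hMd⟩ := exists_frame (sub_ne_zero.2 T.ne) (sub_ne_zero.2 h.ne.symm)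
    obtain ⟨s, hs, hfit⟩ := T.exists_fits (m := a + (1 / 2 : ℝ) • (b - a)) h
      (injective_of_det_pos hM) ⟨1, one_pos, by rw [one_smul, hMd]⟩ midpoint_mem_openSegment
    exact ⟨_, a, b, l, _, s • M, rfl, det_smul_pos hM hs, hfit s hs le_rfl, rfl⟩

/-- The result of an insertion into a given edge is unique up to isotopy. -/
theorem InsertedInto.unique {T : Tangle} {J k k' : List Space} (h : T.InsertedInto J k)
    (h' : T.InsertedInto J k') : Isotopic k k' := by
  obtain ⟨a, b, l, m, M, rfl, hM, hfit, rfl⟩ := h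
  obtain ⟨a', b', l', m', M', e, hM', hfit', rfl⟩ := h'
  simp only [List.cons.injEq] at e
  obtain ⟨rfl, rfl, rfl⟩ := e
  obtain ⟨r, hr, hd⟩ := hfit.dir
  obtain ⟨r', hr', hd'⟩ := hfit'.dir
  -- The linear parts of the two copies are joined by frames that keep the arc directed along the
  -- edge; this is where the positive determinants are needed.
  obtain ⟨N, hNc, N0, N1, hN⟩ := exists_path_frames (sub_ne_zero.2 hfit.simple.ne.symm) hr hr' hd hd'
    hM hM'
  have hl : ∀ g ∈ (fun _ : ℝ => b) :: l.map (fun (z : Space) (_ : ℝ) => z),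
      ContinuousOn g (Set.Icc 0 1) := by
    simp only [List.mem_cons, List.mem_map]
    rintro g (rfl | ⟨z, -, rfl⟩) <;> exact continuousOn_const
  have hmc : ContinuousOn (fun t : ℝ => m + t • (m' - m)) (Set.Icc 0 1) := by fun_prop
  obtain ⟨s₀, h0, hs⟩ := T.exists_fits_family (x := fun _ => a) (y := fun _ => b)
    (m := fun t => m + t • (m' - m)) (l := l.map fun z _ => z) (M := N) continuousOn_const
    hl hmc (fun z => (hNc z).continuousOn)
    (fun t ht => by simpa [Function.comp_def] using hfit.simple) (fun t ht => (hN t ht).1)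
    (fun t ht => (hN t ht).2)
    (fun t ht => (convex_openSegment a b).segment_subset hfit.mem hfit'.mem
      (mem_segment_iff.2 ⟨t, ht.1, ht.2, rfl⟩))
  -- Both copies are first shrunk by a factor at which the whole family fits. It is bounded by `1`
  -- because only shrinking is known to preserve the fit.
  have hpos : 0 < min s₀ 1 := lt_min h0 one_pos
  have h1 := hfit.isotopic_smul hpos (min_le_right _ _)
  have h2 := hfit'.isotopic_smul hpos (min_le_right _ _)
  have h3 := isotopic_of_fits_family (T := T) (x := fun _ => a) (y := fun _ => b)
    (m := fun t => m + t • (m' - m)) (l := l.map fun z _ => z) (M := fun t => min s₀ 1 • N t)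
    continuousOn_const hl hmc
    (fun z => by simp only [LinearMap.smul_apply]; exact (hNc z).continuousOn.const_smul (min s₀ 1))
    (fun t ht => hs _ hpos (min_le_left _ _) t ht)
  refine h1.trans (Isotopic.trans ?_ h2.symm)
  simpa [Function.comp_def, N0, N1] using h3

/-- An inserted arc stays near the edge it replaces. -/
theorem Fits.path_subset {T : Tangle} {a b : Space} {l : List Space} {m : Space}
    {M : Space →ₗ[ℝ] Space} (h : T.Fits a b l m M) {r : ℝ}
    (hr : ∀ x ∈ T.verts, T.place m M x ∈ Metric.ball m r) (l' : List Space) (e : Space) :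
    path (T.insert a (b :: l') m M) e ⊆ path (a :: b :: l') e ∪ Metric.ball m r := by
  obtain ⟨s, q, hs, hq, hsq, hm, hP, -⟩ := h.positions
  have happ : T.insert a (b :: l') m M =
      a :: ((T.Q :: T.B).map (T.place m M) ++ T.place m M T.P :: b :: l') := by
    simp [insert_eq]
  have harc := arc_subset hr
  rw [happ, path_cons, path_append]
  rintro x (hx | hx | hx | hx)
  · left; left
    rw [List.map_cons, List.cons_append, start_cons, T.place_Q] at hx
    exact hseg_subset_hseg le_rfl hs.le (by linarith) one_pos (by simp) hm hx
  · right; exact harc hx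
  · left; left
    exact hseg_subset_hseg (by linarith) hsq.le le_rfl hsq hP (by simp) hx
  · left; right; exact hx

/-- An inserted arc can be moved around a corner of the polygon. -/
theorem InsertedInto.exists_rotate {T : Tangle} {a : Space} {l k : List Space}
    (h : T.InsertedInto (a :: l) k) : ∃ k', T.InsertedInto (l ++ [a]) k' ∧ Isotopic k k' := by
  have hJ := h.isSimple_left
  obtain ⟨b, c, l, rfl⟩ : ∃ b c l', l = b :: c :: l' := by
    match l, hJ with
    | [], h => exact absurd h.1 (by simp)
    | [b], h => exact absurd h.1 (by simp)
    | b :: c :: l, _ => exact ⟨b, c, l, rfl⟩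
  obtain ⟨g, hg1, hg2⟩ := hJ.exists_increasing
  obtain ⟨ε, hε, hball⟩ := IsSimple.exists_ball (l₁ := [a]) hJ
  have hab := hJ.ne
  have hJ' := hJ
  rw [isSimple_cons_iff, simplePath_cons, simplePath_cons] at hJ'
  obtain ⟨hlen, ⟨hs, hd2⟩, hd1⟩ := hJ'
  obtain ⟨τ, hτ0, hτ1, hτa, hτc⟩ : ∃ τ : ℝ, 0 < τ ∧ τ < 1 ∧ τ * ‖b - a‖ < ε ∧ τ * ‖c - b‖ < ε := by
    have hN : 0 < ‖b - a‖ + ‖c - b‖ + 1 + ε := by positivity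
    refine ⟨ε / (‖b - a‖ + ‖c - b‖ + 1 + ε), by positivity, ?_, ?_, ?_⟩
    · rw [div_lt_one hN]; linarith [norm_nonneg (b - a), norm_nonneg (c - b)]
    · rw [div_mul_eq_mul_div, div_lt_iff₀ hN]; nlinarith [norm_nonneg (b - a), norm_nonneg (c - b)]
    · rw [div_mul_eq_mul_div, div_lt_iff₀ hN]; nlinarith [norm_nonneg (b - a), norm_nonneg (c - b)]
  -- The chord from `x t` to `y t` carries the arc around the corner `b`: at time `0` it is the last
  -- piece of the edge `ab`, at time `1` the first piece of the edge `bc`. The bounds on `τ` keep it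
  -- in the ball in which `b` may be moved.
  set x : ℝ → Space := fun t => a + (1 - τ + t * τ) • (b - a) with hx
  set y : ℝ → Space := fun t => b + (t * τ) • (c - b) with hy
  have hyx : ∀ t, y t - x t = ((1 - t) * τ) • (b - a) + (t * τ) • (c - b) := by
    intro t; simp only [hx, hy]; module
  have hxc : Continuous x := by fun_prop
  have hyc : Continuous y := by fun_prop
  have hxball : ∀ t ∈ Set.Icc (0 : ℝ) 1, x t ∈ Metric.ball b ε := by
    intro t ht
    have : x t - b = (-(τ - t * τ)) • (b - a) := by simp only [hx]; module
    rw [mem_ball_iff_norm, this, norm_smul, norm_neg, Real.norm_of_nonneg (by nlinarith [ht.2])]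
    have : t * τ * ‖b - a‖ ≥ 0 := mul_nonneg (mul_nonneg ht.1 hτ0.le) (norm_nonneg _)
    nlinarith
  have hyball : ∀ t ∈ Set.Icc (0 : ℝ) 1, y t ∈ Metric.ball b ε := by
    intro t ht
    have : y t - b = (t * τ) • (c - b) := by simp only [hy]; module
    rw [mem_ball_iff_norm, this, norm_smul, Real.norm_of_nonneg (mul_nonneg ht.1 hτ0.le)]
    have : 0 ≤ (1 - t) * (τ * ‖c - b‖) :=
      mul_nonneg (by linarith [ht.2]) (mul_nonneg hτ0.le (norm_nonneg _))
    nlinarith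
  have hsimp : ∀ t ∈ Set.Icc (0 : ℝ) 1, IsSimple (a :: x t :: y t :: c :: l) := by
    intro t ht
    have htτ : 0 ≤ t * τ := mul_nonneg ht.1 hτ0.le
    have htτ1 : t * τ < 1 := by nlinarith [ht.2]
    have htτ2 : t * τ ≤ τ := by nlinarith [ht.2]
    have s1 : hseg a (x t) ⊆ hseg a b :=
      hseg_subset_hseg le_rfl (by linarith) (by linarith) one_pos (by simp) rfl
    have s2 : hseg (y t) c ⊆ hseg b c :=
      hseg_subset_hseg htτ htτ1.le le_rfl htτ1 rfl (by simp)
    -- The functional `g` increases along `a`, `x t`, `y t`, `c`, which makes the three edges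
    -- between them disjoint.
    have gb : ∀ {p q z : Space}, 0 < g (q - p) → z ∈ hseg p q → g p ≤ g z ∧ g z < g q := by
      intro p q z hpq hz
      obtain ⟨u, hu0, hu1, rfl⟩ := mem_hseg.1 hz
      rw [map_sub] at hpq
      rw [map_add, map_smul, map_sub, smul_eq_mul]; constructor <;> nlinarith
    have gax : 0 < g (x t - a) := by
      rw [show x t - a = (1 - τ + t * τ) • (b - a) by simp only [hx]; abel, map_smul, smul_eq_mul]
      exact mul_pos (by linarith) hg1
    have gxy : 0 < g (y t - x t) := by
      rw [hyx, map_add, map_smul, map_smul, smul_eq_mul, smul_eq_mul]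
      rcases ht.1.lt_or_eq with h0 | h0
      · have h1 := mul_pos (mul_pos h0 hτ0) hg2
        have h2 := mul_nonneg (mul_nonneg (sub_nonneg.2 ht.2) hτ0.le) hg1.le
        linarith
      · rw [← h0]; simpa using mul_pos hτ0 hg1
    have gyc : 0 < g (c - y t) := by
      rw [show c - y t = (1 - t * τ) • (c - b) by simp only [hy]; module, map_smul, smul_eq_mul]
      exact mul_pos (by linarith) hg2
    rw [isSimple_cons_iff, simplePath_cons, simplePath_cons, simplePath_cons]
    refine ⟨by simp, ⟨⟨hs, hd2.mono_left s2⟩, ?_⟩, ?_⟩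
    · rw [Set.disjoint_left]
      rintro z hz (hz' | hz')
      · have h1 := gb gxy hz
        have h2 := gb gyc hz'
        linarith
      -- Every point `z` of the chord is an admissible new position of the vertex `b`, so it is not
      -- on the rest of the polygon.
      · have hzb : z ∈ Metric.ball b ε :=
          (convex_ball b ε).segment_subset (hxball t ht) (hyball t ht) (hseg_subset_segment _ _ hz)
        have := hball z hzb
        rw [List.singleton_append, isSimple_cons_iff, simplePath_cons, simplePath_cons] at this
        exact Set.disjoint_left.1 this.2.1.2 (left_mem_hseg _ _) hz'
    · rw [Set.disjoint_left]
      rintro z hz (hz' | hz' | hz')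
      · have h1 := gb gax hz
        have h2 := gb gxy hz'
        linarith
      · have h1 := gb gax hz
        have h2 := gb gyc hz'
        rw [map_sub] at gxy; linarith
      · exact Set.disjoint_left.1 hd1 (s1 hz) (Or.inr hz')
  set d₀ : Space := τ • (b - a) with hd₀
  set d₁ : Space := τ • (c - b) with hd₁
  have hgd₀ : 0 < g d₀ := by rw [hd₀, map_smul]; exact mul_pos hτ0 hg1
  have hgd₁ : 0 < g d₁ := by rw [hd₁, map_smul]; exact mul_pos hτ0 hg2
  have hd₀0 : d₀ ≠ 0 := by intro e; rw [e, map_zero] at hgd₀; exact hgd₀.ne rfl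
  obtain ⟨M₀, hM₀, hM₀d⟩ := exists_frame (sub_ne_zero.2 T.ne) hd₀0
  -- A transvection that turns the direction of the chord at time `0` into the one at time `t`. Its
  -- determinant is a convex combination of `1` and `g d₁ / g d₀`, hence positive.
  set R : ℝ → Space →ₗ[ℝ] Space := fun t =>
    LinearMap.transvection ((t / g d₀) • g) (d₁ - d₀) with hR
  have hRdet : ∀ t ∈ Set.Icc (0 : ℝ) 1, 0 < LinearMap.det (R t) := by
    intro t ht
    rw [hR, LinearMap.transvection.det, LinearMap.smul_apply, map_sub, smul_eq_mul]
    have h1 : t / g d₀ * (g d₁ - g d₀) = t * (g d₁ / g d₀) - t := by field_simp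
    rw [h1]
    rcases ht.1.lt_or_eq with h0 | h0
    · have := mul_pos h0 (div_pos hgd₁ hgd₀); linarith [ht.2]
    · rw [← h0]; norm_num
  have hRd : ∀ t, R t d₀ = y t - x t := by
    intro t
    rw [hR, LinearMap.transvection.apply, LinearMap.smul_apply, smul_eq_mul,
      div_mul_cancel₀ _ hgd₀.ne', hyx, hd₀, hd₁]; module
  set M : ℝ → Space →ₗ[ℝ] Space := fun t => R t ∘ₗ M₀ with hM
  have hMdet : ∀ t ∈ Set.Icc (0 : ℝ) 1, 0 < LinearMap.det (M t) := by
    intro t ht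
    rw [hM, LinearMap.det_comp]; exact mul_pos (hRdet t ht) hM₀
  have hMd : ∀ t, M t (T.P - T.Q) = y t - x t := by
    intro t; rw [hM, LinearMap.comp_apply, hM₀d, hRd]
  have hMc : ∀ z, Continuous fun t => M t z := by
    intro z
    simp only [hM, hR, LinearMap.comp_apply, LinearMap.transvection.apply, LinearMap.smul_apply,
      smul_eq_mul]
    fun_prop
  set m : ℝ → Space := fun t => x t + (1 / 2 : ℝ) • (y t - x t) with hm
  have hmc : Continuous m := by fun_prop
  have hlc : ∀ g ∈ y :: ((c :: l) ++ [a]).map (fun (z : Space) (_ : ℝ) => z),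
      ContinuousOn g (Set.Icc 0 1) := by
    simp only [List.mem_cons, List.mem_map]
    rintro g (rfl | ⟨z, -, rfl⟩)
    · exact hyc.continuousOn
    · exact continuousOn_const
  obtain ⟨s, hs0, hfit⟩ := T.exists_fits_family (x := x) (y := y) (m := m)
    (l := ((c :: l) ++ [a]).map fun z _ => z) (M := M) hxc.continuousOn hlc hmc.continuousOn
    (fun z => (hMc z).continuousOn)
    (fun t ht => by
      have := (hsimp t ht).rotate
      simpa [Function.comp_def] using this)
    (fun t ht => injective_of_det_pos (hMdet t ht))
    (fun t ht => ⟨1, one_pos, by rw [one_smul, hMd]⟩) (fun t ht => midpoint_mem_openSegment)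
  have hfit' : ∀ t ∈ Set.Icc (0 : ℝ) 1, T.Fits (x t) (y t) ((c :: l) ++ [a]) (m t) (s • M t) := by
    intro t ht
    simpa [Function.comp_def] using hfit s hs0 le_rfl t ht
  have hiso := isotopic_of_fits_family (T := T) (x := x) (y := y) (m := m)
    (l := ((c :: l) ++ [a]).map fun z _ => z) (M := fun t => s • M t) hxc.continuousOn hlc
    hmc.continuousOn
    (fun z => by simp only [LinearMap.smul_apply]; exact (hMc z).continuousOn.const_smul s)
    (fun t ht => hfit s hs0 le_rfl t ht)
  have h01 : (0 : ℝ) ∈ Set.Icc (0 : ℝ) 1 := by simp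
  have h11 : (1 : ℝ) ∈ Set.Icc (0 : ℝ) 1 := by simp
  have y0 : y 0 = b := by simp [hy]
  have x1 : x 1 = b := by simp [hx]
  have x0 : x 0 = a + (1 - τ) • (b - a) := by simp [hx]
  have y1 : y 1 = b + τ • (c - b) := by simp [hy]
  have F0 := hfit' 0 h01
  have F1 := hfit' 1 h11
  have hiso' : Isotopic (T.insert (x 0) (b :: (c :: l) ++ [a]) (m 0) (s • M 0))
      (T.insert b (y 1 :: (c :: l) ++ [a]) (m 1) (s • M 1)) := by
    have := hiso
    rw [y0, x1] at this
    simpa [Function.comp_def] using this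
  rw [y0] at F0
  rw [x1] at F1
  -- the copy near the end of the first edge
  have G0 : T.Fits a b (c :: l) (m 0) (s • M 0) := by
    obtain ⟨ρ, hρ, hb1, hb2⟩ := F0.ball
    obtain ⟨r, hr, hrd⟩ := F0.dir
    obtain ⟨u, hu0, hu1, hu⟩ := mem_openSegment_iff.1 F0.mem
    refine ⟨hJ, F0.inj, ⟨r * τ, by positivity, ?_⟩, mem_openSegment_iff.2
      ⟨(1 - τ) + u * τ, by nlinarith, by nlinarith, ?_⟩, ρ, hρ, hb1, fun z hz => ?_⟩
    · rw [hrd, x0, mul_smul]; congr 1; module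
    · rw [hu, x0]; module
    · have := (hb2 z hz).1
      rw [← List.cons_append, path_append] at this
      refine ⟨fun h => this (Or.inl h), ?_⟩
      rintro rfl
      exact this (Or.inr (mem_path_of_mem (by simp)))
  have G1 : T.Fits b c (l ++ [a]) (m 1) (s • M 1) := by
    obtain ⟨ρ, hρ, hb1, hb2⟩ := F1.ball
    obtain ⟨r, hr, hrd⟩ := F1.dir
    obtain ⟨u, hu0, hu1, hu⟩ := mem_openSegment_iff.1 F1.mem
    refine ⟨hJ.rotate, F1.inj, ⟨r * τ, by positivity, ?_⟩, mem_openSegment_iff.2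
      ⟨u * τ, by positivity, by nlinarith, ?_⟩, ρ, hρ, hb1, fun z hz => ?_⟩
    · rw [hrd, y1, mul_smul]; congr 1; module
    · rw [hu, y1]; module
    · refine ⟨fun h => (hb2 z hz).1 (Or.inr h), (hb2 z hz).2⟩
  have I0 : T.InsertedInto (a :: b :: c :: l) (T.insert a (b :: c :: l) (m 0) (s • M 0)) :=
    ⟨a, b, c :: l, _, _, rfl, det_smul_pos (hMdet 0 h01) hs0, G0, rfl⟩
  have I1 : T.InsertedInto (b :: c :: l ++ [a]) (T.insert b (c :: l ++ [a]) (m 1) (s • M 1)) :=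
    ⟨b, c, l ++ [a], _, _, rfl, det_smul_pos (hMdet 1 h11) hs0, G1, rfl⟩
  -- Only subdivisions remain: the family begins with the additional vertex `x 0` before the arc and
  -- ends with the additional vertex `y 1` after it.
  refine ⟨_, I1, (h.unique I0).trans (Isotopic.trans ?_ (hiso'.trans ?_))⟩
  · obtain ⟨u, hu0, hu1, hu⟩ := mem_openSegment_iff.1 F0.mem
    have S0 := G0.isSimple
    rw [insert_eq] at S0
    have hmem : x 0 ∈ openSegment ℝ a (T.place (m 0) (s • M 0) T.Q) := by
      rw [T.place_Q, hu, x0]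
      have hpos : 0 < 1 - τ + u * τ := by nlinarith
      refine mem_openSegment_iff.2 ⟨(1 - τ) / (1 - τ + u * τ), div_pos (by linarith) hpos,
        (div_lt_one hpos).2 (by nlinarith), ?_⟩
      have : a + (1 - τ) • (b - a) + u • (b - (a + (1 - τ) • (b - a))) - a =
          (1 - τ + u * τ) • (b - a) := by module
      rw [this, smul_smul, div_mul_cancel₀ _ hpos.ne']
    have e1 := isotopic_subdivide S0 hmem
    have e2 := isotopic_rotate (e1.isSimple_iff.1 S0)
    have := e1.trans e2
    rw [insert_eq, insert_eq]
    simpa using this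
  · obtain ⟨u, r, hu, hr, hur, -, hP, -⟩ := F1.positions
    have S1 := G1.isSimple
    have hmem : y 1 ∈ openSegment ℝ (T.place (m 1) (s • M 1) T.P) c := by
      rw [hP, y1]
      have hlt : (u + r) * τ < τ := by nlinarith
      have hpos : 0 < 1 - (u + r) * τ := by linarith
      refine mem_openSegment_iff.2 ⟨(1 - (u + r)) * τ / (1 - (u + r) * τ),
        div_pos (mul_pos (by linarith) hτ0) hpos, (div_lt_one hpos).2 (by linarith), ?_⟩
      have : c - (b + (u + r) • (b + τ • (c - b) - b)) = (1 - (u + r) * τ) • (c - b) := by module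
      rw [this, smul_smul, div_mul_cancel₀ _ hpos.ne']; module
    have e : T.insert b (c :: l ++ [a]) (m 1) (s • M 1) =
        (b :: (T.Q :: T.B).map (T.place (m 1) (s • M 1))) ++
          T.place (m 1) (s • M 1) T.P :: c :: (l ++ [a]) := by simp [insert_eq]
    rw [List.cons_append] at e
    rw [e] at S1
    have := isotopic_subdivide_append S1 hmem
    refine Isotopic.symm ?_
    change Isotopic (T.insert b (c :: (l ++ [a])) _ _) _
    rw [e]
    simpa [insert_eq] using this

/-- Insertion of an arc commutes with `Δ`-moves of the polygon. -/
theorem InsertedInto.exists_delta {T : Tangle} {a b c : Space} {l k : List Space}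
    (h : T.InsertedInto (a :: b :: l) k) (h' : IsSimple (a :: c :: b :: l))
    (htri : convexHull ℝ {a, b, c} ∩ carrier (a :: b :: l) = segment ℝ a b) :
    ∃ k', T.InsertedInto (b :: l ++ [a, c]) k' ∧ Isotopic k k' := by
  have hJ := h.isSimple_left
  obtain ⟨d, l, rfl⟩ : ∃ d l', l = d :: l' := by
    match l, hJ with
    | [], h => exact absurd h.1 (by simp)
    | d :: l, _ => exact ⟨d, l, rfl⟩
  -- The arc leaves the edge `ab`, which is about to change, for the next edge `bd`.
  obtain ⟨k₁, hk₁, hkk₁⟩ := h.exists_rotate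
  have hJ₁ : IsSimple (b :: d :: (l ++ [a])) := hJ.rotate
  have hJ₁' : IsSimple (b :: d :: (l ++ [a, c])) := by
    have := h'.rotate.rotate; simpa using this
  rw [carrier_eq (by simp), start_cons, path_cons, start_cons] at htri
  have hJ' := hJ
  rw [isSimple_cons_iff, simplePath_cons] at hJ'
  obtain ⟨-, -, hd⟩ := hJ'
  set m : Space := b + (1 / 2 : ℝ) • (d - b) with hm
  have hmP : m ∈ path (b :: d :: l) a := Or.inl (mem_hseg.2 ⟨1 / 2, by norm_num, by norm_num, rfl⟩)
  -- The triangle meets the polygon in `ab` only, so a ball around the midpoint of `bd` avoids it. A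
  -- copy of the arc inside this ball does not disturb the `Δ`-move.
  have hmtri : m ∉ convexHull ℝ ({a, b, c} : Set Space) := by
    intro hmt
    have h1 : m ∈ segment ℝ a b := by rw [← htri]; exact ⟨hmt, Or.inr hmP⟩
    rw [segment_eq_hseg_union] at h1
    rcases h1 with h1 | h1
    · exact Set.disjoint_left.1 hd h1 hmP
    · have := Set.mem_singleton_iff.1 h1
      rw [hm, add_eq_left, smul_eq_zero] at this
      rcases this with h2 | h2
      · norm_num at h2
      · exact hJ₁.ne (sub_eq_zero.1 h2).symm
  have hclosed : IsClosed (convexHull ℝ ({a, b, c} : Set Space)) :=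
    ((Set.toFinite _).isCompact_convexHull (𝕜 := ℝ)).isClosed
  obtain ⟨ρ, hρ, hρb⟩ := Metric.isOpen_iff.1 hclosed.isOpen_compl m hmtri
  obtain ⟨M, hMdet, hMd⟩ := exists_frame (sub_ne_zero.2 T.ne) (sub_ne_zero.2 hJ₁.ne.symm)
  have hdir : ∃ r : ℝ, 0 < r ∧ M (T.P - T.Q) = r • (d - b) := ⟨1, one_pos, by rw [one_smul, hMd]⟩
  obtain ⟨s₁, hs₁, hf₁⟩ := T.exists_fits hJ₁ (injective_of_det_pos hMdet) hdir
    midpoint_mem_openSegment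
  obtain ⟨s₂, hs₂, hf₂⟩ := T.exists_fits hJ₁' (injective_of_det_pos hMdet) hdir
    midpoint_mem_openSegment
  obtain ⟨C, hC, hbd⟩ := exists_uniform_bound (M := fun _ => M) (fun z => continuousOn_const)
    (T.verts.map fun z => z - T.Q)
  set s : ℝ := min (min s₁ s₂) (ρ / (2 * C)) with hs
  have hs0 : 0 < s := lt_min (lt_min hs₁ hs₂) (by positivity)
  have F₁ := hf₁ s hs0 ((min_le_left _ _).trans (min_le_left _ _))
  have F₂ := hf₂ s hs0 ((min_le_left _ _).trans (min_le_right _ _))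
  have hsmall : ∀ x ∈ T.verts, T.place m (s • M) x ∈ Metric.ball m ρ := by
    intro z hz
    rw [place_apply, mem_ball_iff_norm, add_sub_cancel_left, LinearMap.smul_apply, norm_smul,
      Real.norm_of_nonneg hs0.le]
    have h1 := hbd 0 (by simp) (z - T.Q) (List.mem_map_of_mem hz)
    have h2 : s * (2 * C) ≤ ρ := by
      have : s ≤ ρ / (2 * C) := min_le_right _ _
      rwa [le_div_iff₀ (by positivity)] at this
    nlinarith [norm_nonneg (M (z - T.Q))]
  have I₁ : T.InsertedInto (b :: d :: (l ++ [a])) (T.insert b (d :: (l ++ [a])) m (s • M)) :=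
    ⟨b, d, l ++ [a], _, _, rfl, det_smul_pos hMdet hs0, F₁, rfl⟩
  have I₂ : T.InsertedInto (b :: d :: l ++ [a, c]) (T.insert b (d :: (l ++ [a, c])) m (s • M)) :=
    ⟨b, d, l ++ [a, c], _, _, rfl, det_smul_pos hMdet hs0, F₂, rfl⟩
  refine ⟨_, I₂, hkk₁.trans ((hk₁.unique I₁).trans ?_)⟩
  set A := T.insert b (d :: l) m (s • M) with hA
  have e1 : T.insert b (d :: (l ++ [a])) m (s • M) = A ++ [a] := by simp [hA, insert]
  have e2 : T.insert b (d :: (l ++ [a, c])) m (s • M) = A ++ [a, c] := by simp [hA, insert]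
  obtain ⟨A', hA'⟩ : ∃ A', A = b :: A' := ⟨_, rfl⟩
  have sA1 := F₁.isSimple
  have sA2 := F₂.isSimple
  rw [e1] at sA1 ⊢
  rw [e2] at sA2 ⊢
  have r1 := isotopic_append_comm sA1
  have r2 := isotopic_append_comm sA2
  refine r1.trans (Isotopic.trans ?_ r2.symm)
  have q1 := r1.isSimple_iff.1 sA1
  have q2 := r2.isSimple_iff.1 sA2
  rw [hA'] at q1 q2 ⊢
  refine Relation.EqvGen.rel _ _ (OrientedStep.delta a b c A' q1 q2 ?_)
  rw [carrier_eq (by simp), start_cons, path_cons, start_cons]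
  refine Set.Subset.antisymm ?_ ?_
  · rintro x ⟨hx, hx' | hx'⟩
    · exact hseg_subset_segment _ _ hx'
    · have hsub := F₁.path_subset hsmall l a
      rw [← hA, hA'] at hsub
      rcases hsub hx' with h3 | h3
      · rw [← htri]; exact ⟨hx, Or.inr h3⟩
      · exact absurd hx (hρb h3)
  · intro x hx
    refine ⟨(segment_subset_triangle a b c).1 hx, ?_⟩
    rw [segment_eq_hseg_union] at hx
    rcases hx with hx | hx
    · exact Or.inl hx
    · rw [Set.mem_singleton_iff.1 hx]; exact Or.inr (mem_path_of_mem (by simp))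

/-- The insertion of an arc is well defined on oriented isotopy classes. -/
theorem InsertedInto.isotopic {T : Tangle} {J J' k k' : List Space} (hJ : Isotopic J J')
    (h : T.InsertedInto J k) (h' : T.InsertedInto J' k') : Isotopic k k' := by
  induction hJ generalizing k k' with
  | refl => exact h.unique h'
  | symm _ _ _ ih => exact (ih h' h).symm
  | trans _ J₂ _ h1 _ ih1 ih2 =>
    obtain ⟨k₂, hk₂⟩ := T.exists_insertedInto ((Isotopic.isSimple_iff h1).1 h.isSimple_left)
    exact (ih1 h hk₂).trans (ih2 hk₂ h')
  | rel _ _ hst =>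
    cases hst with
    | rotate a l hs =>
      obtain ⟨k₁, hk₁, e⟩ := h.exists_rotate
      exact e.trans (hk₁.unique h')
    | delta a b c l hs hs' htri =>
      -- This leaves the arc on the edge that starts at `b`. In the new polygon the arc starts on
      -- `ac` and has to pass the corners `c` and `b` to get there.
      obtain ⟨k₁, hk₁, e⟩ := h.exists_delta hs' htri
      obtain ⟨k₂, hk₂, e₂⟩ := h'.exists_rotate
      obtain ⟨k₃, hk₃, e₃⟩ := InsertedInto.exists_rotate (a := c) (l := b :: l ++ [a]) hk₂
      have e4 : b :: l ++ [a] ++ [c] = b :: l ++ [a, c] := by simp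
      rw [e4] at hk₃
      exact e.trans ((hk₁.unique hk₃).trans (e₂.trans e₃).symm)

end Tangle

end KnotTheory


/-! ### Shrinking an arc that is separated from the rest by a plane -/

namespace KnotTheory

theorem simplePath_shrink_start {E : Type*} [AddCommGroup E] [Module ℝ E] {a a' b e : E} {l : List E}
    (h : SimplePath (a :: b :: l) e) (hs : hseg a' b ⊆ hseg a b) : SimplePath (a' :: b :: l) e := by
  rw [simplePath_cons] at h ⊢
  exact ⟨h.1, h.2.mono_left hs⟩

theorem simplePath_shrink_end {E : Type*} [AddCommGroup E] [Module ℝ E] {b e e' : E} {l : List E}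
    (h : SimplePath (l ++ [b]) e) (hs : hseg b e' ⊆ hseg b e) : SimplePath (l ++ [b]) e' := by
  rw [simplePath_append] at h ⊢
  exact ⟨h.1, simplePath_singleton _ _, h.2.2.mono_right (by simpa using hs)⟩

theorem isSimple_cons_append_cons_cons {E : Type*} [AddCommGroup E] [Module ℝ E] {a q p b : E}
    {l l' : List E} (hl : SimplePath (q :: l) p) (hl' : SimplePath (b :: l') a)
    (h₁ : Disjoint (hseg p b) (path (b :: l') a))
    (h₂ : ∀ z ∈ path (q :: l) p, z ∈ hseg p b ∨ z ∈ path (b :: l') a → False)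
    (h₃ : ∀ z ∈ hseg a q, z ∈ path (q :: l) p ∨ z ∈ hseg p b ∨ z ∈ path (b :: l') a → False) :
    IsSimple (a :: q :: (l ++ p :: b :: l')) := by
  rw [isSimple_cons_iff, simplePath_cons, ← List.cons_append, simplePath_append, simplePath_cons,
    path_append]
  exact ⟨by simp; omega, ⟨hl, ⟨hl', h₁⟩, Set.disjoint_left.2 fun z hz hz' => h₂ z hz hz'⟩,
    Set.disjoint_left.2 fun z hz hz' => h₃ z hz hz'⟩

namespace Tangle

theorem exists_fits_in (T : Tangle) {a b : Space} {l : List Space} {m : Space}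
    {M : Space →ₗ[ℝ] Space} (hs : IsSimple (a :: b :: l)) (hinj : Function.Injective M)
    (hdir : ∃ r : ℝ, 0 < r ∧ M (T.P - T.Q) = r • (b - a)) (hm : m ∈ openSegment ℝ a b)
    {U : Set Space} (hU : IsOpen U) (hmU : m ∈ U) :
    ∃ s₀ : ℝ, 0 < s₀ ∧ ∀ s, 0 < s → s ≤ s₀ → T.Fits a b l m (s • M) ∧
      ∀ x ∈ T.verts, T.place m (s • M) x ∈ U := by
  obtain ⟨s₁, hs₁, hf⟩ := T.exists_fits hs hinj hdir hm
  obtain ⟨ρ, hρ, hρb⟩ := Metric.isOpen_iff.1 hU m hmU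
  obtain ⟨C, hC, hbd⟩ := exists_uniform_bound (M := fun _ => M) (fun z => continuousOn_const)
    (T.verts.map fun z => z - T.Q)
  refine ⟨min s₁ (ρ / (2 * C)), lt_min hs₁ (by positivity), fun s h0 h1 =>
    ⟨hf s h0 (h1.trans (min_le_left _ _)), fun z hz => hρb ?_⟩⟩
  rw [place_apply, mem_ball_iff_norm, add_sub_cancel_left, LinearMap.smul_apply, norm_smul,
    Real.norm_of_nonneg h0.le]
  have h2 := hbd 0 (by simp) (z - T.Q) (List.mem_map_of_mem hz)
  have h3 : s * (2 * C) ≤ ρ := by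
    have : s ≤ ρ / (2 * C) := h1.trans (min_le_right _ _)
    rwa [le_div_iff₀ (by positivity)] at this
  nlinarith [norm_nonneg (M (z - T.Q))]

/-- The segment `QP` lies in the plane, while the rest runs strictly beyond it except at its start
`P` and its excluded end `Q`. -/
theorem isSimple_of_closed {T : Tangle} {A : List Space} (hne : A ≠ [])
    (hA : ∀ a ∈ A, T.f T.Q < T.f a) (hk : IsSimple (T.verts ++ A)) :
    IsSimple (T.Q :: T.P :: A) := by
  have e : T.verts ++ A = T.Q :: T.B ++ T.P :: A := by simp [verts]
  rw [e, List.cons_append, isSimple_cons_iff, ← List.cons_append, simplePath_append] at hk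
  obtain ⟨-, -, h2, -⟩ := hk
  rw [isSimple_cons_iff, simplePath_cons]
  refine ⟨by have := List.length_pos_iff.2 hne; simp; omega, h2, Set.disjoint_left.2 fun x hx hx' => ?_⟩
  have hlev : T.f x = T.f T.Q := by
    obtain ⟨t, -, -, rfl⟩ := mem_hseg.1 hx
    rw [map_add, map_smul, map_sub, T.level, sub_self, smul_zero, add_zero]
  rcases lt_or_eq_of_mem_path hne T.level.ge hA le_rfl hx' with h | h
  · exact h.ne' hlev
  · rw [h] at hx
    exact right_notMem_hseg T.ne.symm hx

set_option maxHeartbeats 1000000 in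
/-- If the rest of the polygon lies on the other side of the plane, then the arc can be shrunk to
an inserted copy of itself. -/
theorem InsertedInto.isotopic_closed {T : Tangle} {A k : List Space} (hne : A ≠ [])
    (hA : ∀ a ∈ A, T.f T.Q < T.f a) (hk : IsSimple (T.verts ++ A))
    (h : T.InsertedInto (T.Q :: T.P :: A) k) : Isotopic (T.verts ++ A) k := by
  have hJ := isSimple_of_closed hne hA hk
  have hk' := hk
  have e : T.verts ++ A = T.Q :: T.B ++ T.P :: A := by simp [verts]
  rw [e, List.cons_append, isSimple_cons_iff, ← List.cons_append, simplePath_append] at hk'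
  obtain ⟨-, hTB, hPA, -⟩ := hk'
  obtain ⟨b₀, B', hB'⟩ : ∃ b B', T.B = b :: B' := by
    cases hB : T.B with
    | nil => exact absurd hB T.ne_nil
    | cons b B' => exact ⟨b, B', rfl⟩
  obtain ⟨B'', b₁, hB''⟩ : ∃ B'' b, T.B = B'' ++ [b] := by
    rcases List.eq_nil_or_concat T.B with h0 | ⟨B'', b, h0⟩
    · exact absurd h0 T.ne_nil
    · exact ⟨B'', b, by simpa using h0⟩
  set c := T.f T.Q with hc
  have hb₀ : 0 < c - T.f b₀ := sub_pos.2 (T.below b₀ (by simp [hB']))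
  have hb₁ : 0 < c - T.f b₁ := sub_pos.2 (T.below b₁ (by simp [hB'']))
  -- The functional `f` tells the arc from `A`. A second functional is needed to tell what happens
  -- near `Q` from what happens near `P`.
  obtain ⟨g', hg'⟩ := SeparatingDual.exists_eq_one (R := ℝ) (sub_ne_zero.2 T.ne)
  set g : Space →ₗ[ℝ] ℝ := g'.toLinearMap with hg
  have hgh : g (T.P - T.Q) = 1 := hg'
  -- The directions from `Q` and from `P` into the arc, scaled so that the level drops at unit speed
  -- along both.
  set u₁ : Space := (c - T.f b₀)⁻¹ • (b₀ - T.Q) with hu₁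
  set u₂ : Space := (c - T.f b₁)⁻¹ • (b₁ - T.P) with hu₂
  have fu₁ : T.f u₁ = -1 := by
    rw [hu₁, map_smul, map_sub, smul_eq_mul, ← hc]; field_simp; ring
  have fu₂ : T.f u₂ = -1 := by
    rw [hu₂, map_smul, map_sub, smul_eq_mul, T.level, ← hc]; field_simp; ring
  -- At depth `η` the points on the two end edges are still above all inner vertices and on their
  -- own sides of the middle with respect to `g`.
  obtain ⟨η, hη, hηB, hη1, hη2⟩ : ∃ η : ℝ, 0 < η ∧ (∀ b ∈ T.B, η < c - T.f b) ∧
      η * |g u₁| < 1 / 2 ∧ η * |g u₂| < 1 / 2 := by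
    have hall : ∀ L : List Space, (∀ b ∈ L, 0 < c - T.f b) → ∃ η : ℝ, 0 < η ∧ ∀ b ∈ L, η < c - T.f b := by
      intro L
      induction L with
      | nil => exact fun _ => ⟨1, one_pos, by simp⟩
      | cons a L ih =>
        intro hL
        obtain ⟨η, h0, h1⟩ := ih fun b hb => hL b (by simp [hb])
        have ha := hL a (by simp)
        refine ⟨min η ((c - T.f a) / 2), lt_min h0 (by linarith), fun b hb => ?_⟩
        rcases List.mem_cons.1 hb with rfl | hb
        · exact (min_le_right _ _).trans_lt (by linarith)
        · exact (min_le_left _ _).trans_lt (h1 b hb)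
    obtain ⟨η₀, h0, h1⟩ := hall T.B fun b hb => sub_pos.2 (T.below b hb)
    set N := |g u₁| + |g u₂| + 1 with hN
    have hNpos : 0 < N := by positivity
    refine ⟨min η₀ (1 / (2 * N)), lt_min h0 (by positivity),
      fun b hb => (min_le_left _ _).trans_lt (h1 b hb), ?_, ?_⟩
    · refine (mul_le_mul_of_nonneg_right (min_le_right _ _) (abs_nonneg _)).trans_lt ?_
      rw [div_mul_eq_mul_div, div_lt_div_iff₀ (by positivity) two_pos]
      have := abs_nonneg (g u₂); linarith
    · refine (mul_le_mul_of_nonneg_right (min_le_right _ _) (abs_nonneg _)).trans_lt ?_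
      rw [div_mul_eq_mul_div, div_lt_div_iff₀ (by positivity) two_pos]
      have := abs_nonneg (g u₁); linarith
  set mid : Space := T.Q + (1 / 2 : ℝ) • (T.P - T.Q) with hmid
  set q : ℝ → Space := fun θ => T.Q + (θ * η) • u₁ with hq
  set p : ℝ → Space := fun θ => T.P + (θ * η) • u₂ with hp
  -- The homothety with centre `mid` and ratio `σ`, written as a placement so that the final polygon
  -- is literally an insertion.
  set ψ : ℝ → Space →ᵃ[ℝ] Space := fun σ =>
    T.place (mid + σ • (T.Q - mid)) (σ • LinearMap.id) with hψ
  have ψa : ∀ σ z, ψ σ z = mid + σ • (z - mid) := by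
    intro σ z
    rw [hψ, place_apply, LinearMap.smul_apply, LinearMap.id_apply]; module
  have fmid : T.f mid = c := by
    rw [hmid, map_add, map_smul, map_sub, T.level, sub_self, smul_zero, add_zero]
  have fψ : ∀ σ z, T.f (ψ σ z) = c + σ * (T.f z - c) := by
    intro σ z; rw [ψa, map_add, map_smul, map_sub, fmid, smul_eq_mul]
  have fq : ∀ θ, T.f (q θ) = c - θ * η := by
    intro θ; simp only [hq, map_add, map_smul, fu₁, smul_eq_mul]; rw [← hc]; ring
  have fp : ∀ θ, T.f (p θ) = c - θ * η := by
    intro θ; simp only [hp, map_add, map_smul, fu₂, smul_eq_mul]; rw [T.level, ← hc]; ring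
  have gψ : ∀ σ z, g (ψ σ z - mid) = σ * g (z - mid) := by
    intro σ z; rw [ψa, add_sub_cancel_left, map_smul, smul_eq_mul]
  have gQ : g (T.Q - mid) = -(1 / 2) := by
    rw [show T.Q - mid = (-(1 / 2) : ℝ) • (T.P - T.Q) by rw [hmid]; module, map_smul, hgh]; simp
  have gP : g (T.P - mid) = 1 / 2 := by
    rw [show T.P - mid = (1 / 2 : ℝ) • (T.P - T.Q) by rw [hmid]; module, map_smul, hgh]; simp
  have gq : ∀ θ, 0 ≤ θ → θ ≤ 1 → g (q θ - mid) < 0 := by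
    intro θ h0 h1
    rw [show q θ - mid = (T.Q - mid) + (θ * η) • u₁ by simp only [hq]; abel, map_add, gQ, map_smul,
      smul_eq_mul]
    have h2 : θ * η * g u₁ ≤ η * |g u₁| := by
      have := le_abs_self (g u₁)
      have h3 : θ * (η * |g u₁|) ≤ 1 * (η * |g u₁|) :=
        mul_le_mul_of_nonneg_right h1 (by positivity)
      have h4 := mul_le_mul_of_nonneg_left this (mul_nonneg h0 hη.le)
      linarith
    linarith
  have gp : ∀ θ, 0 ≤ θ → θ ≤ 1 → 0 < g (p θ - mid) := by
    intro θ h0 h1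
    rw [show p θ - mid = (T.P - mid) + (θ * η) • u₂ by simp only [hp]; abel, map_add, gP, map_smul,
      smul_eq_mul]
    have h2 : -(η * |g u₂|) ≤ θ * η * g u₂ := by
      have := neg_abs_le (g u₂)
      have h3 : θ * (η * |g u₂|) ≤ 1 * (η * |g u₂|) :=
        mul_le_mul_of_nonneg_right h1 (by positivity)
      have h4 := mul_le_mul_of_nonneg_left this (mul_nonneg h0 hη.le)
      linarith
    linarith
  have ghs : ∀ {x y z : Space}, g (x - mid) < 0 → g (y - mid) < 0 → z ∈ hseg x y →
      g (z - mid) < 0 := by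
    intro x y z hx hy hz
    obtain ⟨t, h0, h1, rfl⟩ := mem_hseg.1 hz
    rw [show x + t • (y - x) - mid = (1 - t) • (x - mid) + t • (y - mid) by module, map_add,
      map_smul, map_smul, smul_eq_mul, smul_eq_mul]
    nlinarith
  have ghs' : ∀ {x y z : Space}, 0 < g (x - mid) → 0 < g (y - mid) → z ∈ hseg x y →
      0 < g (z - mid) := by
    intro x y z hx hy hz
    obtain ⟨t, h0, h1, rfl⟩ := mem_hseg.1 hz
    rw [show x + t • (y - x) - mid = (1 - t) • (x - mid) + t • (y - mid) by module, map_add,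
      map_smul, map_smul, smul_eq_mul, smul_eq_mul]
    nlinarith
  have hseg1 : ∀ θ, 0 ≤ θ → θ ≤ 1 → hseg (q θ) b₀ ⊆ hseg T.Q b₀ := by
    intro θ h0 h1
    have hlt : η < c - T.f b₀ := hηB b₀ (by simp [hB'])
    have hle : θ * η * (c - T.f b₀)⁻¹ < 1 := by
      rw [← div_eq_mul_inv, div_lt_one hb₀]; nlinarith
    refine hseg_subset_hseg (by positivity) hle.le le_rfl hle ?_ (by simp)
    simp only [hq, hu₁, smul_smul]
  have hseg2 : ∀ θ, 0 ≤ θ → θ ≤ 1 → hseg b₁ (p θ) ⊆ hseg b₁ T.P := by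
    intro θ h0 h1
    have hlt : η < c - T.f b₁ := hηB b₁ (by simp [hB''])
    have hle : θ * η * (c - T.f b₁)⁻¹ < 1 := by
      rw [← div_eq_mul_inv, div_lt_one hb₁]; nlinarith
    have h3 : 0 ≤ θ * η * (c - T.f b₁)⁻¹ := by positivity
    refine hseg_subset_hseg le_rfl (t := 1 - θ * η * (c - T.f b₁)⁻¹) (by linarith) (by linarith)
      one_pos (by simp) ?_
    simp only [hp, hu₂, smul_smul]; module
  have arc : ∀ θ, 0 ≤ θ → θ ≤ 1 → SimplePath (q θ :: T.B) (p θ) := by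
    intro θ h0 h1
    have s1 : SimplePath (T.Q :: T.B) (p θ) := by
      have := T.simple
      rw [hB'', ← List.cons_append] at this ⊢
      exact simplePath_shrink_end this (hseg2 θ h0 h1)
    rw [hB'] at s1 ⊢
    exact simplePath_shrink_start s1 (hseg1 θ h0 h1)
  have arcf : ∀ θ, 0 ≤ θ → θ ≤ 1 → ∀ z ∈ path (q θ :: T.B) (p θ), T.f z < c - θ * η ∨ z = q θ := by
    intro θ h0 h1 z hz
    refine gt_or_eq_of_mem_path T.ne_nil (fq θ).le (fun b hb => ?_) (fp θ).le hz
    have := hηB b hb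
    nlinarith
  have psi_inj : ∀ σ, 0 < σ → Function.Injective (ψ σ) := fun σ hσ =>
    T.place_injective _ (by
      intro x y hxy
      rw [LinearMap.smul_apply, LinearMap.smul_apply] at hxy
      exact smul_right_injective _ hσ.ne' hxy)
  -- The arc from `q θ` to `p θ` is scaled and joined to `Q` and `P` by straight edges. These edges
  -- lie in the slab between the levels `c - σθη` and `c`, the scaled arc lies below the slab except
  -- at its start, and the path from `P` through `A` lies above the plane except at `P`; contacts on
  -- the boundary levels are excluded by `g`. For `σ = 1` and `θ = 0` the joining edges would
  -- degenerate, whence the last hypothesis.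
  have hsimple : ∀ σ θ, 0 < σ → σ ≤ 1 → 0 ≤ θ → θ ≤ 1 → (σ < 1 ∨ 0 < θ) →
      IsSimple (T.Q :: ψ σ (q θ) :: (T.B.map (ψ σ) ++ ψ σ (p θ) :: T.P :: A)) := by
    intro σ θ hσ hσ1 hθ hθ1 hor
    have hneQ : T.Q ≠ ψ σ (q θ) := by
      intro e
      have h1 := congrArg T.f e
      rw [fψ, fq, ← hc] at h1
      have h2 : θ = 0 := by
        have : σ * (θ * η) = 0 := by linarith
        rcases mul_eq_zero.1 this with h | h
        · exact absurd h hσ.ne'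
        · exact (mul_eq_zero.1 h).resolve_right hη.ne'
      have h3 := congrArg (fun z => g (z - mid)) e
      simp only [gψ, h2, hq, zero_mul, zero_smul, add_zero, gQ] at h3
      rcases hor with h | h
      · linarith
      · exact h.ne' h2
    have hneP : ψ σ (p θ) ≠ T.P := by
      intro e
      have h1 := congrArg T.f e
      rw [fψ, fp, T.level, ← hc] at h1
      have h2 : θ = 0 := by
        have : σ * (θ * η) = 0 := by linarith
        rcases mul_eq_zero.1 this with h | h
        · exact absurd h hσ.ne'
        · exact (mul_eq_zero.1 h).resolve_right hη.ne'
      have h3 := congrArg (fun z => g (z - mid)) e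
      simp only [gψ, h2, hp, zero_mul, zero_smul, add_zero, gP] at h3
      rcases hor with h | h
      · linarith
      · exact h.ne' h2
    have gQ' : g (T.Q - mid) < 0 := by rw [gQ]; norm_num
    have gP' : 0 < g (T.P - mid) := by rw [gP]; norm_num
    have gψq : g (ψ σ (q θ) - mid) < 0 := by
      rw [gψ]; exact mul_neg_of_pos_of_neg hσ (gq θ hθ hθ1)
    have gψp : 0 < g (ψ σ (p θ) - mid) := by rw [gψ]; exact mul_pos hσ (gp θ hθ hθ1)
    have hθη : 0 ≤ σ * (θ * η) := by positivity
    have E1f : ∀ z ∈ hseg T.Q (ψ σ (q θ)), c - σ * (θ * η) ≤ T.f z ∧ T.f z ≤ c := by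
      intro z hz
      obtain ⟨t, h0, h1, rfl⟩ := mem_hseg.1 hz
      rw [map_add, map_smul, map_sub, fψ, fq, smul_eq_mul, ← hc,
        show c + t * (c + σ * (c - θ * η - c) - c) = c - t * (σ * (θ * η)) by ring]
      have h2 := mul_nonneg h0 hθη
      have h3 := mul_le_of_le_one_left hθη h1.le
      constructor <;> linarith only [h2, h3]
    have E3f : ∀ z ∈ hseg (ψ σ (p θ)) T.P, c - σ * (θ * η) ≤ T.f z ∧ T.f z ≤ c := by
      intro z hz
      obtain ⟨t, h0, h1, rfl⟩ := mem_hseg.1 hz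
      rw [map_add, map_smul, map_sub, fψ, fp, smul_eq_mul, T.level, ← hc,
        show c + σ * (c - θ * η - c) + t * (c - (c + σ * (c - θ * η - c))) =
          c - (1 - t) * (σ * (θ * η)) by ring]
      have h2 := mul_nonneg (sub_nonneg.2 h1.le) hθη
      have h3 := mul_le_of_le_one_left hθη (sub_le_self 1 h0)
      constructor <;> linarith only [h2, h3]
    have E2f : ∀ z ∈ path ((q θ :: T.B).map (ψ σ)) (ψ σ (p θ)),
        T.f z < c - σ * (θ * η) ∨ z = ψ σ (q θ) := by
      intro z hz
      rw [path_map] at hz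
      obtain ⟨y, hy, rfl⟩ := hz
      rcases arcf θ hθ hθ1 y hy with h | h
      · left; rw [fψ]; nlinarith
      · right; rw [h]
    have E4f : ∀ z ∈ path (T.P :: A) T.Q, c < T.f z ∨ z = T.P :=
      fun z hz => lt_or_eq_of_mem_path hne T.level.ge hA le_rfl hz
    have Bsimple := (arc θ hθ hθ1).map (psi_inj σ hσ)
    refine isSimple_cons_append_cons_cons Bsimple hPA ?_ ?_ ?_
    · rw [Set.disjoint_left]
      intro z hz hz'
      rcases E4f z hz' with h | h
      · linarith [(E3f z hz).2]
      · rw [h] at hz; exact right_notMem_hseg hneP hz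
    · rintro z hz (hz' | hz')
      · rcases E2f z hz with h | h
        · linarith [(E3f z hz').1]
        · have := ghs' gψp gP' hz'
          rw [h] at this; linarith
      · rcases E2f z hz with h | h <;> rcases E4f z hz' with h' | h'
        · linarith
        · rw [h', T.level] at h; linarith
        · rw [h, fψ, fq] at h'; linarith
        · rw [h] at h'; rw [h'] at gψq; linarith
    · rintro z hz (hz' | hz' | hz')
      · rcases E2f z hz' with h | h
        · linarith [(E1f z hz).1]
        · rw [h] at hz; exact right_notMem_hseg hneQ hz
      · have h1 := ghs gQ' gψq hz
        have h2 := ghs' gψp gP' hz'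
        linarith
      · rcases E4f z hz' with h | h
        · linarith [(E1f z hz).2]
        · have h1 := ghs gQ' gψq hz
          rw [h] at h1; linarith
  -- a small scale at which the shrunk arc fits
  obtain ⟨s₀, hs₀, hfit⟩ := T.exists_fits_family (x := fun _ => T.Q) (y := fun _ => T.P)
    (m := fun t => mid + (t / 2) • (T.Q - mid)) (l := A.map fun z _ => z)
    (M := fun _ => LinearMap.id) continuousOn_const
    (by simp only [List.mem_cons, List.mem_map]
        rintro g (rfl | ⟨z, -, rfl⟩) <;> exact continuousOn_const)
    (by fun_prop) (fun z => continuousOn_const)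
    (fun t ht => by simpa [Function.comp_def] using hJ) (fun _ _ => Function.injective_id)
    (fun _ _ => ⟨1, one_pos, by simp⟩)
    (fun t ht => mem_openSegment_iff.2 ⟨1 / 2 - t / 4, by linarith [ht.2], by linarith [ht.1],
      by simp only [hmid]; module⟩)
  set σ₀ : ℝ := min s₀ (1 / 2) with hσ₀
  have hσ₀0 : 0 < σ₀ := lt_min hs₀ (by norm_num)
  have hσ₀1 : σ₀ ≤ 1 / 2 := min_le_right _ _
  have F : T.Fits T.Q T.P A (mid + σ₀ • (T.Q - mid)) (σ₀ • LinearMap.id) := by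
    have := hfit σ₀ hσ₀0 (min_le_left _ _) (2 * σ₀) ⟨by linarith, by linarith⟩
    simpa [Function.comp_def, mul_div_cancel_left₀] using this
  have I : T.InsertedInto (T.Q :: T.P :: A)
      (T.insert T.Q (T.P :: A) (mid + σ₀ • (T.Q - mid)) (σ₀ • LinearMap.id)) :=
    ⟨_, _, _, _, _, rfl, det_smul_pos (by simp) hσ₀0, F, rfl⟩
  refine Isotopic.trans ?_ (I.unique h)
  -- the isotopy
  set σ : ℝ → ℝ := fun t => 1 - t * (1 - σ₀) with hσ
  have hfam := isotopic_of_family (l := (fun _ => T.Q) :: (fun t => ψ (σ t) (q (1 - t))) ::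
      (T.B.map (fun b t => ψ (σ t) b) ++ (fun t => ψ (σ t) (p (1 - t))) :: (fun _ => T.P) ::
        A.map fun z _ => z))
    (by
      intro γ hγ
      simp only [List.mem_cons, List.mem_append, List.mem_map] at hγ
      rcases hγ with rfl | rfl | ⟨z, -, rfl⟩ | rfl | rfl | ⟨z, -, rfl⟩
      · exact continuousOn_const
      · simp only [ψa, hq, hσ]; fun_prop
      · simp only [ψa, hσ]; fun_prop
      · simp only [ψa, hp, hσ]; fun_prop
      · exact continuousOn_const
      · exact continuousOn_const)
    (by
      intro t ht
      have h1 : 0 < σ t := by simp only [hσ]; nlinarith [ht.1, ht.2]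
      have h2 : σ t ≤ 1 := by simp only [hσ]; nlinarith [ht.1, ht.2]
      have := hsimple (σ t) (1 - t) h1 h2 (by linarith [ht.2]) (by linarith [ht.1]) (by
        rcases ht.2.lt_or_eq with h | h
        · right; linarith
        · left; simp only [hσ, h]; linarith)
      simpa [Function.comp_def] using this)
  have σ0 : σ 0 = 1 := by simp [hσ]
  have σ1 : σ 1 = σ₀ := by simp [hσ]
  have ψ1 : ∀ z, ψ 1 z = z := by intro z; rw [ψa]; module
  -- At the end `θ = 0`, so the joining edges are the two remaining pieces of the segment `QP`.
  have hend : T.insert T.Q (T.P :: A) (mid + σ₀ • (T.Q - mid)) (σ₀ • LinearMap.id) =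
      T.Q :: ψ σ₀ (q 0) :: (T.B.map (ψ σ₀) ++ ψ σ₀ (p 0) :: T.P :: A) := by
    rw [insert_eq]; simp [hq, hp, hψ]
  have hfam' : Isotopic (T.Q :: q 1 :: (T.B ++ p 1 :: T.P :: A))
      (T.insert T.Q (T.P :: A) (mid + σ₀ • (T.Q - mid)) (σ₀ • LinearMap.id)) := by
    rw [hend]
    simpa [Function.comp_def, σ0, σ1, ψ1] using hfam
  refine Isotopic.trans ?_ hfam'
  -- the two subdivisions
  have o1 : q 1 ∈ openSegment ℝ T.Q b₀ := by
    have hlt : η < c - T.f b₀ := hηB b₀ (by simp [hB'])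
    refine mem_openSegment_iff.2 ⟨η * (c - T.f b₀)⁻¹, by positivity, ?_, ?_⟩
    · rw [← div_eq_mul_inv, div_lt_one hb₀]; exact hlt
    · simp only [hq, hu₁, smul_smul, one_mul]
  have o2 : p 1 ∈ openSegment ℝ b₁ T.P := by
    have hlt : η < c - T.f b₁ := hηB b₁ (by simp [hB''])
    have h1 : η * (c - T.f b₁)⁻¹ < 1 := by
      rw [← div_eq_mul_inv, div_lt_one hb₁]; exact hlt
    have h2 : 0 < η * (c - T.f b₁)⁻¹ := by positivity
    refine mem_openSegment_iff.2 ⟨1 - η * (c - T.f b₁)⁻¹, by linarith, by linarith, ?_⟩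
    simp only [hp, hu₂, smul_smul, one_mul]; module
  have s1 : Isotopic (T.verts ++ A) (T.Q :: (T.B ++ p 1 :: T.P :: A)) := by
    have e1 : T.verts ++ A = (T.Q :: B'') ++ b₁ :: T.P :: A := by simp [verts, hB'']
    rw [e1] at hk ⊢
    have := isotopic_subdivide_append hk o2
    rw [hB'']; simpa using this
  have s2 := s1.isSimple_iff.1 hk
  refine s1.trans ?_
  rw [hB'] at s2 ⊢
  exact isotopic_subdivide s2 o1

end Tangle

/-! ### Cutting corners, and triangles -/

/-- The triangle `xwy` lies on the side `c ≤ f`, whereas the rest of the polygon is strictly below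
except at `y`. Hence removing `w` is an inverse `Δ`-move. -/
theorem isotopic_cut_corner {f : Space →ₗ[ℝ] ℝ} {c : ℝ} {w x y v₀ v : Space} {m : List Space}
    (h : IsSimple (w :: v₀ :: m ++ [v])) (hx : x ∈ openSegment ℝ v w) (hy : y ∈ openSegment ℝ w v₀)
    (fx : f x = c) (fy : f y = c) (hlow : ∀ z ∈ v₀ :: m ++ [v], f z < c) :
    Isotopic (w :: v₀ :: m ++ [v]) (x :: y :: v₀ :: m ++ [v]) := by
  have h1 := isotopic_subdivide h hy
  have h1s := h1.isSimple_iff.1 h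
  have h2 := isotopic_subdivide_last (l := y :: v₀ :: m) h1s hx
  have h2s := h2.isSimple_iff.1 h1s
  have e : w :: y :: v₀ :: m ++ [v, x] = (w :: y :: v₀ :: m ++ [v]) ++ [x] := by simp
  rw [e] at h2 h2s
  have h3 := isotopic_append_comm h2s
  have h3s := h3.isSimple_iff.1 h2s
  refine h1.trans (h2.trans (h3.trans ?_))
  have hxw : x ≠ w := IsSimple.ne h3s
  have hw : c < f w := by
    obtain ⟨t, t0, t1, rfl⟩ := Tangle.mem_openSegment_iff.1 hx
    have h4 := hlow v (by simp)
    rw [map_add, map_smul, map_sub, smul_eq_mul] at fx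
    nlinarith
  change IsSimple (x :: w :: y :: (v₀ :: m ++ [v])) at h3s
  change Isotopic (x :: w :: y :: (v₀ :: m ++ [v])) (x :: y :: (v₀ :: m ++ [v]))
  have hs := h3s
  rw [isSimple_cons_iff, simplePath_cons, simplePath_cons] at hs
  obtain ⟨-, ⟨hs, -⟩, hd⟩ := hs
  have hlev : ∀ z ∈ path (y :: (v₀ :: m ++ [v])) x, f z < c ∨ z = y := fun z hz =>
    gt_or_eq_of_mem_path (by simp) fy.le hlow fx.le hz
  have hxy : x ≠ y := by
    rintro rfl
    exact Set.disjoint_left.1 hd (left_mem_hseg _ _) (mem_path_of_mem (by simp))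
  refine (isotopic_insert ?_ ?_ ?_).symm
  · rw [isSimple_cons_iff, simplePath_cons]
    refine ⟨by simp, hs, Set.disjoint_left.2 fun z hz hz' => ?_⟩
    have hfz : f z = c := by
      obtain ⟨t, -, -, rfl⟩ := mem_hseg.1 hz
      rw [map_add, map_smul, map_sub, fx, fy, sub_self, smul_zero, add_zero]
    rcases hlev z hz' with h4 | h4
    · exact h4.ne hfz
    · rw [h4] at hz; exact right_notMem_hseg hxy hz
  · rintro t rfl
    rw [map_add, map_smul, map_sub, fx, fy, sub_self, smul_zero, add_zero] at hw
    exact hw.ne rfl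
  · intro z hz hz'
    obtain ⟨u, s, hu, hs', -, rfl⟩ := mem_triangle hz
    refine (hlev _ hz').resolve_left (not_lt.2 ?_)
    rw [map_add, map_add, map_smul, map_smul, map_sub, map_sub, fx, fy, sub_self, smul_zero,
      add_zero, smul_eq_mul]
    nlinarith

theorem isSimple_triangle {a b c : Space} (hab : a ≠ b) (hc : ∀ t : ℝ, a + t • (b - a) ≠ c) :
    IsSimple [a, b, c] := by
  have hba : b - a ≠ 0 := sub_ne_zero.2 hab.symm
  have key : ∀ u v : ℝ, u • (b - a) + v • (c - a) = 0 → u = 0 ∧ v = 0 := by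
    intro u v h
    have hv := coeff_eq_zero hc h
    rw [hv, zero_smul, add_zero, smul_eq_zero] at h
    exact ⟨h.resolve_right hba, hv⟩
  rw [isSimple_cons_iff, simplePath_cons, simplePath_cons]
  refine ⟨by simp, ⟨simplePath_singleton _ _, ?_⟩, ?_⟩
  · simp only [path_cons, start_nil, path_nil, Set.union_empty, Set.disjoint_left]
    intro x hx hx'
    obtain ⟨t, t0, t1, rfl⟩ := mem_hseg.1 hx
    obtain ⟨s, s0, s1, e⟩ := mem_hseg.1 hx'
    have := key (1 - t) (t - (1 - s)) (by
      have : (1 - t) • (b - a) + (t - (1 - s)) • (c - a) =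
        (b + t • (c - b)) - (c + s • (a - c)) := by module
      rw [this, e, sub_self])
    linarith [this.1]
  · simp only [path_cons, start_nil, start_cons, path_nil, Set.union_empty, Set.disjoint_left]
    rintro x hx (hx' | hx')
    · obtain ⟨t, t0, t1, rfl⟩ := mem_hseg.1 hx
      obtain ⟨s, s0, s1, e⟩ := mem_hseg.1 hx'
      have := key (t - (1 - s)) (-s) (by
        have : (t - (1 - s)) • (b - a) + (-s) • (c - a) =
          (a + t • (b - a)) - (b + s • (c - b)) := by module
        rw [this, e, sub_self])
      linarith [this.1, this.2]
    · obtain ⟨t, t0, t1, rfl⟩ := mem_hseg.1 hx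
      obtain ⟨s, s0, s1, e⟩ := mem_hseg.1 hx'
      have := key t (-(1 - s)) (by
        have : t • (b - a) + (-(1 - s)) • (c - a) =
          (a + t • (b - a)) - (c + s • (a - c)) := by module
        rw [this, e, sub_self])
      linarith [this.2]

theorem IsSimple.not_collinear {a b c : Space} (h : IsSimple [a, b, c]) (t : ℝ) :
    a + t • (b - a) ≠ c := by
  rintro rfl
  rw [isSimple_cons_iff, simplePath_cons, simplePath_cons] at h
  obtain ⟨-, ⟨-, h2⟩, h1⟩ := h
  simp only [path_cons, start_nil, start_cons, path_nil, Set.union_empty, Set.disjoint_left,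
    Set.mem_union, not_or] at h1 h2
  rcases lt_or_ge t 0 with ht | ht
  · refine (h1 (left_mem_hseg _ _)).1 (mem_hseg.2 ⟨1 / (1 - t), ?_, ?_, ?_⟩)
    · exact div_nonneg zero_le_one (by linarith)
    · rw [div_lt_one (by linarith)]; linarith
    · have : a + t • (b - a) - b = (1 - t) • (a - b) := by module
      rw [this, smul_smul, div_mul_cancel₀ _ (by linarith)]; module
  rcases lt_or_ge t 1 with ht' | ht'
  · exact (h1 (mem_hseg.2 ⟨t, ht, ht', rfl⟩)).2 (left_mem_hseg _ _)
  · refine h2 (left_mem_hseg _ _) (mem_hseg.2 ⟨1 - 1 / t, ?_, ?_, ?_⟩)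
    · rw [sub_nonneg, div_le_one (by linarith)]; exact ht'
    · have : 0 < 1 / t := by positivity
      linarith
    · have : a - (a + t • (b - a)) = t • (a - b) := by module
      rw [this, smul_smul, sub_mul, div_mul_cancel₀ _ (by linarith : t ≠ 0)]; module

/-- A vertex that moves straight to a point off the plane of the triangle never meets the line
through the other two. -/
theorem isotopic_triangle_move {a b c d : Space} (h : IsSimple [a, b, c])
    (hd : ∀ x y : ℝ, a + x • (b - a) + y • (c - a) ≠ d) : Isotopic [a, b, c] [a, b, d] := by
  have := isotopic_of_family (l := [fun _ => a, fun _ => b, fun t => c + t • (d - c)])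
    (by
      intro g hg
      simp only [List.mem_cons, List.not_mem_nil, or_false] at hg
      rcases hg with rfl | rfl | rfl <;> fun_prop)
    (by
      intro t ht
      refine isSimple_triangle h.ne fun s e => ?_
      rcases eq_or_ne t 0 with rfl | h0
      · simp only [zero_smul, add_zero] at e
        exact h.not_collinear s e
      · refine hd (s / t) (1 - 1 / t) ?_
        have h2 : t • d = a + s • (b - a) - c + t • c := by
          rw [e]; module
        have h3 : d = t⁻¹ • (a + s • (b - a) - c + t • c) := by
          rw [← h2, smul_smul, inv_mul_cancel₀ h0, one_smul]
        rw [h3, smul_add, smul_smul, inv_mul_cancel₀ h0, one_smul, div_eq_mul_inv, one_div]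
        module)
  simpa using this

theorem exists_off_planes (a b c a' b' c' : Space) :
    ∃ d : Space, (∀ x y : ℝ, a + x • (b - a) + y • (c - a) ≠ d) ∧
      ∀ x y : ℝ, a' + x • (b' - a') + y • (c' - a') ≠ d := by
  classical
  obtain ⟨d, -, hd⟩ := exists_mem_avoiding isOpen_univ (Set.univ_nonempty (α := Space))
    ({{a, b, c}, {a', b', c'}} : Set (Finset Space)) (by simp)
    (fun s => affineSpan ℝ (s : Set Space))
    (by rintro s (rfl | rfl) <;> exact affineSpan_ne_top _ Finset.card_le_three)
  have key : ∀ a b c : Space, d ∉ affineSpan ℝ (({a, b, c} : Finset Space) : Set Space) →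
      ∀ x y : ℝ, a + x • (b - a) + y • (c - a) ≠ d := by
    rintro a b c hd x y rfl
    apply hd
    have m : ∀ z ∈ ({a, b, c} : Finset Space),
        z ∈ affineSpan ℝ (({a, b, c} : Finset Space) : Set Space) :=
      fun z hz => subset_affineSpan _ _ hz
    have e := (affineSpan ℝ (({a, b, c} : Finset Space) : Set Space)).smul_vsub_vadd_mem x
      (m b (by simp)) (m a (by simp)) (m a (by simp))
    have e2 := (affineSpan ℝ (({a, b, c} : Finset Space) : Set Space)).smul_vsub_vadd_mem y
      (m c (by simp)) (m a (by simp)) e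
    convert e2 using 1
    simp only [vsub_eq_sub, vadd_eq_add]; abel
  exact ⟨d, key a b c (hd _ (by simp)), key a' b' c' (hd _ (by simp))⟩

/-- The vertices are replaced one by one by points in general position to both triangles, until both
have become the same triangle. -/
theorem isotopic_triangles {a b c a' b' c' : Space} (h : IsSimple [a, b, c])
    (h' : IsSimple [a', b', c']) : Isotopic [a, b, c] [a', b', c'] := by
  obtain ⟨d₃, h₃, h₃'⟩ := exists_off_planes a b c a' b' c'
  obtain ⟨d₂, h₂, h₂'⟩ := exists_off_planes d₃ a b d₃ a' b'
  obtain ⟨d₁, h₁, h₁'⟩ := exists_off_planes d₂ d₃ a d₂ d₃ a'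
  have key : ∀ {a b c : Space}, IsSimple [a, b, c] → (∀ x y : ℝ, a + x • (b - a) + y • (c - a) ≠ d₃) →
      (∀ x y : ℝ, d₃ + x • (a - d₃) + y • (b - d₃) ≠ d₂) →
      (∀ x y : ℝ, d₂ + x • (d₃ - d₂) + y • (a - d₂) ≠ d₁) → Isotopic [a, b, c] [d₂, d₃, d₁] := by
    intro a b c h e₃ e₂ e₁
    have i1 := isotopic_triangle_move h e₃
    have i2 := isotopic_append_comm (l₁ := [a, b]) (l₂ := [d₃]) (i1.isSimple_iff.1 h)
    have s2 := (i1.trans i2).isSimple_iff.1 h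
    have i3 := isotopic_triangle_move s2 e₂
    have i4 := isotopic_append_comm (l₁ := [d₃, a]) (l₂ := [d₂]) (i3.isSimple_iff.1 s2)
    have s4 := (i3.trans i4).isSimple_iff.1 s2
    exact i1.trans (i2.trans (i3.trans (i4.trans (isotopic_triangle_move s4 e₁))))
  exact (key h h₃ h₂ h₁).trans (key h' h₃' h₂' h₁').symm

namespace Tangle

/-- Inserting an arc into a triangle closes it up. -/
theorem InsertedInto.isotopic_verts {T : Tangle} {a b c : Space} {k : List Space}
    (hT : IsSimple T.verts) (h : T.InsertedInto [a, b, c] k) : Isotopic T.verts k := by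
  obtain ⟨b₀, hb₀⟩ := List.exists_mem_of_ne_nil _ T.ne_nil
  -- The reflection of an inner vertex in `Q` lies on the other side of the plane. With `z` added,
  -- the closing part of the polygon is separated from the arc.
  set z : Space := T.Q + (T.Q - b₀) with hz
  have fz : T.f T.Q < T.f z := by
    rw [hz, map_add, map_sub]; linarith [T.below b₀ hb₀]
  have r1 : Isotopic T.verts (T.P :: T.Q :: T.B) := isotopic_append_comm (l₂ := [T.P]) hT
  have s1 := r1.isSimple_iff.1 hT
  have r2 : Isotopic (T.P :: T.Q :: T.B) (T.P :: z :: T.Q :: T.B) := by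
    refine isotopic_insert s1 ?_ ?_
    · rintro t e
      rw [← e, map_add, map_smul, map_sub, T.level, sub_self, smul_zero, add_zero] at fz
      exact fz.ne rfl
    · intro x hx hx'
      obtain ⟨u, s, hu, hs', -, rfl⟩ := mem_triangle hx
      refine (gt_or_eq_of_mem_path T.ne_nil le_rfl T.below T.level.le hx').resolve_left (not_lt.2 ?_)
      rw [map_add, map_add, map_smul, map_smul, map_sub, map_sub, T.level, sub_self, smul_zero,
        add_zero, smul_eq_mul]
      nlinarith
  have s2 := r2.isSimple_iff.1 s1
  have r3 : Isotopic (T.P :: z :: T.Q :: T.B) (T.verts ++ [z]) := by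
    have := isotopic_append_comm (l₁ := [T.P, z]) s2
    simpa [verts] using this
  have s3 := r3.isSimple_iff.1 s2
  have hA : ∀ a ∈ [z], T.f T.Q < T.f a := by simpa using fz
  have hJ := isSimple_of_closed (by simp) hA s3
  obtain ⟨k', hk'⟩ := T.exists_insertedInto hJ
  exact r1.trans (r2.trans (r3.trans ((hk'.isotopic_closed (by simp) hA s3).trans
    (InsertedInto.isotopic (isotopic_triangles hJ h.isSimple_left) hk' h))))

end Tangle

/-- The connected sum is well defined, in a form adapted to its use below: if `k` consists of two
arcs on both sides of a plane, the polygon `w :: T.verts` is isotopic to the one closed arc,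
and `U` is isotopic to the other, then `k` is isotopic to the insertion of `T` into `U`. -/
theorem isotopic_insertedInto_of_connectedSum {f : Space →ₗ[ℝ] ℝ} {c : ℝ} {P Q : Space}
    {A B : List Space} (hP : f P = c) (hQ : f Q = c) (hA : ∀ a ∈ A, c < f a) (hB : ∀ b ∈ B, f b < c)
    (hk : IsSimple (P :: (A ++ Q :: B))) (hk₁ : IsSimple (P :: (A ++ [Q])))
    (hk₂ : IsSimple (Q :: (B ++ [P]))) {T : Tangle} {w : Space} (hw : T.f T.Q < T.f w)
    (hW : Isotopic (w :: T.verts) (Q :: (B ++ [P]))) {U F : List Space}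
    (hU : Isotopic U (P :: (A ++ [Q]))) (hF : T.InsertedInto U F) :
    Isotopic (P :: (A ++ Q :: B)) F := by
  have hAne : A ≠ [] := by
    rintro rfl; have := hk₁.1; simp at this
  have hBne : B ≠ [] := by
    rintro rfl; have := hk₂.1; simp at this
  have hsp := hk
  rw [isSimple_cons_iff, ← List.cons_append, simplePath_append] at hsp
  have hPQ : Q ≠ P := by
    rintro rfl
    exact Set.disjoint_left.1 hsp.2.2.2 (mem_path_of_mem (l := Q :: A) (e := Q) (v := Q) (by simp))
      (mem_path_of_mem (l := Q :: B) (e := Q) (v := Q) (by simp))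
  -- the arc `A`
  let S : Tangle :=
    { f := -f, Q := P, B := A, P := Q, level := by simp [hP, hQ],
      below := by simpa [hP] using hA, ne_nil := hAne, simple := hsp.2.1, ne := hPQ }
  have hSv : S.verts = P :: (A ++ [Q]) := by simp [Tangle.verts, S]
  have hSB : ∀ b ∈ B, S.f S.Q < S.f b := by simpa [S, hP] using hB
  have hSk : S.verts ++ B = P :: (A ++ Q :: B) := by simp [hSv]
  have hkS : IsSimple (S.verts ++ B) := by rw [hSk]; exact hk
  have hJ₂ := Tangle.isSimple_of_closed hBne hSB hkS
  obtain ⟨k', hk'⟩ := S.exists_insertedInto hJ₂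
  have i1 := hk'.isotopic_closed hBne hSB hkS
  rw [hSk] at i1
  have i2 : Isotopic (Q :: (B ++ [P])) (P :: Q :: B) :=
    isotopic_append_comm (l₁ := Q :: B) (l₂ := [P]) hk₂
  -- cutting the corner at `w`
  have hWs : IsSimple (w :: T.verts) := hW.isSimple_iff.2 hk₂
  set x : Space := T.P + (1 / 2 : ℝ) • (w - T.P) with hx
  set y : Space := w + (1 / 2 : ℝ) • (T.Q - w) with hy
  -- At the level halfway between `Q` and `w`, cutting the corner produces an edge `xy` strictly
  -- beyond the plane of `T`, with room for a copy of the arc `A`.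
  set d : ℝ := (T.f T.Q + T.f w) / 2 with hd
  have fx : T.f x = d := by
    rw [hx, map_add, map_smul, map_sub, T.level, smul_eq_mul, hd]; ring
  have fy : T.f y = d := by
    rw [hy, map_add, map_smul, map_sub, smul_eq_mul, hd]; ring
  have hxo : x ∈ openSegment ℝ T.P w := Tangle.midpoint_mem_openSegment
  have hyo : y ∈ openSegment ℝ w T.Q := Tangle.midpoint_mem_openSegment
  have i3 : Isotopic (w :: T.verts) (x :: y :: T.verts) :=
    isotopic_cut_corner hWs hxo hyo fx fy (by
      intro z hz
      simp only [List.cons_append, List.mem_cons, List.mem_append, List.not_mem_nil, or_false] at hz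
      have hd' : T.f T.Q < d := by rw [hd]; linarith
      rcases hz with rfl | hz | rfl
      · exact hd'
      · exact (T.below z hz).trans hd'
      · rw [T.level]; exact hd')
  have hZ : IsSimple (x :: y :: T.verts) := i3.isSimple_iff.1 hWs
  have htri : IsSimple [w, T.Q, T.P] := by
    refine IsSimple.rotate (a := T.P) (l := [w, T.Q]) ?_
    refine IsSimple.rotate (a := T.Q) (l := [T.P, w]) ?_
    refine isSimple_triangle T.ne.symm fun t e => ?_
    rw [← e, map_add, map_smul, map_sub, T.level, sub_self, smul_zero, add_zero] at hw
    exact hw.ne rfl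
  have i4 : Isotopic [w, T.Q, T.P] [x, y, T.Q, T.P] :=
    isotopic_cut_corner (m := []) htri hxo hyo fx fy (by
      intro z hz
      simp only [List.cons_append, List.nil_append, List.mem_cons, List.not_mem_nil, or_false] at hz
      have hd' : T.f T.Q < d := by rw [hd]; linarith
      rcases hz with rfl | rfl
      · exact hd'
      · rw [T.level]; exact hd')
  have hquad : IsSimple [x, y, T.Q, T.P] := i4.isSimple_iff.1 htri
  -- inserting the arc `A` at the corner
  obtain ⟨M, hMdet, hMd⟩ := exists_frame (sub_ne_zero.2 S.ne) (sub_ne_zero.2 hquad.ne.symm)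
  set m : Space := x + (1 / 2 : ℝ) • (y - x) with hm
  have hmo : m ∈ openSegment ℝ x y := Tangle.midpoint_mem_openSegment
  have fm : T.f m = d := by
    rw [hm, map_add, map_smul, map_sub, fx, fy, sub_self, smul_zero, add_zero]
  have hdir : ∃ r : ℝ, 0 < r ∧ M (S.P - S.Q) = r • (y - x) := ⟨1, one_pos, by rw [one_smul, hMd]⟩
  have hUo : IsOpen {z : Space | T.f T.Q < T.f z} :=
    isOpen_lt continuous_const (LinearMap.continuous_of_finiteDimensional T.f)
  obtain ⟨s₁, hs₁, hf₁⟩ := S.exists_fits_in hZ (injective_of_det_pos hMdet) hdir hmo hUo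
    (show T.f T.Q < T.f m by rw [fm, hd]; linarith)
  obtain ⟨s₂, hs₂, hf₂⟩ := S.exists_fits hquad (injective_of_det_pos hMdet) hdir hmo
  set s : ℝ := min s₁ s₂ with hs
  have hs0 : 0 < s := lt_min hs₁ hs₂
  obtain ⟨F₁, F₁U⟩ := hf₁ s hs0 (min_le_left _ _)
  have F₂ := hf₂ s hs0 (min_le_right _ _)
  have I₁ : S.InsertedInto (x :: y :: T.verts) (S.insert x (y :: T.verts) m (s • M)) :=
    ⟨_, _, _, _, _, rfl, det_smul_pos hMdet hs0, F₁, rfl⟩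
  have I₂ : S.InsertedInto [x, y, T.Q, T.P] (S.insert x [y, T.Q, T.P] m (s • M)) :=
    ⟨_, _, _, _, _, rfl, det_smul_pos hMdet hs0, F₂, rfl⟩
  have i5 := Tangle.InsertedInto.isotopic (i2.symm.trans (hW.symm.trans i3)) hk' I₁
  set A' : List Space := x :: S.verts.map (S.place m (s • M)) ++ [y] with hA'
  have e1 : S.insert x (y :: T.verts) m (s • M) = A' ++ T.verts := by simp [hA', Tangle.insert]
  have e2 : S.insert x [y, T.Q, T.P] m (s • M) = A' ++ [T.Q, T.P] := by simp [hA', Tangle.insert]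
  have hA'f : ∀ a ∈ A', T.f T.Q < T.f a := by
    intro a ha
    rw [hA'] at ha
    simp only [List.cons_append, List.mem_cons, List.mem_append, List.not_mem_nil, or_false,
      List.mem_map] at ha
    rcases ha with rfl | ⟨z, hz, rfl⟩ | rfl
    · rw [fx, hd]; linarith
    · exact F₁U z hz
    · rw [fy, hd]; linarith
  have hA'ne : A' ≠ [] := by simp [hA']
  have sI₁ := I₁.isSimple_right
  have sI₂ := I₂.isSimple_right
  rw [e1] at i5 sI₁
  rw [e2] at I₂ sI₂
  -- The copy of `A` now lies beyond the plane of `T`, so the roles are exchanged: `T` becomes the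
  -- arc to be shrunk.
  have i6 := isotopic_append_comm sI₁
  have hT' := i6.isSimple_iff.1 sI₁
  have hJ := Tangle.isSimple_of_closed hA'ne hA'f hT'
  have i7 : Isotopic (A' ++ [T.Q, T.P]) (T.Q :: T.P :: A') := isotopic_append_comm sI₂
  -- the closed arc `A`
  obtain ⟨k₃, hk₃⟩ := S.exists_insertedInto htri
  have i8 := hk₃.isotopic_verts (by rw [hSv]; exact hk₁)
  have i9 := Tangle.InsertedInto.isotopic i4 hk₃ I₂
  rw [hSv] at i8
  obtain ⟨k₄, hk₄⟩ := T.exists_insertedInto hJ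
  have i10 := hk₄.isotopic_closed hA'ne hA'f hT'
  -- The polygon into which `T` is shrunk is the arc `A` inserted into a triangle with a cut corner.
  -- It is thus isotopic to the closed arc `A`, hence to `U`, and the two insertions of `T` agree.
  have i11 := Tangle.InsertedInto.isotopic (i7.symm.trans (i9.symm.trans (i8.symm.trans hU.symm)))
    hk₄ hF
  exact i1.trans (i5.trans (i6.trans (i10.trans i11)))

end KnotTheory


namespace KnotTheory

/-! ### Regular plane polygons -/

/-- Two common points make the segments collinear, say `c = a + p(b - a)` and `d = a + (p + ρ)(b -
a)`, and the claim is about overlapping intervals. The third alternative is needed only for opposite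
directions, because of the half-open ends. -/
theorem mem_hseg_of_two_common {E : Type*} [AddCommGroup E] [Module ℝ E] {a b c d x y : E}
    (hxy : x ≠ y) (h₁ : x ∈ hseg a b) (h₂ : x ∈ hseg c d) (h₃ : y ∈ hseg a b) (h₄ : y ∈ hseg c d) :
    a ∈ hseg c d ∨ c ∈ hseg a b ∨ (b ∈ hseg c d ∧ d ∈ hseg a b) := by
  obtain ⟨t, t0, t1, ht⟩ := mem_hseg.1 h₁
  obtain ⟨s, s0, s1, hs⟩ := mem_hseg.1 h₂
  obtain ⟨t', -, -, ht'⟩ := mem_hseg.1 h₃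
  obtain ⟨s', -, -, hs'⟩ := mem_hseg.1 h₄
  have e1 : y - x = (t' - t) • (b - a) := by rw [ht, ht']; module
  have e2 : y - x = (s' - s) • (d - c) := by rw [hs, hs']; module
  have hst : s' - s ≠ 0 := fun h => hxy (by rw [h, zero_smul, sub_eq_zero] at e2; exact e2.symm)
  have htt : t' - t ≠ 0 := fun h => hxy (by rw [h, zero_smul, sub_eq_zero] at e1; exact e1.symm)
  set ρ := (t' - t) / (s' - s) with hρ
  have hρ0 : ρ ≠ 0 := div_ne_zero htt hst
  have hd : d - c = ρ • (b - a) := by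
    rw [hρ, div_eq_inv_mul, mul_smul, ← e1, e2, smul_smul, inv_mul_cancel₀ hst, one_smul]
  set p := t - s * ρ with hp
  have hc : c = a + p • (b - a) := by
    have : c = x - s • (d - c) := by rw [hs]; module
    rw [this, hd, ht, hp]; module
  have hd' : d = a + (p + ρ) • (b - a) := by
    rw [eq_add_of_sub_eq hd, hc]; module
  have ha : a = c + (-p / ρ) • (d - c) := by
    rw [hd, smul_smul, div_mul_cancel₀ _ hρ0, hc]; module
  have hb : b = c + ((1 - p) / ρ) • (d - c) := by
    rw [hd, smul_smul, div_mul_cancel₀ _ hρ0]; nth_rewrite 1 [hc]; module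
  have htp : t = p + s * ρ := by rw [hp]; ring
  rcases lt_or_gt_of_ne hρ0 with h | h
  · by_cases h2 : p + ρ < 0
    · refine Or.inl (mem_hseg.2 ⟨_, ?_, ?_, ha⟩)
      · exact div_nonneg_of_nonpos (by nlinarith) h.le
      · rw [div_lt_one_of_neg h]; linarith
    · have h3 : d ∈ hseg a b := mem_hseg.2 ⟨_, not_lt.1 h2, by nlinarith, hd'⟩
      by_cases h4 : p < 1
      · exact Or.inr (Or.inl (mem_hseg.2 ⟨p, by linarith, h4, hc⟩))
      · refine Or.inr (Or.inr ⟨mem_hseg.2 ⟨_, ?_, ?_, hb⟩, h3⟩)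
        · exact div_nonneg_of_nonpos (by linarith) h.le
        · rw [div_lt_one_of_neg h]; nlinarith
  · by_cases h2 : 0 ≤ p
    · exact Or.inr (Or.inl (mem_hseg.2 ⟨p, h2, by nlinarith, hc⟩))
    · refine Or.inl (mem_hseg.2 ⟨_, div_nonneg (by linarith) h.le, ?_, ha⟩)
      rw [div_lt_one h]; nlinarith

theorem vertex_mod {E : Type*} [AddCommGroup E] (l : List E) (i : ℕ) :
    vertex l (i % l.length) = vertex l i := by simp [vertex]

theorem IsRegular.vertex_eq_iff {l : List Plane} (h : IsRegular l) {i j : ℕ} (hj : j < l.length)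
    (hij : vertex l i ∈ edge l j) : i % l.length = j := by
  by_contra hne
  have h3 := h.1
  exact h.2.1 (i % l.length) j (Nat.mod_lt _ (by omega)) hj hne (by rwa [vertex_mod])

theorem IsRegular.crossing_unique {l : List Plane} (h : IsRegular l) {i j : ℕ} (hij : i < j)
    (hj : j < l.length) {x y : Plane} (hx : x ∈ edge l i ∩ edge l j) (hy : y ∈ edge l i ∩ edge l j) :
    x = y := by
  by_contra hne
  have h3 := h.1
  rcases mem_hseg_of_two_common hne hx.1 hx.2 hy.1 hy.2 with h1 | h1 | ⟨h1, h2⟩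
  · have := h.vertex_eq_iff hj h1
    rw [Nat.mod_eq_of_lt (by omega)] at this; omega
  · have := h.vertex_eq_iff (hij.trans hj) h1
    rw [Nat.mod_eq_of_lt (by omega)] at this; omega
  -- Each of the two edges would have to follow the other cyclically, which is impossible with at
  -- least three edges.
  · have e1 := h.vertex_eq_iff hj h1
    have e2 := h.vertex_eq_iff (hij.trans hj) h2
    rw [Nat.mod_eq_of_lt (by omega)] at e1
    rcases (show j + 1 ≤ l.length by omega).lt_or_eq with h4 | h4
    · rw [Nat.mod_eq_of_lt h4] at e2; omega
    · rw [h4, Nat.mod_self] at e2; omega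

theorem IsRegular.vertex_ne {l : List Plane} (h : IsRegular l) {i : ℕ} (hi : i < l.length) :
    vertex l i ≠ vertex l (i + 1) := by
  intro e
  have h3 := h.1
  have := h.vertex_eq_iff (i := i + 1) hi (by rw [← e]; exact left_mem_hseg _ _)
  rcases (show i + 1 ≤ l.length by omega).lt_or_eq with h4 | h4
  · rw [Nat.mod_eq_of_lt h4] at this; omega
  · rw [h4, Nat.mod_self] at this; omega

theorem IsRegular.finite_double {l : List Plane} (h : IsRegular l) :
    {x | 2 ≤ passes l (start l 0) x}.Finite := by
  classical
  have hl : l ≠ [] := by rintro rfl; have := h.1; simp at this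
  refine Set.Finite.subset (s := ⋃ i ∈ Finset.range l.length, ⋃ j ∈ Finset.range l.length,
    {x | i < j ∧ x ∈ edge l i ∩ edge l j}) ?_ ?_
  · refine Set.Finite.biUnion (Finset.finite_toSet _) fun i _ =>
      Set.Finite.biUnion (Finset.finite_toSet _) fun j hj => Set.Subsingleton.finite ?_
    rintro x ⟨hij, hx⟩ y ⟨-, hy⟩
    exact h.crossing_unique hij (by simpa using hj) hx hy
  · intro x hx
    rw [Set.mem_ofPred_eq, passes_closed hl, ← Nat.lt_iff_add_one_le, Finset.one_lt_card] at hx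
    obtain ⟨i, hi, j, hj, hij⟩ := hx
    rw [Finset.mem_filter, Finset.mem_range] at hi hj
    simp only [Set.mem_iUnion, Finset.mem_range]
    rcases lt_or_gt_of_ne hij with h1 | h1
    · exact ⟨i, hi.1, j, hj.1, h1, hi.2, hj.2⟩
    · exact ⟨j, hj.1, i, hi.1, h1, hj.2, hi.2⟩

/-! ### The list of edges -/

section Edges

variable {E : Type*}

/-- The list of the edges of the path through `l` with end point `e`. -/
def edges : List E → E → List (E × E)
  | [], _ => []
  | a :: l, e => (a, start l e) :: edges l e

@[simp] theorem edges_nil (e : E) : edges [] e = [] := rfl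

@[simp] theorem edges_cons (a : E) (l : List E) (e : E) :
    edges (a :: l) e = (a, start l e) :: edges l e := rfl

theorem edges_append (l₁ l₂ : List E) (b e : E) :
    edges (l₁ ++ b :: l₂) e = edges l₁ b ++ edges (b :: l₂) e := by
  induction l₁ with
  | nil => simp
  | cons a l ih =>
    rw [List.cons_append, edges_cons, ih, edges_cons a l, List.cons_append]
    congr 2
    cases l <;> simp

theorem edges_map {F : Type*} (g : E → F) (l : List E) (e : E) :
    edges (l.map g) (g e) = (edges l e).map (Prod.map g g) := by
  induction l with
  | nil => simp
  | cons a l ih => rw [List.map_cons, edges_cons, ih, edges_cons, List.map_cons, start_map]; rfl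

@[simp] theorem length_edges (l : List E) (e : E) : (edges l e).length = l.length := by
  induction l <;> simp [*]

theorem getElem?_edges [AddCommGroup E] {l : List E} (hl : l ≠ []) {i : ℕ} (hi : i < l.length) :
    (edges l (start l 0))[i]? = some (vertex l i, vertex l (i + 1)) := by
  have key : ∀ (l : List E) (e : E) (i : ℕ), i < l.length →
      (edges l e)[i]? = some ((l ++ [e]).getD i 0, (l ++ [e]).getD (i + 1) 0) := by
    intro l e
    induction l with
    | nil => simp
    | cons a l ih =>
      intro i hi
      cases i with
      | zero => cases l <;> simp
      | succ i => simpa using ih i (by simpa using hi)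
  rw [key _ _ _ hi, vertex_eq hl hi.le, vertex_eq hl hi]

theorem pair_sublist_cons_iff {s t a : E} {l : List E} :
    [s, t].Sublist (a :: l) ↔ (s = a ∧ t ∈ l) ∨ [s, t].Sublist l := by
  rw [List.sublist_cons_iff]
  constructor
  · rintro (h | ⟨r, hr, h⟩)
    · exact Or.inr h
    · rw [List.cons.injEq] at hr
      obtain ⟨rfl, rfl⟩ := hr
      exact Or.inl ⟨rfl, List.singleton_sublist.1 h⟩
  · rintro (⟨rfl, h⟩ | h)
    · exact Or.inr ⟨_, rfl, List.singleton_sublist.2 h⟩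
    · exact Or.inl h

/-- A two-element sublist records that `s` is passed before `t`. As no indices occur, this order is
easily followed through concatenations and changes of the basepoint. -/
theorem pair_sublist_append_iff {s t : E} {l₁ l₂ : List E} :
    [s, t].Sublist (l₁ ++ l₂) ↔ [s, t].Sublist l₁ ∨ (s ∈ l₁ ∧ t ∈ l₂) ∨ [s, t].Sublist l₂ := by
  induction l₁ with
  | nil => simp
  | cons a l ih =>
    rw [List.cons_append, pair_sublist_cons_iff, ih, pair_sublist_cons_iff, List.mem_append,
      List.mem_cons]
    tauto

theorem pair_sublist_iff {s t : E} {l : List E} :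
    [s, t].Sublist l ↔ ∃ i j : ℕ, i < j ∧ l[i]? = some s ∧ l[j]? = some t := by
  induction l with
  | nil => simp
  | cons a l ih =>
    rw [pair_sublist_cons_iff, ih, List.mem_iff_getElem?]
    constructor
    · rintro (⟨rfl, j, hj⟩ | ⟨i, j, hij, hi, hj⟩)
      · exact ⟨0, j + 1, by omega, by simp, by simpa using hj⟩
      · exact ⟨i + 1, j + 1, by omega, by simpa using hi, by simpa using hj⟩
    · rintro ⟨i, j, hij, hi, hj⟩
      obtain ⟨j, rfl⟩ : ∃ j', j = j' + 1 := ⟨j - 1, by omega⟩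
      rw [List.getElem?_cons_succ] at hj
      cases i with
      | zero => exact Or.inl ⟨by simpa using hi.symm, j, hj⟩
      | succ i => exact Or.inr ⟨i, j, by omega, by simpa using hi, hj⟩

end Edges

/-! ### The vertical projection -/

/-- The vertical projection as a linear map. -/
def projL : Space →ₗ[ℝ] Plane where
  toFun := proj
  map_add' x y := by ext i; fin_cases i <;> simp [proj]
  map_smul' r x := by ext i; fin_cases i <;> simp [proj]

theorem proj_eq_iff {x y : Space} : proj x = proj y ↔ x 0 = y 0 ∧ x 1 = y 1 := by
  constructor
  · intro h; exact ⟨by simpa [proj] using congrFun h 0, by simpa [proj] using congrFun h 1⟩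
  · rintro ⟨h0, h1⟩; ext i; fin_cases i <;> simp [proj, h0, h1]

theorem eq_of_proj_eq {x y : Space} (h : proj x = proj y) (h2 : x 2 = y 2) : x = y := by
  obtain ⟨h0, h1⟩ := proj_eq_iff.1 h
  ext i; fin_cases i
  · exact h0
  · exact h1
  · exact h2

theorem proj_add_smul (a b : Space) (t : ℝ) :
    proj (a + t • (b - a)) = proj a + t • (proj b - proj a) := by
  have := map_add projL a (t • (b - a))
  rw [map_smul, map_sub] at this
  exact this

theorem proj_hseg (a b : Space) : hseg (proj a) (proj b) = proj '' hseg a b :=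
  hseg_map projL.toAffineMap a b

theorem proj_path (l : List Space) (e : Space) : path (l.map proj) (proj e) = proj '' path l e :=
  path_map projL.toAffineMap l e

theorem vertex_map_proj (l : List Space) (i : ℕ) : vertex (l.map proj) i = proj (vertex l i) := by
  have h0 : proj 0 = 0 := map_zero projL
  rw [vertex, vertex, List.length_map, ← h0, List.getD_map]

theorem edge_map_proj (l : List Space) (i : ℕ) : edge (l.map proj) i = proj '' edge l i := by
  have : edge (l.map proj) i = hseg (proj (vertex l i)) (proj (vertex l (i + 1))) := by
    rw [← vertex_map_proj, ← vertex_map_proj]; rfl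
  rw [this, proj_hseg]; rfl

theorem proj_injOn_hseg {a b : Space} (h : proj a ≠ proj b) : Set.InjOn proj (hseg a b) := by
  rintro x hx y hy e
  obtain ⟨t, -, -, rfl⟩ := mem_hseg.1 hx
  obtain ⟨s, -, -, rfl⟩ := mem_hseg.1 hy
  rw [proj_add_smul, proj_add_smul, add_right_inj, ← sub_eq_zero, ← sub_smul, smul_eq_zero] at e
  rw [sub_eq_zero.1 (e.resolve_right (sub_ne_zero.2 h.symm))]

/-! ### Bad pairs of points -/

/-- The pairs of points on the edges `es` (in the order in which they are passed) with the same
vertical projection whose first point is lower than the second one. -/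
def bad (es : List (Space × Space)) : Set (Space × Space) :=
  {p | ∃ s t, [s, t].Sublist es ∧ p.1 ∈ openSegment ℝ s.1 s.2 ∧ p.2 ∈ openSegment ℝ t.1 t.2 ∧
    proj p.1 = proj p.2 ∧ p.1 2 < p.2 2}

theorem openSegment_subset_hseg {E : Type*} [AddCommGroup E] [Module ℝ E] (a b : E) :
    openSegment ℝ a b ⊆ hseg a b := by
  intro x hx
  obtain ⟨t, h0, h1, rfl⟩ := Tangle.mem_openSegment_iff.1 hx
  exact mem_hseg.2 ⟨t, h0.le, h1, rfl⟩

theorem mem_openSegment_of_mem_hseg {E : Type*} [AddCommGroup E] [Module ℝ E] {a b x : E}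
    (h : x ∈ hseg a b) (hne : x ≠ a) : x ∈ openSegment ℝ a b := by
  obtain ⟨t, h0, h1, rfl⟩ := mem_hseg.1 h
  refine Tangle.mem_openSegment_iff.2 ⟨t, h0.lt_of_ne ?_, h1, rfl⟩
  rintro rfl; simp at hne

/-- Vertices of a regular projection are not crossings, so open and half-open edges carry the same
pairs. `bad` uses open edges because they are symmetric under reversal. -/
theorem mem_bad_iff {l : List Space} (hreg : IsRegular (l.map proj)) {p : Space × Space} :
    p ∈ bad (edges l (start l 0)) ↔ ∃ i j, i < j ∧ j < l.length ∧
      p.1 ∈ edge l i ∧ p.2 ∈ edge l j ∧ proj p.1 = proj p.2 ∧ p.1 2 < p.2 2 := by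
  have h3 := hreg.1
  have hne : l ≠ [] := by rintro rfl; simp at h3
  constructor
  · rintro ⟨s, t, hst, h1, h2, h4⟩
    obtain ⟨i, j, hij, hi, hj⟩ := pair_sublist_iff.1 hst
    have hjl : j < l.length := by
      have := (List.getElem?_eq_some_iff.1 hj).1; simpa using this
    rw [getElem?_edges hne (by omega), Option.some.injEq] at hi hj
    subst hi hj
    exact ⟨i, j, hij, hjl, openSegment_subset_hseg _ _ h1, openSegment_subset_hseg _ _ h2, h4⟩
  · rintro ⟨i, j, hij, hjl, h1, h2, h4, h5⟩
    refine ⟨_, _, pair_sublist_iff.2 ⟨i, j, hij, getElem?_edges hne (hij.trans hjl),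
      getElem?_edges hne hjl⟩, mem_openSegment_of_mem_hseg h1 ?_,
      mem_openSegment_of_mem_hseg h2 ?_, h4, h5⟩
    · intro e
      refine hreg.2.1 i j (by simp; omega) (by simpa) hij.ne ?_
      dsimp only at e
      rw [vertex_map_proj, edge_map_proj, ← e, h4]; exact ⟨_, h2, rfl⟩
    · intro e
      refine hreg.2.1 j i (by simpa) (by simp; omega) hij.ne' ?_
      dsimp only at e
      rw [vertex_map_proj, edge_map_proj, ← e, ← h4]; exact ⟨_, h1, rfl⟩

theorem Diagram.mem_crossings {D : Diagram} {c : ℕ × ℕ} :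
    c ∈ D.crossings ↔ c.1 < c.2 ∧ c.2 < D.verts.length ∧
      (edge D.verts c.1 ∩ edge D.verts c.2).Nonempty := by
  classical
  unfold crossings
  rw [Finset.mem_filter, Finset.mem_product, Finset.mem_range, Finset.mem_range]
  exact ⟨fun h => ⟨h.2.1, h.1.2, h.2.2⟩, fun h => ⟨⟨h.1.trans h.2.1, h.2.1⟩, h.1, h.2.2⟩⟩

/-- On two given edges of a regular polygon, there is at most one pair of points with the same
projection. -/
theorem IsRegular.pair_unique {l : List Space} (hreg : IsRegular (l.map proj)) {i j : ℕ}
    (hij : i < j) (hj : j < l.length) {x y x' y' : Space} (hx : x ∈ edge l i) (hy : y ∈ edge l j)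
    (hxy : proj x = proj y) (hx' : x' ∈ edge l i) (hy' : y' ∈ edge l j) (hxy' : proj x' = proj y') :
    x = x' ∧ y = y' := by
  have huniq : proj x = proj x' := by
    refine hreg.crossing_unique hij (by simpa) ⟨?_, ?_⟩ ⟨?_, ?_⟩ <;> rw [edge_map_proj]
    · exact ⟨_, hx, rfl⟩
    · rw [hxy]; exact ⟨_, hy, rfl⟩
    · exact ⟨_, hx', rfl⟩
    · rw [hxy']; exact ⟨_, hy', rfl⟩
  have hinj : ∀ i, i < l.length → Set.InjOn proj (edge l i) := fun i hi =>
    proj_injOn_hseg (by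
      rw [← vertex_map_proj, ← vertex_map_proj]; exact hreg.vertex_ne (by simpa))
  exact ⟨hinj _ (hij.trans hj) hx hx' huniq, hinj _ hj hy hy' (by rw [← hxy, huniq, hxy'])⟩

/-- An ascending crossing corresponds to the pair of points of the knot above it. By regularity two
edges have at most one such pair, and by simplicity a point lies on one edge only, so this is a
bijection. Counting points instead of index pairs makes the number insensitive to subdivision. -/
theorem Diagram.IsProjectionOf.ascendingNumber_eq {D : Diagram} {K : Knot}
    (h : D.IsProjectionOf K) :
    (bad (edges K.verts (start K.verts 0))).Finite ∧
      D.ascendingNumber = (bad (edges K.verts (start K.verts 0))).ncard := by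
  classical
  obtain ⟨hv, ho⟩ := h
  obtain ⟨l, hsimple⟩ := K
  dsimp only at hv ho ⊢
  have hreg : IsRegular (l.map proj) := hv ▸ D.regular
  have hcr : ∀ c, c ∈ D.crossings ↔ c.1 < c.2 ∧ c.2 < l.length ∧ ∃ p : Space × Space,
      p.1 ∈ edge l c.1 ∧ p.2 ∈ edge l c.2 ∧ proj p.1 = proj p.2 := by
    intro c
    rw [mem_crossings, hv, List.length_map, edge_map_proj, edge_map_proj]
    refine and_congr_right fun _ => and_congr_right fun _ => ⟨?_, ?_⟩
    · rintro ⟨z, ⟨x, hx, rfl⟩, ⟨y, hy, hyx⟩⟩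
      exact ⟨(x, y), hx, hy, hyx.symm⟩
    · rintro ⟨p, hx, hy, hxy⟩
      exact ⟨_, ⟨_, hx, rfl⟩, ⟨_, hy, hxy.symm⟩⟩
  set C := D.crossings.filter fun c => ¬ (D.firstOver c ↔ D.descending.firstOver c) with hC
  have hCmem : ∀ c, c ∈ C ↔ c ∈ D.crossings ∧ ¬ D.firstOver c := by
    intro c; rw [hC, Finset.mem_filter]; simp [descending]
  have hmem : ∀ c, c ∈ C → ∃ p : Space × Space, p.1 ∈ edge l c.1 ∧ p.2 ∈ edge l c.2 ∧
      proj p.1 = proj p.2 ∧ p.1 2 < p.2 2 := by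
    intro c hc
    obtain ⟨hc, hn⟩ := (hCmem c).1 hc
    obtain ⟨h1, h2, ⟨x, y⟩, hx, hy, hxy⟩ := (hcr c).1 hc
    dsimp only at hx hy hxy
    rw [ho c hc x hx y hy hxy] at hn
    refine ⟨(x, y), hx, hy, hxy, (not_lt.1 hn).lt_of_ne fun e => ?_⟩
    obtain rfl := eq_of_proj_eq hxy e
    exact Set.disjoint_left.1 (hsimple.2 _ _ h1 h2) hx hy
  choose! f hf using hmem
  have himg : bad (edges l (start l 0)) = f '' C := by
    ext p
    rw [mem_bad_iff hreg]
    constructor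
    · rintro ⟨i, j, hij, hjl, h1, h2, h4, h5⟩
      have hc : (i, j) ∈ D.crossings := (hcr _).2 ⟨hij, hjl, p, h1, h2, h4⟩
      have hc' : (i, j) ∈ C := (hCmem _).2 ⟨hc, by rw [ho _ hc _ h1 _ h2 h4]; exact h5.le.not_gt⟩
      obtain ⟨g1, g2, g3, -⟩ := hf _ hc'
      have := hreg.pair_unique hij hjl g1 g2 g3 h1 h2 h4
      exact ⟨_, hc', Prod.ext this.1 this.2⟩
    · rintro ⟨c, hc, rfl⟩
      have hc' := (hcr c).1 ((hCmem c).1 hc).1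
      exact ⟨c.1, c.2, hc'.1, hc'.2.1, hf _ hc⟩
  have hfinj : Set.InjOn f C := by
    intro c hc c' hc' e
    obtain ⟨g1, g2, -⟩ := hf _ hc
    obtain ⟨g1', g2', -⟩ := hf _ hc'
    have hb := (hcr c).1 ((hCmem c).1 hc).1
    have hb' := (hcr c').1 ((hCmem c').1 hc').1
    have key : ∀ i j x, i < l.length → j < l.length → x ∈ edge l i → x ∈ edge l j → i = j := by
      intro i j x hi hj hx hx'
      rcases lt_trichotomy i j with h | h | h
      · exact (Set.disjoint_left.1 (hsimple.2 _ _ h hj) hx hx').elim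
      · exact h
      · exact (Set.disjoint_left.1 (hsimple.2 _ _ h hi) hx' hx).elim
    rw [← e] at g1' g2'
    exact Prod.ext (key _ _ _ (hb.1.trans hb.2.1) (hb'.1.trans hb'.2.1) g1 g1')
      (key _ _ _ hb.2.1 hb'.2.1 g2 g2')
  refine ⟨himg ▸ C.finite_toSet.image f, ?_⟩
  rw [himg, hfinj.ncard_image, Set.ncard_coe_finset]
  rfl

theorem exists_isProjectionOf {K : Knot} (hreg : IsRegular (K.verts.map proj)) :
    ∃ D : Diagram, D.IsProjectionOf K := by
  refine ⟨⟨K.verts.map proj, hreg, fun c => ∃ x ∈ edge K.verts c.1, ∃ y ∈ edge K.verts c.2,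
    proj x = proj y ∧ y 2 < x 2⟩, rfl, fun c hc x hx y hy hxy => ⟨?_, fun h => ⟨x, hx, y, hy, hxy, h⟩⟩⟩
  rintro ⟨x', hx', y', hy', hxy', h⟩
  obtain ⟨h1, h2, -⟩ := Diagram.mem_crossings.1 hc
  obtain ⟨rfl, rfl⟩ := hreg.pair_unique h1 (by simpa using h2) hx hy hxy hx' hy' hxy'
  exact h

/-- The ascending number is bounded by the number of bad pairs of any regular polygon. -/
theorem ascendingNumber_le {K : Knot} {l : List Space} (hl : IsSimple l)
    (hreg : IsRegular (l.map proj)) (hK : Equivalent ⟨l, hl⟩ K) :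
    ascendingNumber K ≤ (bad (edges l (start l 0))).ncard := by
  obtain ⟨D, hD⟩ := exists_isProjectionOf (K := ⟨l, hl⟩) hreg
  exact Nat.sInf_le ⟨D, ⟨_, hK, hD⟩, hD.ascendingNumber_eq.2⟩

theorem IsRegular.finite_bad {l : List Space} (hreg : IsRegular (l.map proj)) (hl : IsSimple l) :
    (bad (edges l (start l 0))).Finite := by
  obtain ⟨D, hD⟩ := exists_isProjectionOf (K := ⟨l, hl⟩) hreg
  exact hD.ascendingNumber_eq.1

/-- The ascending number is attained, provided that there is a regular projection. -/
theorem exists_ascendingNumber_eq {K : Knot} {l : List Space} (hl : IsSimple l)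
    (hreg : IsRegular (l.map proj)) (hK : Equivalent ⟨l, hl⟩ K) :
    ∃ K' : Knot, Equivalent K' K ∧ IsRegular (K'.verts.map proj) ∧
      ascendingNumber K = (bad (edges K'.verts (start K'.verts 0))).ncard := by
  obtain ⟨D, hD⟩ := exists_isProjectionOf (K := ⟨l, hl⟩) hreg
  -- Without any diagram the infimum would be the default value `0`; hence the need for one regular
  -- projection.
  have hne : {n | ∃ D : Diagram, D.IsDiagramOf K ∧ D.ascendingNumber = n}.Nonempty :=
    ⟨_, D, ⟨_, hK, hD⟩, rfl⟩
  obtain ⟨D', ⟨K', hK', hD'⟩, hn⟩ := Nat.sInf_mem hne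
  exact ⟨K', hK', hD'.1 ▸ D'.regular, hn.symm.trans hD'.ascendingNumber_eq.2⟩

end KnotTheory


namespace KnotTheory

/-! ### Reversal of the direction -/

section Reverse

variable {E : Type*} [AddCommGroup E] [Module ℝ E]

open Classical in
theorem through_hseg {a b : E} (h : a ≠ b) (x : E) :
    through (hseg a b) x = (if x ∈ openSegment ℝ a b then 1 else 0) + if a = x then 1 else 0 := by
  have h1 : a ∉ openSegment ℝ a b := fun ha => h (left_mem_openSegment_iff.1 ha)
  rw [through_eq_ite]
  by_cases hx : a = x
  · subst hx; simp [h1, left_mem_hseg]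
  · have : x ∈ hseg a b ↔ x ∈ openSegment ℝ a b :=
      ⟨fun h2 => mem_openSegment_of_mem_hseg h2 (Ne.symm hx), fun h2 => openSegment_subset_hseg _ _ h2⟩
    simp [hx, this]

-- Reversal changes half-open edges, so invariance of `passes` is not formal. Counting open edges
-- and vertices separately turns it into a sum of two symmetric terms.
open Classical in
theorem passes_eq_countP {l : List E} {e : E} (h : ∀ s ∈ edges l e, s.1 ≠ s.2) (x : E) :
    passes l e x = (edges l e).countP (fun s => x ∈ openSegment ℝ s.1 s.2) + l.count x := by
  induction l with
  | nil => simp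
  | cons a l ih =>
    rw [edges_cons] at h ⊢
    rw [passes_cons, ih fun s hs => h s (List.mem_cons_of_mem _ hs),
      through_hseg (h _ List.mem_cons_self), List.countP_cons, List.count_cons]
    simp only [decide_eq_true_eq, beq_iff_eq]
    ring

theorem edges_reverse {E : Type*} (a e : E) (l : List E) :
    edges (e :: l.reverse) a = ((edges (a :: l) e).map Prod.swap).reverse := by
  induction l generalizing a with
  | nil => simp
  | cons b l ih =>
    have : e :: (b :: l).reverse = (e :: l.reverse) ++ b :: [] := by simp
    rw [this, edges_append, ih, edges_cons a]
    simp

theorem edges_ne {l : List E} (h2 : 2 ≤ l.length)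
    (h : ∀ v ∈ l, passes l (start l 0) v ≤ 1) : ∀ s ∈ edges l (start l 0), s.1 ≠ s.2 := by
  classical
  intro s hs e
  have hl : l ≠ [] := by rintro rfl; simp at h2
  obtain ⟨i, hi⟩ := List.mem_iff_getElem?.1 hs
  have hil : i < l.length := by
    have := (List.getElem?_eq_some_iff.1 hi).1; simpa using this
  rw [getElem?_edges hl hil, Option.some.injEq] at hi
  subst hi
  dsimp only at e
  have hmem : vertex l i ∈ l := by
    rw [vertex, Nat.mod_eq_of_lt hil, List.getD_eq_getElem _ _ hil]; exact List.getElem_mem _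
  have := h _ hmem
  rw [passes_closed hl, Finset.card_le_one] at this
  have h1 := this i (by simpa using ⟨hil, left_mem_hseg _ _⟩) ((i + 1) % l.length) (by
    rw [Finset.mem_filter, Finset.mem_range, edge_mod, e]
    exact ⟨Nat.mod_lt _ (by omega), left_mem_hseg _ _⟩)
  rcases (show i + 1 ≤ l.length by omega).lt_or_eq with h4 | h4
  · rw [Nat.mod_eq_of_lt h4] at h1; omega
  · rw [h4, Nat.mod_self] at h1; omega

theorem passes_reverse {a : E} {l : List E} (h2 : l ≠ []) (h : ∀ v ∈ a :: l, passes (a :: l) a v ≤ 1)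
    (x : E) : passes (a :: l.reverse) a x = passes (a :: l) a x := by
  classical
  have h1 : ∀ s ∈ edges (a :: l) a, s.1 ≠ s.2 :=
    edges_ne (l := a :: l) (by have := List.length_pos_iff.2 h2; simp; omega) h
  rw [passes_eq_countP h1, passes_eq_countP, edges_reverse, List.countP_reverse, List.countP_map,
    List.count_cons, List.count_cons, List.count_reverse]
  · congr 2
    ext s
    simp [openSegment_symm ℝ s.1 s.2]
  · intro s hs
    rw [edges_reverse, List.mem_reverse, List.mem_map] at hs
    obtain ⟨t, ht, rfl⟩ := hs
    exact (h1 t ht).symm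

theorem IsSimple.reverse {a : E} {l : List E} (h : IsSimple (a :: l)) : IsSimple (a :: l.reverse) := by
  rw [isSimple_cons_iff] at h ⊢
  refine ⟨by simpa using h.1, fun x => ?_⟩
  rw [passes_reverse (by rintro rfl; simp at h) fun v _ => h.2 v]
  exact h.2 x

theorem carrier_reverse {a : E} {l : List E} (h : IsSimple (a :: l)) :
    carrier (a :: l.reverse) = carrier (a :: l) := by
  rw [carrier_eq (by simp), carrier_eq (by simp)]
  ext x
  rw [isSimple_cons_iff] at h
  rw [mem_path_iff, mem_path_iff, start_cons, start_cons,
    passes_reverse (by rintro rfl; simp at h) fun v _ => h.2 v]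

theorem carrier_rotate {a : E} {l : List E} (hl : l ≠ []) :
    carrier (l ++ [a]) = carrier (a :: l) := by
  rw [carrier_eq (by simp), carrier_eq (by simp)]
  ext x
  rw [mem_path_iff, mem_path_iff, start_cons, ← passes_rotate a l x hl]
  cases l with
  | nil => exact absurd rfl hl
  | cons b l => simp

end Reverse

theorem IsRegular.reverse {a : Plane} {l : List Plane} (h : IsRegular (a :: l)) :
    IsRegular (a :: l.reverse) := by
  rw [isRegular_iff] at h ⊢
  obtain ⟨h1, h2, h3⟩ := h
  have hl : l ≠ [] := by rintro rfl; simp at h1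
  simp only [start_cons] at h2 h3 ⊢
  refine ⟨by simpa using h1, fun x => ?_, fun v hv => ?_⟩
  · rw [passes_reverse hl h3]; exact h2 x
  · rw [passes_reverse hl h3]; exact h3 v (by simpa using hv)

theorem IsRegular.map {φ : Plane →ᵃ[ℝ] Plane} (hφ : Function.Injective φ) {l : List Plane}
    (h : IsRegular l) : IsRegular (l.map φ) := by
  have h1 := h.1
  rw [isRegular_iff] at h ⊢
  cases l with
  | nil => simp at h1
  | cons a l =>
    simp only [List.map_cons, start_cons] at h ⊢
    rw [← List.map_cons]
    refine ⟨by simpa using h.1, fun x => ?_, fun v hv => ?_⟩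
    · by_cases hx : x ∈ path ((a :: l).map φ) (φ a)
      · rw [path_map] at hx
        obtain ⟨y, -, rfl⟩ := hx
        rw [passes_map hφ]; exact h.2.1 y
      · rw [passes_eq_zero.2 hx]; omega
    · obtain ⟨y, hy, rfl⟩ := List.mem_map.1 hv
      rw [passes_map hφ]; exact h.2.2 y hy

theorem Isotopic.reverse {l l' : List Space} (h : Isotopic l l') : Isotopic l.reverse l'.reverse := by
  induction h with
  | rel _ _ h =>
    cases h with
    | rotate a l h =>
      rw [List.reverse_cons, List.reverse_append]
      exact (isotopic_rotate h.reverse).symm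
    | delta a b c l h h' htri =>
      have h1 := h.reverse
      have h1' := h'.reverse
      have e1 : (a :: b :: l).reverse = l.reverse ++ [b, a] := by simp
      have e2 : (a :: c :: b :: l).reverse = l.reverse ++ [b, c, a] := by simp
      have s1 : IsSimple (l.reverse ++ [b, a]) := by rw [← e1]; simpa using h1.rotate
      have s2 : IsSimple (l.reverse ++ [b, c, a]) := by rw [← e2]; simpa using h1'.rotate
      have i1 := isotopic_append_comm s1
      have i2 := isotopic_append_comm s2
      rw [e1, e2]
      have i3 : Isotopic (b :: a :: l.reverse) (b :: c :: a :: l.reverse) := by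
        refine Relation.EqvGen.rel _ _ (OrientedStep.delta b a c l.reverse
          (i1.isSimple_iff.1 s1) (i2.isSimple_iff.1 s2) ?_)
        have e3 : carrier (b :: a :: l.reverse) = carrier (a :: b :: l) := by
          rw [← carrier_rotate (a := b) (l := a :: l.reverse) (by simp), ← carrier_reverse h]
          simp
        rw [e3, Set.insert_comm, htri, segment_symm]
      exact i1.trans (i3.trans i2.symm)
  | refl => exact Isotopic.refl _
  | symm _ _ _ ih => exact ih.symm
  | trans _ _ _ _ _ h1 h2 => exact h1.trans h2

/-- Oriented isotopy is compatible with reversal, so all reversals in a chain of steps can be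
collected into at most one. -/
theorem Equivalent.isotopic {K K' : Knot} (h : Equivalent K K') :
    Isotopic K.verts K'.verts ∨ Isotopic K.verts K'.verts.reverse := by
  induction h with
  | rel K K' h =>
    cases h with
    | rotate h =>
      left
      rw [h]
      have hs := K.simple
      cases hv : K.verts with
      | nil => rw [hv] at hs; exact absurd hs.1 (by simp)
      | cons a l => rw [hv] at hs; simpa using isotopic_rotate hs
    | reverse h => right; rw [h, List.reverse_reverse]; exact Isotopic.refl _
    | delta a b c l h h' htri =>
      left
      have hs := K.simple
      have hs' := K'.simple
      rw [h] at hs htri ⊢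
      rw [h'] at hs' ⊢
      exact Relation.EqvGen.rel _ _ (OrientedStep.delta a b c l hs hs' htri)
  | refl => exact Or.inl (Isotopic.refl _)
  | symm _ _ _ ih =>
    rcases ih with h | h
    · exact Or.inl h.symm
    · right
      have := h.reverse
      rw [List.reverse_reverse] at this
      exact this.symm
  | trans _ _ _ _ _ h1 h2 =>
    rcases h1 with h1 | h1 <;> rcases h2 with h2 | h2
    · exact Or.inl (h1.trans h2)
    · exact Or.inr (h1.trans h2)
    · exact Or.inr (h1.trans h2.reverse)
    · left
      have := h2.reverse
      rw [List.reverse_reverse] at this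
      exact h1.trans this

/-! ### Turning a polygon upside down -/

/-- The linear map with the matrix of a rotation about the first coordinate axis, if
`c ^ 2 + s ^ 2 = 1`. -/
def turn (c s : ℝ) : Space →ₗ[ℝ] Space where
  toFun x := ![x 0, c * x 1 - s * x 2, s * x 1 + c * x 2]
  map_add' x y := by ext i; fin_cases i <;> simp <;> ring
  map_smul' r x := by ext i; fin_cases i <;> simp <;> ring

theorem turn_apply (c s : ℝ) (x : Space) :
    turn c s x = ![x 0, c * x 1 - s * x 2, s * x 1 + c * x 2] := rfl

theorem turn_injective {c s : ℝ} (h : c ^ 2 + s ^ 2 = 1) : Function.Injective (turn c s) := by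
  refine Function.LeftInverse.injective (g := turn c (-s)) fun x => ?_
  ext i; fin_cases i
  · simp [turn_apply]
  · simp [turn_apply]; linear_combination x 1 * h
  · simp [turn_apply]; linear_combination x 2 * h

/-- The rotations by the angles between `0` and `π` form a continuous family of simple polygons. -/
theorem isotopic_turn {l : List Space} (h : IsSimple l) :
    Isotopic l (l.map (turn (-1) 0)) := by
  have := isotopic_of_family
    (l := l.map fun x t => turn (Real.cos (Real.pi * t)) (Real.sin (Real.pi * t)) x)
    (by
      intro g hg
      obtain ⟨x, -, rfl⟩ := List.mem_map.1 hg
      simp only [turn_apply]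
      fun_prop)
    (by
      intro t _
      rw [List.map_map]
      exact h.map (φ := (turn (Real.cos (Real.pi * t)) (Real.sin (Real.pi * t))).toAffineMap)
        (turn_injective (by rw [add_comm]; exact Real.sin_sq_add_cos_sq _)))
  have h0 : turn 1 0 = LinearMap.id := by
    ext x i; fin_cases i <;> simp [turn_apply]
  simpa [Function.comp_def, h0] using this

/-- Reflection of the plane in the first coordinate axis. -/
def mirror : Plane →ₗ[ℝ] Plane where
  toFun x := ![x 0, -x 1]
  map_add' x y := by ext i; fin_cases i <;> simp; ring
  map_smul' r x := by ext i; fin_cases i <;> simp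

theorem mirror_injective : Function.Injective mirror := by
  refine Function.LeftInverse.injective (g := mirror) fun x => ?_
  ext i; fin_cases i <;> simp [mirror]

theorem proj_turn (x : Space) : proj (turn (-1) 0 x) = mirror (proj x) := by
  ext i; fin_cases i <;> simp [proj, mirror, turn_apply]

/-- The half-turn exchanges upper and lower strands, and the reversal exchanges first and second
encounters; together they preserve the property of being ascending. -/
theorem bad_turn_subset (es : List (Space × Space)) :
    bad (((es.map (Prod.map (turn (-1) 0) (turn (-1) 0))).map Prod.swap).reverse) ⊆
      (fun p => (turn (-1) 0 p.2, turn (-1) 0 p.1)) '' bad es := by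
  rintro ⟨x, y⟩ ⟨s, t, hst, hx, hy, hxy, hlt⟩
  have h1 := List.reverse_sublist.2 hst
  rw [List.reverse_reverse, List.map_map] at h1
  obtain ⟨r, hr, hr'⟩ := List.sublist_map_iff.1 h1
  obtain ⟨t', s', rfl⟩ : ∃ t' s', r = [t', s'] := by
    have := congrArg List.length hr'
    match r, this with
    | [t', s'], _ => exact ⟨t', s', rfl⟩
  simp only [List.reverse_cons, List.reverse_nil, List.nil_append, List.cons_append, List.map_cons,
    List.map_nil, List.cons.injEq, and_true, Function.comp_apply] at hr'
  obtain ⟨rfl, rfl⟩ := hr'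
  simp only [Prod.fst_swap, Prod.snd_swap, Prod.map_fst, Prod.map_snd] at hx hy hxy hlt
  have himg : ∀ a b : Space, openSegment ℝ (turn (-1) 0 a) (turn (-1) 0 b) =
      turn (-1) 0 '' openSegment ℝ a b := fun a b =>
    (image_openSegment ℝ (turn (-1) 0).toAffineMap a b).symm
  rw [himg, openSegment_symm] at hx hy
  obtain ⟨x', hx', rfl⟩ := hx
  obtain ⟨y', hy', rfl⟩ := hy
  refine ⟨(y', x'), ⟨t', s', hr, hy', hx', ?_, ?_⟩, rfl⟩
  · rw [proj_turn, proj_turn] at hxy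
    exact (mirror_injective hxy).symm
  · simpa [turn_apply] using hlt

/-- The ascending number of a knot is realized by regular polygons with a prescribed direction. -/
theorem exists_isotopic_ascendingNumber {K : Knot} {l : List Space} (hl : IsSimple l)
    (hreg : IsRegular (l.map proj)) (hK : Equivalent ⟨l, hl⟩ K) :
    ∃ l', IsSimple l' ∧ Isotopic l' K.verts ∧ IsRegular (l'.map proj) ∧
      (bad (edges l' (start l' 0))).ncard ≤ ascendingNumber K := by
  obtain ⟨K', hK', hreg', hn⟩ := exists_ascendingNumber_eq hl hreg hK
  rcases hK'.isotopic with h | h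
  · exact ⟨_, K'.simple, h, hreg', hn.ge⟩
  have hs := K'.simple
  have hfin := hreg'.finite_bad hs
  generalize K'.verts = l₀ at hs h hreg' hn hfin
  cases l₀ with
  | nil => exact absurd hs.1 (by simp)
  | cons a m =>
    -- The minimal polygon has the opposite orientation. Turned over and reversed, it gets the
    -- prescribed one without additional bad pairs.
    have h1 := (isotopic_turn hs).symm.trans h
    have hs1 : IsSimple ((a :: m).map (turn (-1) 0)) :=
      hs.map (φ := (turn (-1) 0).toAffineMap) (turn_injective (by norm_num))
    rw [List.map_cons] at h1 hs1
    have h2 := h1.reverse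
    rw [List.reverse_reverse, List.reverse_cons] at h2
    refine ⟨_, hs1.reverse, (isotopic_rotate hs1.reverse).trans h2, ?_, ?_⟩
    · have h3 := (hreg'.map (φ := mirror.toAffineMap) mirror_injective)
      have h4 : ((a :: m).map proj).map mirror.toAffineMap =
          proj (turn (-1) 0 a) :: (m.map (turn (-1) 0)).map proj := by
        simp [Function.comp_def, proj_turn]
      rw [h4] at h3
      simpa using h3.reverse
    · rw [hn, start_cons, edges_reverse, ← List.map_cons, edges_map]
      have hf : (bad (edges (a :: m) a)).Finite := hfin
      exact (Set.ncard_le_ncard (bad_turn_subset _) (hf.image _)).trans (Set.ncard_image_le hf)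

end KnotTheory


namespace KnotTheory

/-! ### Existence of regular projections -/

/-- Twice the oriented area of a triangle. -/
def area (a b c : Plane) : ℝ := (b 0 - a 0) * (c 1 - a 1) - (b 1 - a 1) * (c 0 - a 0)

/-- The oriented area as an affine function of the last vertex. -/
def areaMap (a b : Plane) : Plane →ᵃ[ℝ] ℝ where
  toFun := area a b
  linear := (b 0 - a 0) • LinearMap.proj 1 - (b 1 - a 1) • LinearMap.proj 0
  map_vadd' p v := by simp [area]; ring

@[simp] theorem areaMap_apply (a b c : Plane) : areaMap a b c = area a b c := rfl

theorem area_rotate (a b c : Plane) : area b c a = area a b c := by simp only [area]; ring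

theorem area_swap (a b c : Plane) : area b a c = -area a b c := by simp only [area]; ring

theorem area_self (a b : Plane) : area a b a = 0 := by simp [area]

theorem area_self' (a b : Plane) : area a b b = 0 := by simp only [area]; ring

theorem area_add_smul (a b x y : Plane) (t : ℝ) :
    area a b (x + t • (y - x)) = area a b x + t * (area a b y - area a b x) := by
  simp only [area, Pi.add_apply, Pi.smul_apply, Pi.sub_apply, smul_eq_mul]; ring

theorem area_of_mem_hseg {a b x : Plane} (h : x ∈ hseg a b) : area a b x = 0 := by
  obtain ⟨t, -, -, rfl⟩ := mem_hseg.1 h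
  rw [area_add_smul, area_self, area_self', sub_self, mul_zero, add_zero]

theorem exists_area_ne_zero {a b : Plane} (h : a ≠ b) : ∃ c, area a b c ≠ 0 := by
  refine ⟨![a 0 - (b 1 - a 1), a 1 + (b 0 - a 0)], fun hc => h ?_⟩
  have : (b 0 - a 0) ^ 2 + (b 1 - a 1) ^ 2 = 0 := by
    rw [← hc]; simp [area]; ring
  have h0 : b 0 - a 0 = 0 := by nlinarith [sq_nonneg (b 0 - a 0), sq_nonneg (b 1 - a 1)]
  have h1 : b 1 - a 1 = 0 := by nlinarith [sq_nonneg (b 0 - a 0), sq_nonneg (b 1 - a 1)]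
  ext i; fin_cases i
  · exact (sub_eq_zero.1 h0).symm
  · exact (sub_eq_zero.1 h1).symm

theorem ne_of_area_ne_zero {a b c : Plane} (h : area a b c ≠ 0) : a ≠ b := by
  rintro rfl; simp [area] at h

/-- The determinant that vanishes if the lines `ab`, `cd`, `ef` have a point in common. -/
def conc (a b c d e f : Plane) : ℝ := area c d f * area a b e - area a b f * area c d e

/-- The determinant `conc` as an affine function of the last point. -/
noncomputable def concMap (a b c d e : Plane) : Plane →ᵃ[ℝ] ℝ :=
  area a b e • areaMap c d - area c d e • areaMap a b

theorem concMap_apply (a b c d e f : Plane) : concMap a b c d e f = conc a b c d e f := by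
  simp [concMap, conc]; ring

theorem conc_eq_zero {a b c d e f x : Plane} (h₁ : x ∈ hseg a b) (h₂ : x ∈ hseg c d)
    (h₃ : x ∈ hseg e f) : conc a b c d e f = 0 := by
  have e1 := area_of_mem_hseg h₁
  have e2 := area_of_mem_hseg h₂
  obtain ⟨t, -, ht, rfl⟩ := mem_hseg.1 h₃
  rw [area_add_smul] at e1 e2
  have h4 : (1 - t) * conc a b c d e f = 0 := by
    rw [conc]; linear_combination area c d f * e1 - area a b f * e2
  exact (mul_eq_zero.1 h4).resolve_left (by linarith)

theorem disjoint_hseg_of_area_ne_zero {a b c : Plane} (h : area a b c ≠ 0) :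
    Disjoint (hseg a b) (hseg b c) := by
  refine Set.disjoint_left.2 fun x h₁ h₂ => ?_
  have e1 := area_of_mem_hseg h₁
  obtain ⟨t, -, ht, rfl⟩ := mem_hseg.1 h₂
  rw [area_add_smul, area_self', sub_zero, zero_add] at e1
  rw [(mul_eq_zero.1 e1).resolve_right h, zero_smul, add_zero] at h₁
  exact right_notMem_hseg (ne_of_area_ne_zero h) h₁

/-- The zero set of an affine function that is not identically zero is a proper affine subspace. -/
theorem exists_mem_ne_zero {n : ℕ} {O : Set (Fin n → ℝ)} (hO : IsOpen O) (hne : O.Nonempty)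
    {S : Set ((Fin n → ℝ) →ᵃ[ℝ] ℝ)} (hS : S.Finite) :
    ∃ x ∈ O, ∀ g ∈ S, (∃ y, g y ≠ 0) → g x ≠ 0 := by
  obtain ⟨x, hx, h⟩ := exists_mem_avoiding hO hne {g ∈ S | ∃ y, g y ≠ 0}
    (hS.subset (Set.sep_subset _ _)) (fun g => (affineSpan ℝ {(0 : ℝ)}).comap g) (by
      rintro g ⟨-, y, hy⟩ htop
      have : y ∈ (affineSpan ℝ {(0 : ℝ)}).comap g := by rw [htop]; trivial
      simp only [AffineSubspace.mem_comap, AffineSubspace.mem_affineSpan_singleton] at this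
      exact hy this)
  refine ⟨x, hx, fun g hg hy h0 => h g ⟨hg, hy⟩ ?_⟩
  simp only [AffineSubspace.mem_comap, AffineSubspace.mem_affineSpan_singleton]
  exact h0

/-- The first `n` points of the sequence are in general position. -/
structure General (p : ℕ → Plane) (n : ℕ) : Prop where
  ne : ∀ i j, i < n → j < n → i ≠ j → p i ≠ p j
  area : ∀ i j k, i < n → j < n → k < n → i ≠ j → i ≠ k → j ≠ k → area (p i) (p j) (p k) ≠ 0
  conc : ∀ a b c d e f, [a, b, c, d, e, f].Nodup → (∀ i ∈ [a, b, c, d, e, f], i < n) →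
    conc (p a) (p b) (p c) (p d) (p e) (p f) ≠ 0

/-- Up to sign, `area` and `conc` are invariant under permutations that bring the new index to the
last place. -/
theorem General.succ {p : ℕ → Plane} {n : ℕ} (h : General p n)
    (h₁ : ∀ i, i < n → p i ≠ p n)
    (h₂ : ∀ i j, i < n → j < n → i ≠ j → KnotTheory.area (p i) (p j) (p n) ≠ 0)
    (h₃ : ∀ a b c d e, [a, b, c, d, e].Nodup → (∀ i ∈ [a, b, c, d, e], i < n) →
      KnotTheory.conc (p a) (p b) (p c) (p d) (p e) (p n) ≠ 0) : General p (n + 1) := by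
  have lt : ∀ {i}, i < n + 1 → i ≠ n → i < n := fun h h' => by omega
  refine ⟨fun i j hi hj hij => ?_, fun i j k hi hj hk hij hik hjk => ?_,
    fun a b c d e f hnd hlt => ?_⟩
  · by_cases ei : i = n
    · subst ei; exact (h₁ j (lt hj hij.symm)).symm
    by_cases ej : j = n
    · subst ej; exact h₁ i (lt hi hij)
    exact h.ne i j (lt hi ei) (lt hj ej) hij
  · by_cases ei : i = n
    · subst ei
      rw [← area_rotate]
      exact h₂ j k (lt hj hij.symm) (lt hk hik.symm) hjk
    by_cases ej : j = n
    · subst ej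
      rw [← area_rotate, ← area_rotate]
      exact h₂ k i (lt hk hjk.symm) (lt hi hij) hik.symm
    by_cases ek : k = n
    · subst ek; exact h₂ i j (lt hi hik) (lt hj hjk) hij
    exact h.area i j k (lt hi ei) (lt hj ej) (lt hk ek) hij hik hjk
  · simp only [List.nodup_cons, List.mem_cons, List.not_mem_nil, or_false, not_or, not_false_eq_true,
      List.nodup_nil, and_true, forall_eq_or_imp, forall_eq] at hnd hlt h₃
    have h0 := h.conc
    simp only [List.nodup_cons, List.mem_cons, List.not_mem_nil, or_false, not_or,
      not_false_eq_true, List.nodup_nil, and_true, forall_eq_or_imp, forall_eq] at h0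
    by_cases ef : f = n
    · subst ef
      exact h₃ a b c d e (by omega) (by omega)
    by_cases ee : e = n
    · subst ee
      intro hc
      refine h₃ a b c d f (by omega) (by omega) ?_
      rw [← neg_eq_zero, ← hc]; simp only [KnotTheory.conc]; ring
    by_cases ed : d = n
    · subst ed
      intro hc
      refine h₃ a b e f c (by omega) (by omega) ?_
      rw [← neg_eq_zero, ← hc]; simp only [KnotTheory.conc, KnotTheory.area]; ring
    by_cases ec : c = n
    · subst ec
      intro hc
      refine h₃ a b e f d (by omega) (by omega) ?_
      rw [← hc]; simp only [KnotTheory.conc, KnotTheory.area]; ring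
    by_cases eb : b = n
    · subst eb
      intro hc
      refine h₃ e f c d a (by omega) (by omega) ?_
      rw [← neg_eq_zero, ← hc]; simp only [KnotTheory.conc, KnotTheory.area]; ring
    by_cases ea : a = n
    · subst ea
      intro hc
      refine h₃ e f c d b (by omega) (by omega) ?_
      rw [← hc]; simp only [KnotTheory.conc, KnotTheory.area]; ring
    exact h0 a b c d e f (by omega) (by omega)

theorem exists_general (x : ℕ → Plane) {ε : ℝ} (hε : 0 < ε) (n : ℕ) :
    ∃ p : ℕ → Plane, (∀ k, k < n → dist (p k) (x k) < ε) ∧ General p n := by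
  induction n with
  | zero =>
    refine ⟨x, by simp, ⟨by simp, by simp, fun a b c d e f _ h => ?_⟩⟩
    have := h a (by simp); omega
  | succ n ih =>
    obtain ⟨p, hp, hG⟩ := ih
    obtain ⟨q, hq, hqS⟩ := exists_mem_ne_zero (Metric.isOpen_ball (x := x n) (ε := ε))
      ⟨x n, Metric.mem_ball_self hε⟩
      -- The first family only serves to make the new point distinct from the old ones: avoiding any
      -- line through `p i` suffices.
      (S := Set.range (fun i : Fin n => areaMap (p i) (p i + Pi.single 0 1)) ∪
        Set.range (fun i : Fin n × Fin n => areaMap (p i.1) (p i.2)) ∪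
        Set.range (fun i : Fin n × Fin n × Fin n × Fin n × Fin n =>
          concMap (p i.1) (p i.2.1) (p i.2.2.1) (p i.2.2.2.1) (p i.2.2.2.2)))
      (((Set.finite_range _).union (Set.finite_range _)).union (Set.finite_range _))
    have e1 : ∀ k, k < n → Function.update p n q k = p k := fun k hk =>
      Function.update_of_ne hk.ne _ _
    have e2 : Function.update p n q n = q := Function.update_self _ _ _
    refine ⟨Function.update p n q, fun k hk => ?_, General.succ ?_ ?_ ?_ ?_⟩
    · rcases (Nat.lt_succ_iff.1 hk).lt_or_eq with h | rfl
      · rw [e1 k h]; exact hp k h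
      · rw [e2]; exact hq
    · refine ⟨fun i j hi hj => ?_, fun i j k hi hj hk => ?_, fun a b c d e f hnd hlt => ?_⟩
      · rw [e1 i hi, e1 j hj]; exact hG.ne i j hi hj
      · rw [e1 i hi, e1 j hj, e1 k hk]; exact hG.area i j k hi hj hk
      · rw [e1 a (hlt a (by simp)), e1 b (hlt b (by simp)), e1 c (hlt c (by simp)),
          e1 d (hlt d (by simp)), e1 e (hlt e (by simp)), e1 f (hlt f (by simp))]
        exact hG.conc a b c d e f hnd hlt
    · intro i hi
      rw [e1 i hi, e2]
      rintro rfl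
      refine hqS _ (Or.inl (Or.inl ⟨⟨i, hi⟩, rfl⟩)) (exists_area_ne_zero fun h => ?_) (area_self _ _)
      simpa using congrFun h 0
    · intro i j hi hj hij
      rw [e1 i hi, e1 j hj, e2]
      exact hqS _ (Or.inl (Or.inr ⟨⟨⟨i, hi⟩, ⟨j, hj⟩⟩, rfl⟩))
        (exists_area_ne_zero (hG.ne i j hi hj hij))
    · intro a b c d e hnd hlt
      have ha := hlt a (by simp)
      have hb := hlt b (by simp)
      have hc := hlt c (by simp)
      have hd := hlt d (by simp)
      have he := hlt e (by simp)
      rw [e1 a ha, e1 b hb, e1 c hc, e1 d hd, e1 e he, e2, ← concMap_apply]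
      -- At the point `p c` one of the two products in `conc` vanishes and the other is nonzero, so
      -- the function is not identically zero.
      refine hqS _ (Or.inr ⟨⟨⟨a, ha⟩, ⟨b, hb⟩, ⟨c, hc⟩, ⟨d, hd⟩, ⟨e, he⟩⟩, rfl⟩) ⟨p c, ?_⟩
      simp only [List.nodup_cons, List.mem_cons, List.not_mem_nil, or_false, not_or] at hnd
      rw [concMap_apply, conc, area_self, zero_mul, zero_sub]
      refine neg_ne_zero.2 (mul_ne_zero ?_ ?_)
      · exact hG.area a b c ha hb hc (by omega) (by omega) (by omega)
      · exact hG.area c d e hc hd he (by omega) (by omega) (by omega)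

/-- A vertex on a foreign edge would give three collinear points. Among three edges with a common
point, either two are adjacent, and then disjoint, or all six end points are distinct and `conc`
vanishes. -/
theorem General.isRegular {p : ℕ → Plane} {n : ℕ} (h : General p n) (h3 : 3 ≤ n) {l : List Plane}
    (hl : l.length = n) (hv : ∀ i, vertex l i = p (i % n)) : IsRegular l := by
  have hedge : ∀ i, i < n → edge l i = hseg (p i) (p ((i + 1) % n)) := by
    intro i hi
    have : edge l i = hseg (vertex l i) (vertex l (i + 1)) := rfl
    rw [this, hv, hv, Nat.mod_eq_of_lt hi]
  have hmod : ∀ i, i < n → (i + 1) % n = i + 1 ∧ i + 1 < n ∨ (i + 1) % n = 0 ∧ i + 1 = n := by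
    intro i hi
    rcases (show i + 1 ≤ n by omega).lt_or_eq with h4 | h4
    · exact Or.inl ⟨Nat.mod_eq_of_lt h4, h4⟩
    · exact Or.inr ⟨by rw [h4, Nat.mod_self], h4⟩
  have adj : ∀ i j k, i < n → j < n → k < n → i ≠ j → i ≠ k → j ≠ k →
      Disjoint (hseg (p i) (p j)) (hseg (p j) (p k)) := fun i j k hi hj hk hij hik hjk =>
    disjoint_hseg_of_area_ne_zero (h.area i j k hi hj hk hij hik hjk)
  refine ⟨by omega, fun i j hi hj hij hmem => ?_, fun i j k hij hjk hk => ?_⟩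
  · rw [hl] at hi hj
    rw [hedge j hj, hv, Nat.mod_eq_of_lt hi] at hmem
    have hj' := hmod j hj
    by_cases e : i = (j + 1) % n
    · rw [← e] at hmem
      exact right_notMem_hseg (h.ne j i hj hi hij.symm) hmem
    · exact h.area j ((j + 1) % n) i hj (by omega) hi (by omega) hij.symm (Ne.symm e)
        (area_of_mem_hseg hmem)
  · rw [hl] at hk
    have hi' := hmod i (by omega)
    have hj' := hmod j (by omega)
    have hk' := hmod k hk
    rw [hedge i (by omega), hedge j (by omega), hedge k hk, Set.eq_empty_iff_forall_notMem]
    rintro x ⟨⟨xi, xj⟩, xk⟩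
    by_cases c1 : (i + 1) % n = j
    · rw [c1] at xi
      exact Set.disjoint_left.1 (adj i j ((j + 1) % n) (by omega) (by omega) (by omega) (by omega)
        (by omega) (by omega)) xi xj
    by_cases c2 : (j + 1) % n = k
    · rw [c2] at xj
      exact Set.disjoint_left.1 (adj j k ((k + 1) % n) (by omega) (by omega) (by omega) (by omega)
        (by omega) (by omega)) xj xk
    by_cases c3 : (k + 1) % n = i
    · rw [c3] at xk
      exact Set.disjoint_left.1 (adj k i ((i + 1) % n) (by omega) (by omega) (by omega) (by omega)
        (by omega) (by omega)) xk xi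
    refine h.conc i ((i + 1) % n) j ((j + 1) % n) k ((k + 1) % n) ?_ ?_ (conc_eq_zero xi xj xk)
    · simp only [List.nodup_cons, List.mem_cons, List.not_mem_nil, or_false, not_or,
        not_false_eq_true, List.nodup_nil, and_true]
      omega
    · simp only [List.mem_cons, List.not_mem_nil, or_false, forall_eq_or_imp, forall_eq]
      omega

/-- The horizontal coordinates of the vertices are perturbed into general position, within the
radius in which the isotopy class is constant. -/
theorem exists_isotopic_isRegular {l : List Space} (hl : IsSimple l) :
    ∃ l', IsSimple l' ∧ Isotopic l' l ∧ IsRegular (l'.map proj) := by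
  obtain ⟨n, v, rfl⟩ : ∃ (n : ℕ) (v : Fin n → Space), l = List.ofFn v :=
    ⟨l.length, l.get, (List.ofFn_get l).symm⟩
  obtain ⟨ε, hε, hball⟩ := exists_ball_isotopic hl
  obtain ⟨p, hp, hG⟩ := exists_general
    (fun k => if h : k < n then proj (v ⟨k, h⟩) else 0) hε n
  have h3 : 3 ≤ n := by simpa using hl.1
  set w : Fin n → Space := fun i => ![p i 0, p i 1, v i 2] with hw
  have hpw : ∀ i, proj (w i) = p i := fun i => by
    ext j; fin_cases j <;> simp [proj, hw]
  have hd : dist w v < ε := by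
    rw [dist_pi_lt_iff hε]
    intro i
    have h1 := hp i i.2
    simp only [i.2, dite_true] at h1
    rw [dist_pi_lt_iff hε] at h1 ⊢
    intro j
    fin_cases j
    · simpa [hw, proj] using h1 0
    · simpa [hw, proj] using h1 1
    · simpa [hw] using hε
  obtain ⟨hs, hi⟩ := hball w hd
  refine ⟨_, hs, hi.symm, hG.isRegular h3 (by simp) fun i => ?_⟩
  have hin : i % n < n := Nat.mod_lt _ (by omega)
  rw [vertex_map_proj, vertex, List.length_ofFn, List.getD_eq_getElem _ _ (by simpa using hin),
    List.getElem_ofFn, hpw]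

end KnotTheory


/-! ### Minimal polygons in a given oriented isotopy class -/

namespace KnotTheory

theorem ascendingNumber_congr {K K' : Knot} (h : Equivalent K K') :
    ascendingNumber K = ascendingNumber K' := by
  have : ∀ D : Diagram, D.IsDiagramOf K ↔ D.IsDiagramOf K' := fun D =>
    ⟨fun ⟨k, hk, hD⟩ => ⟨k, hk.trans _ _ _ h, hD⟩,
      fun ⟨k, hk, hD⟩ => ⟨k, hk.trans _ _ _ (h.symm _ _), hD⟩⟩
  simp only [ascendingNumber, this]

/-- The ascending number of a knot is realized by regular polygons in each oriented isotopy
class. -/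
theorem exists_isotopic_le_ascendingNumber {K k : Knot} (h : Equivalent K k) :
    ∃ l, IsSimple l ∧ Isotopic l k.verts ∧ IsRegular (l.map proj) ∧
      (bad (edges l (start l 0))).ncard ≤ ascendingNumber K := by
  obtain ⟨l, hl, hi, hr⟩ := exists_isotopic_isRegular k.simple
  obtain ⟨l', hl', hi', hr', hn⟩ := exists_isotopic_ascendingNumber hl hr (hi.equivalent hl k.simple)
  exact ⟨l', hl', hi', hr', hn.trans (ascendingNumber_congr h).ge⟩

/-! ### A short edge without crossings -/

section Cut

variable {E : Type*} [AddCommGroup E] [Module ℝ E]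

/-- The point at the position `t` on the line through `a` and `b`. -/
def pos (a b : E) (t : ℝ) : E := a + t • (b - a)

theorem pos_mem_openSegment (a b : E) {s t : ℝ} (h0 : 0 < s) (h : s < t) :
    pos a b s ∈ openSegment ℝ a (pos a b t) := by
  have ht := h0.trans h
  refine Tangle.mem_openSegment_iff.2 ⟨s / t, by positivity, (div_lt_one ht).2 h, ?_⟩
  rw [pos, pos, add_sub_cancel_left, smul_smul, div_mul_cancel₀ _ ht.ne']

theorem pos_mem_openSegment' (a b : E) {t : ℝ} (h0 : 0 < t) (h : t < 1) :
    pos a b t ∈ openSegment ℝ a b := Tangle.mem_openSegment_iff.2 ⟨t, h0, h, rfl⟩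

theorem pos_mem_hseg (a b : E) {t : ℝ} (h0 : 0 ≤ t) (h : t < 1) : pos a b t ∈ hseg a b :=
  mem_hseg.2 ⟨t, h0, h, rfl⟩

theorem pos_ne {a b : E} (hab : a ≠ b) {t : ℝ} (h : 0 < t) : a ≠ pos a b t := by
  intro e
  rw [pos, left_eq_add, smul_eq_zero] at e
  exact e.elim h.ne' (sub_ne_zero.2 hab.symm)

theorem hseg_pos_subset (a b : E) {s t : ℝ} (h0 : 0 ≤ s) (h : s < t) (h1 : t ≤ 1) :
    hseg (pos a b s) (pos a b t) ⊆ hseg a b :=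
  hseg_subset_hseg h0 h.le h1 (h.trans_le h1) rfl rfl

theorem exists_of_mem_hseg_pos {a b x : E} {s t : ℝ} (hst : s < t)
    (hx : x ∈ hseg (pos a b s) (pos a b t)) : ∃ r, s ≤ r ∧ r < t ∧ x = pos a b r := by
  obtain ⟨u, h0, h1, rfl⟩ := mem_hseg.1 hx
  exact ⟨s + u * (t - s), by nlinarith, by nlinarith, by simp only [pos]; module⟩

theorem pos_zero (a b : E) : pos a b 0 = a := by simp [pos]

theorem pos_one (a b : E) : pos a b 1 = b := by simp [pos]

theorem passes_cut {a b : E} (hab : a ≠ b) {τ : ℝ} (h0 : 0 < τ) (h1 : 2 * τ < 1) (l : List E)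
    (x : E) : passes (pos a b τ :: pos a b (2 * τ) :: b :: (l ++ [a])) (pos a b τ) x =
      passes (a :: b :: l) a x := by
  have e1 := passes_rotate a (pos a b τ :: pos a b (2 * τ) :: b :: l) x (by simp)
  rw [passes_subdivide (pos_mem_openSegment a b h0 (by linarith)) (pos_ne hab (by linarith)),
    passes_subdivide (pos_mem_openSegment' a b (by linarith) h1) hab] at e1
  exact e1

end Cut

theorem isotopic_cut {a b : Space} {l : List Space} (h : IsSimple (a :: b :: l)) {τ : ℝ}
    (h0 : 0 < τ) (h1 : 2 * τ < 1) :
    Isotopic (a :: b :: l) (pos a b τ :: pos a b (2 * τ) :: b :: (l ++ [a])) := by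
  have i1 := isotopic_subdivide h (pos_mem_openSegment' a b (t := 2 * τ) (by linarith) h1)
  have s1 := i1.isSimple_iff.1 h
  have i2 := isotopic_subdivide s1 (pos_mem_openSegment a b h0 (t := 2 * τ) (by linarith))
  exact i1.trans (i2.trans (isotopic_rotate (i2.isSimple_iff.1 s1)))

theorem proj_pos (a b : Space) (t : ℝ) : proj (pos a b t) = pos (proj a) (proj b) t :=
  proj_add_smul a b t

theorem openSegment_subset_path {E : Type*} [AddCommGroup E] [Module ℝ E] {l : List E} {e : E}
    {s : E × E} (hs : s ∈ edges l e) : openSegment ℝ s.1 s.2 ⊆ path l e := by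
  induction l with
  | nil => simp at hs
  | cons a l ih =>
    rw [edges_cons, List.mem_cons] at hs
    rcases hs with rfl | hs
    · exact (openSegment_subset_hseg _ _).trans Set.subset_union_left
    · exact (ih hs).trans Set.subset_union_right

theorem IsRegular.head_ne {a b : Plane} {l : List Plane} (h : IsRegular (a :: b :: l)) : a ≠ b := by
  have h3 := h.1
  have := h.vertex_ne (i := 0) (by omega)
  simpa [vertex] using this

/-- A regular polygon has finitely many double points, and the vertex `a` is none of them. -/
theorem exists_positions_notMem {a b : Plane} {l : List Plane} (h : IsRegular (a :: b :: l)) :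
    ∃ t₀ : ℝ, 0 < t₀ ∧ t₀ < 1 ∧ ∀ r, 0 ≤ r → r ≤ t₀ → pos a b r ∉ path (b :: l) a := by
  have hab := h.head_ne
  have hinj : Function.Injective (pos a b) := by
    intro s t hst
    rw [pos, pos, add_right_inj] at hst
    exact smul_left_injective ℝ (sub_ne_zero.2 hab.symm) hst
  -- The position `0` is removed so that the complement is a neighbourhood of it; that `a` is not a
  -- double point is used separately at the end.
  have hfin := (h.finite_double.preimage hinj.injOn).subset
    (Set.sdiff_subset (t := {(0 : ℝ)}))
  have hopen := hfin.isClosed.isOpen_compl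
  obtain ⟨ε, hε, hball⟩ := Metric.isOpen_iff.1 hopen 0 (by simp)
  refine ⟨min (ε / 2) (1 / 2), by positivity, (min_le_right _ _).trans_lt (by norm_num),
    fun r h0 h1 hr => ?_⟩
  have hr1 : r < 1 := h1.trans_lt ((min_le_right _ _).trans_lt (by norm_num))
  have h2 : 2 ≤ passes (a :: b :: l) a (pos a b r) := by
    rw [passes_cons, start_cons, through_of_mem (pos_mem_hseg a b h0 hr1)]
    have := mem_path_iff.1 hr; omega
  rcases h0.lt_or_eq with h3 | rfl
  · have hr2 : r ∈ Metric.ball (0 : ℝ) ε := by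
      rw [mem_ball_iff_norm, sub_zero, Real.norm_of_nonneg h0]
      exact h1.trans_lt ((min_le_left _ _).trans_lt (by linarith))
    exact hball hr2 ⟨h2, h3.ne'⟩
  · rw [pos_zero] at h2
    have := (isRegular_iff.1 h).2.2 a (by simp)
    rw [start_cons] at this; omega

/-- A regular polygon can be subdivided in such a way that it begins with an edge without
crossings. -/
theorem exists_edge_without_crossings {l : List Space} (hl : IsSimple l)
    (hreg : IsRegular (l.map proj)) :
    ∃ u v m, IsSimple (u :: v :: m) ∧ Isotopic (u :: v :: m) l ∧
      IsRegular ((u :: v :: m).map proj) ∧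
      (∀ x ∈ hseg u v, ∀ y ∈ path (v :: m) u, proj x ≠ proj y) ∧
      bad (edges (v :: m) u) ⊆ bad (edges l (start l 0)) := by
  obtain ⟨a, b, l, rfl⟩ : ∃ a b l', l = a :: b :: l' := by
    match l, hl with
    | [], hl => exact absurd hl.1 (by simp)
    | [a], hl => exact absurd hl.1 (by simp)
    | a :: b :: l, _ => exact ⟨a, b, l, rfl⟩
  have hreg' := hreg
  rw [List.map_cons, List.map_cons] at hreg'
  have hab := hreg'.head_ne
  obtain ⟨t₀, h0, h1, hfree⟩ := exists_positions_notMem hreg'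
  set τ := t₀ / 2 with hτ
  have ht₀ : 2 * τ = t₀ := by rw [hτ]; ring
  have hτ0 : 0 < τ := by positivity
  have hi := isotopic_cut hl hτ0 (by linarith)
  have hpath : ∀ y ∈ path (b :: l) a, proj y ∈ path (proj b :: l.map proj) (proj a) := by
    intro y hy
    rw [← List.map_cons, proj_path]; exact ⟨y, hy, rfl⟩
  have hcut : ∀ x, passes ((pos a b τ :: pos a b (2 * τ) :: b :: (l ++ [a])).map proj)
      (proj (pos a b τ)) x = passes ((a :: b :: l).map proj) (proj a) x := by
    intro x
    have := passes_cut hab hτ0 (by linarith : 2 * τ < 1) (l.map proj) x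
    simpa [proj_pos] using this
  have hle1 : ∀ r, 0 ≤ r → r ≤ t₀ →
      passes ((a :: b :: l).map proj) (proj a) (pos (proj a) (proj b) r) ≤ 1 := by
    intro r hr0 hr1
    rw [List.map_cons, passes_cons]
    have := passes_eq_zero.2 (hfree r hr0 hr1)
    rw [List.map_cons, this]
    exact through_le_one _ _
  have hR := isRegular_iff.1 hreg
  have hreg₂ : IsRegular ((pos a b τ :: pos a b (2 * τ) :: b :: (l ++ [a])).map proj) := by
    rw [isRegular_iff]
    refine ⟨by simp, fun x => ?_, fun v hv => ?_⟩
    · exact (hcut x).trans_le (hR.2.1 x)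
    · refine (hcut v).trans_le ?_
      simp only [List.map_cons, List.map_append, List.map_nil, List.mem_cons, List.mem_append,
        List.not_mem_nil, or_false] at hv
      rcases hv with rfl | rfl | rfl | hv | rfl
      · rw [proj_pos]; exact hle1 _ hτ0.le (by linarith)
      · rw [proj_pos]; exact hle1 _ (by linarith) (by linarith)
      · exact hR.2.2 _ (by simp)
      · exact hR.2.2 _ (by simp [hv])
      · exact hR.2.2 _ (by simp)
  refine ⟨pos a b τ, pos a b (2 * τ), b :: (l ++ [a]), hi.isSimple_iff.1 hl, hi.symm, hreg₂, ?_, ?_⟩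
  · intro x hx y hy e
    obtain ⟨r, hr0, hr1, rfl⟩ := exists_of_mem_hseg_pos (by linarith) hx
    have h2 := hcut (proj (pos a b r))
    have h3 := hle1 r (by linarith) (by linarith)
    rw [← proj_pos] at h3
    have h4 : 0 < passes ((pos a b (2 * τ) :: b :: (l ++ [a])).map proj) (proj (pos a b τ))
        (proj (pos a b r)) := by
      rw [← mem_path_iff, proj_path, e]; exact ⟨y, hy, rfl⟩
    rw [List.map_cons, passes_cons, List.map_cons, start_cons, through_of_mem, ← List.map_cons] at h2
    · omega
    · rw [proj_hseg]; exact ⟨_, hx, rfl⟩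
  -- The basepoint moves from `a` to the position `τ`. The piece that is now passed last instead of
  -- first has no crossings, so no first encounter changes.
  · have e1 : edges (pos a b (2 * τ) :: b :: (l ++ [a])) (pos a b τ) =
        (pos a b (2 * τ), b) :: (edges (b :: l) a ++ [(a, pos a b τ)]) := by
      have := edges_append (b :: l) [] a (pos a b τ)
      rw [List.cons_append] at this
      rw [edges_cons, this]; simp
    have hinj := proj_injOn_hseg hab
    have o1 : openSegment ℝ (pos a b (2 * τ)) b ⊆ openSegment ℝ a b := by
      intro x hx
      obtain ⟨t, g0, g1, rfl⟩ := Tangle.mem_openSegment_iff.1 hx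
      refine Tangle.mem_openSegment_iff.2 ⟨2 * τ + t * (1 - 2 * τ), by nlinarith, by nlinarith, ?_⟩
      simp only [pos]; module
    have o2 : ∀ x ∈ openSegment ℝ a (pos a b τ), ∃ r, 0 < r ∧ r < τ ∧ x = pos a b r := by
      intro x hx
      obtain ⟨t, g0, g1, rfl⟩ := Tangle.mem_openSegment_iff.1 hx
      exact ⟨t * τ, by positivity, by nlinarith, by simp only [pos]; module⟩
    rintro ⟨x, y⟩ ⟨s, t, hst, hx, hy, hxy, hlt⟩
    dsimp only at hx hy hxy hlt
    rw [e1, pair_sublist_cons_iff, pair_sublist_append_iff, List.mem_append, List.mem_singleton] at hst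
    rcases hst with ⟨rfl, ht | rfl⟩ | hst | ⟨hs, ht⟩ | hst
    · exact ⟨(a, b), t, pair_sublist_cons_iff.2 (Or.inl ⟨rfl, ht⟩), o1 hx, hy, hxy, hlt⟩
    · obtain ⟨r, hr0, hr1, rfl⟩ := o2 y hy
      have := hinj (openSegment_subset_hseg _ _ (o1 hx)) (pos_mem_hseg a b hr0.le (by linarith)) hxy
      rw [this] at hlt; exact absurd hlt (lt_irrefl _)
    · exact ⟨s, t, pair_sublist_cons_iff.2 (Or.inr hst), hx, hy, hxy, hlt⟩
    · subst ht
      obtain ⟨r, hr0, hr1, rfl⟩ := o2 y hy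
      have := hpath x (openSegment_subset_path hs hx)
      rw [hxy, proj_pos] at this
      exact absurd this (hfree r hr0.le (by linarith))
    · exact absurd hst.length_le (by simp)

end KnotTheory


namespace KnotTheory

/-! ### Lifting the crossing-free edge above the rest of the knot -/

theorem isClosed_path_union {n : ℕ} (l : List (Fin n → ℝ)) (e : Fin n → ℝ) :
    IsClosed (path l e ∪ {e}) := by
  induction l with
  | nil => simp
  | cons a l ih =>
    have hs : start l e ∈ path l e ∪ {e} := by
      cases l with
      | nil => simp
      | cons b l => exact Or.inl (mem_path_of_mem (by simp))
    have e1 : path (a :: l) e ∪ {e} = segment ℝ a (start l e) ∪ (path l e ∪ {e}) := by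
      rw [path_cons, segment_eq_hseg_union, Set.union_assoc, Set.union_assoc,
        Set.union_eq_self_of_subset_left (Set.singleton_subset_iff.2 hs)]
    rw [e1]
    refine IsClosed.union ?_ ih
    rw [segment_eq_image_lineMap]
    exact (isCompact_Icc.image AffineMap.lineMap_continuous).isClosed

theorem exists_coordinate_bound {n : ℕ} (l : List (Fin n → ℝ)) (i : Fin n) :
    ∃ c : ℝ, 0 < c ∧ ∀ z ∈ l, |z i| < c := by
  induction l with
  | nil => exact ⟨1, one_pos, by simp⟩
  | cons a l ih =>
    obtain ⟨c, hc, h⟩ := ih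
    refine ⟨max c (|a i| + 1), lt_max_of_lt_left hc, fun z hz => ?_⟩
    rcases List.mem_cons.1 hz with rfl | hz
    · exact lt_max_of_lt_right (by linarith)
    · exact lt_max_of_lt_left (h z hz)

theorem abs_lt_of_mem_path {n : ℕ} {l : List (Fin n → ℝ)} {e x : Fin n → ℝ} {i : Fin n} {c : ℝ}
    (hl : ∀ z ∈ l, |z i| < c) (he : |e i| < c) (hx : x ∈ path l e) : |x i| < c := by
  have hconv : Convex ℝ {z : Fin n → ℝ | |z i| < c} := by
    have : {z : Fin n → ℝ | |z i| < c} = {z | -c < z i} ∩ {z | z i < c} := by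
      ext z; simp [abs_lt]
    rw [this]
    exact (convex_halfSpace_gt (LinearMap.proj i : (Fin n → ℝ) →ₗ[ℝ] ℝ).isLinear _).inter
      (convex_halfSpace_lt (LinearMap.proj i : (Fin n → ℝ) →ₗ[ℝ] ℝ).isLinear _)
  exact path_subset_convex hconv hl he hx

theorem mem_hseg_of_mem_segment_pos {E : Type*} [AddCommGroup E] [Module ℝ E] {u v y : E} {σ τ : ℝ}
    (hσ : 0 < σ) (hστ : σ < τ) (hτ : τ < 1) (hy : y ∈ segment ℝ (pos u v σ) (pos u v τ)) :
    ∃ r, 0 < r ∧ r < 1 ∧ y = pos u v r := by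
  obtain ⟨t, h0, h1, rfl⟩ := mem_segment_iff.1 hy
  refine ⟨σ + t * (τ - σ), by nlinarith, by nlinarith, by simp only [pos]; module⟩

/-- If the vertex `w` is high enough, then the triangle over a crossing-free edge is above the
rest of the knot. -/
theorem exists_height {u v : Space} {m : List Space} {p : Plane}
    (hfree : ∀ x ∈ hseg u v, ∀ y ∈ path (v :: m) u, proj x ≠ proj y)
    (hp : area (proj u) (proj v) p ≠ 0) {σ τ : ℝ} (hσ : 0 < σ) (hστ : σ < τ) (hτ : τ < 1) :
    ∃ w : Space, proj w = p ∧ ∀ y ∈ segment ℝ (pos u v σ) (pos u v τ), ∀ r : ℝ, 0 < r → r ≤ 1 →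
      ∀ x ∈ path (u :: v :: m) u, proj x = proj (y + r • (w - y)) → x 2 < (y + r • (w - y)) 2 := by
  have huv := ne_of_area_ne_zero hp
  set U := proj u with hU
  set V := proj v with hV
  set S := segment ℝ (pos U V σ) (pos U V τ) with hS
  have hScomp : IsCompact S := by
    rw [hS, segment_eq_image_lineMap]
    exact isCompact_Icc.image AffineMap.lineMap_continuous
  have hdisj : Disjoint S (path ((v :: m).map proj) U ∪ {U}) := by
    refine Set.disjoint_left.2 fun y hy hy' => ?_
    obtain ⟨r, h0, h1, rfl⟩ := mem_hseg_of_mem_segment_pos hσ hστ hτ hy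
    rcases hy' with h | h
    · rw [hU, hV, ← proj_pos, proj_path] at h
      obtain ⟨z, hz, e⟩ := h
      exact hfree _ (pos_mem_hseg u v h0.le h1) z hz e.symm
    · exact pos_ne huv h0 h.symm
  obtain ⟨δ, hδ, hthick⟩ := hdisj.exists_thickenings hScomp (isClosed_path_union _ _)
  obtain ⟨B, hB⟩ := hScomp.exists_bound_of_continuousOn (f := fun y => p - y) (by fun_prop)
  set B' := max B 1 with hB'
  have hB'0 : 0 < B' := lt_max_of_lt_right one_pos
  obtain ⟨M, hM, hMb⟩ := exists_coordinate_bound (u :: v :: m) 2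
  set r₀ := δ / (2 * B') with hr₀
  have hr₀0 : 0 < r₀ := by positivity
  -- Up to the parameter `r₀`, the projection stays within `δ` of the base segment, away from the
  -- rest of the diagram. From `r₀` on, the height is at least `-(1 - r)M + r₀H`, which exceeds the
  -- bound `M` for the heights of the knot.
  set H := M + (2 * M + 1) / r₀ with hH
  have hH0 : r₀ * H = r₀ * M + (2 * M + 1) := by
    rw [hH, mul_add, mul_div_cancel₀ _ hr₀0.ne']
  have hHM : 0 < H := by positivity
  refine ⟨![p 0, p 1, H], by ext i; fin_cases i <;> simp [proj], ?_⟩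
  set w : Space := ![p 0, p 1, H] with hw
  have hwp : proj w = p := by ext i; fin_cases i <;> simp [proj, hw]
  intro y hy r hr0 hr1 x hx hxy
  obtain ⟨ρ, g0, g1, rfl⟩ := mem_hseg_of_mem_segment_pos hσ hστ hτ hy
  have hyh := pos_mem_hseg u v g0.le g1
  have hyS : proj (pos u v ρ) ∈ S := by
    have h1 : proj '' segment ℝ (pos u v σ) (pos u v τ) = S := by
      rw [hS, hU, hV, ← proj_pos, ← proj_pos]
      exact image_segment ℝ projL.toAffineMap _ _
    rw [← h1]; exact ⟨_, hy, rfl⟩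
  rw [proj_add_smul, hwp] at hxy
  rcases hx with hx | hx
  -- The projected line `uv` does not contain `p`, so the triangle is over it only along its base,
  -- where `r = 0`.
  · exfalso
    have h1 : proj x ∈ hseg U V := by rw [hU, hV, proj_hseg]; exact ⟨x, hx, rfl⟩
    have h2 : proj (pos u v ρ) ∈ hseg U V := by rw [hU, hV, proj_hseg]; exact ⟨_, hyh, rfl⟩
    have h3 := area_of_mem_hseg h1
    rw [hxy, area_add_smul, area_of_mem_hseg h2, zero_add, sub_zero] at h3
    exact (mul_eq_zero.1 h3).elim hr0.ne' hp
  have hx2 : |x 2| < M :=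
    abs_lt_of_mem_path (fun z hz => hMb z (List.mem_cons_of_mem _ hz)) (hMb u (by simp)) hx
  have hy2 : |pos u v ρ 2| < M :=
    abs_lt_of_mem_path (l := [u]) (e := v) (by simpa using hMb u (by simp)) (hMb v (by simp))
      (Or.inl hyh)
  by_cases hr : r ≤ r₀
  · exfalso
    have t₁ : proj x ∈ Metric.thickening δ S := by
      rw [hxy, Metric.mem_thickening_iff]
      refine ⟨_, hyS, ?_⟩
      rw [dist_eq_norm, add_sub_cancel_left, norm_smul, Real.norm_of_nonneg hr0.le]
      have h1 : ‖p - proj (pos u v ρ)‖ ≤ B' := (hB _ hyS).trans (le_max_left _ _)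
      calc r * ‖p - proj (pos u v ρ)‖ ≤ r₀ * B' := mul_le_mul hr h1 (norm_nonneg _) hr₀0.le
        _ = δ / 2 := by rw [hr₀]; field_simp
        _ < δ := by linarith
    have t₂ : proj x ∈ Metric.thickening δ (path ((v :: m).map proj) U ∪ {U}) := by
      refine Metric.self_subset_thickening hδ _ (Or.inl ?_)
      rw [hU, proj_path]; exact ⟨x, hx, rfl⟩
    exact Set.disjoint_left.1 hthick t₁ t₂
  · rw [not_le] at hr
    have h1 : (pos u v ρ + r • (w - pos u v ρ)) 2 = (1 - r) * pos u v ρ 2 + r * H := by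
      simp only [Pi.add_apply, Pi.smul_apply, Pi.sub_apply, smul_eq_mul]
      have : w 2 = H := by simp [hw]
      rw [this]; ring
    rw [h1]
    have h2 := (abs_lt.1 hx2).2
    have h3 := (abs_lt.1 hy2).1
    have h4 : r₀ * H ≤ r * H := mul_le_mul_of_nonneg_right hr.le hHM.le
    have h5 : (1 - r) * (-M) ≤ (1 - r) * pos u v ρ 2 :=
      mul_le_mul_of_nonneg_left h3.le (by linarith)
    have h6 : 0 < r * M := by positivity
    have h7 : 0 < r₀ * M := by positivity
    linarith

/-- The part of the triangle off its base is strictly above every point of the knot with the same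
projection, so the knot meets the triangle in the base only and the `Δ`-move is admissible. -/
theorem isotopic_apex {u v w : Space} {m : List Space} (h : IsSimple (u :: v :: m)) {σ : ℝ}
    (h0 : 0 < σ) (h1 : 2 * σ < 1) (hw : area (proj u) (proj v) (proj w) ≠ 0)
    (habove : ∀ y ∈ segment ℝ (pos u v σ) (pos u v (2 * σ)), ∀ r : ℝ, 0 < r → r ≤ 1 →
      ∀ x ∈ path (u :: v :: m) u, proj x = proj (y + r • (w - y)) → x 2 < (y + r • (w - y)) 2) :
    Isotopic (u :: v :: m) (pos u v σ :: w :: pos u v (2 * σ) :: v :: (m ++ [u])) := by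
  have hi := isotopic_cut h h0 h1
  have hs := hi.isSimple_iff.1 h
  refine hi.trans (isotopic_insert hs (fun t e => ?_) fun x hx hx' => ?_)
  · have e1 : w = pos u v (σ + t * σ) := by rw [← e]; simp only [pos]; module
    rw [e1, proj_pos, pos, area_add_smul, area_self, area_self'] at hw
    simp at hw
  · obtain ⟨a, b, ha, hb, hab, rfl⟩ := mem_triangle hx
    rcases hb.lt_or_eq with hb0 | rfl
    · exfalso
      -- The position of the base point from which the given point is seen in the direction of `w`.
      -- At the apex `b = 1`, and the quotient takes the harmless default value `0`.
      set ρ := a / (1 - b) with hρ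
      have hρa : (1 - b) * ρ = a := by
        by_cases hb1 : 1 - b = 0
        · rw [hb1, zero_mul]; linarith
        · rw [hρ, mul_div_cancel₀ _ hb1]
      have hρ0 : 0 ≤ ρ := div_nonneg ha (by linarith)
      have hρ1 : ρ ≤ 1 := div_le_one_of_le₀ (by linarith) (by linarith)
      set y := pos u v σ + ρ • (pos u v (2 * σ) - pos u v σ) with hy
      have hx2 : pos u v σ + a • (pos u v (2 * σ) - pos u v σ) + b • (w - pos u v σ) =
          y + b • (w - y) := by
        rw [hy, ← hρa]; module
      rw [hx2] at hx'
      refine lt_irrefl _ (habove y (mem_segment_iff.2 ⟨ρ, hρ0, hρ1, hy⟩) b hb0 (by linarith) _ ?_ rfl)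
      have e1 := path_append (v :: m) [] u (pos u v σ)
      rw [List.cons_append] at e1
      rw [path_cons, start_cons, e1] at hx'
      rcases hx' with hx' | hx' | hx' | hx'
      · have := hseg_pos_subset u v (s := 2 * σ) (t := 1) (by linarith) h1 le_rfl
        rw [pos_one] at this
        exact Or.inl (this hx')
      · exact Or.inr hx'
      · have := hseg_pos_subset u v (s := 0) (t := σ) le_rfl h0 (by linarith)
        rw [pos_zero] at this
        exact Or.inl (this hx')
      · exact absurd hx' (by simp)
    · rw [zero_smul, add_zero] at hx' ⊢
      rw [isSimple_cons_iff, simplePath_cons] at hs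
      by_contra hne
      refine Set.disjoint_left.1 hs.2.2 (mem_hseg.2 ⟨a, ha, lt_of_le_of_ne (by linarith) ?_, rfl⟩) hx'
      rintro rfl
      exact hne (by module)

theorem area_of_mem_hseg_left {a p x : Plane} (h : x ∈ hseg a p) : area a x p = 0 := by
  obtain ⟨t, -, -, rfl⟩ := mem_hseg.1 h
  simp only [area, Pi.add_apply, Pi.smul_apply, Pi.sub_apply, smul_eq_mul]; ring

theorem area_of_mem_hseg_right {a p x : Plane} (h : x ∈ hseg p a) : area a x p = 0 := by
  obtain ⟨t, -, -, rfl⟩ := mem_hseg.1 h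
  simp only [area, Pi.add_apply, Pi.smul_apply, Pi.sub_apply, smul_eq_mul]; ring

/-- By genericity the new edges pass through no other vertex and no old double point, and they are
disjoint from each other. So each of their points other than `s₁` is passed at most once by the old
polygon. -/
theorem isRegular_apex {u v p : Plane} {m : List Plane} (hreg : IsRegular (u :: v :: m))
    (hfree : ∀ x ∈ hseg u v, x ∉ path (v :: m) u) {σ : ℝ} (h0 : 0 < σ) (h1 : 2 * σ < 1)
    (hp : ∀ z ∈ u :: v :: m, z 0 < p 0)
    (hgen₁ : ∀ z, z ∈ pos u v (2 * σ) :: u :: v :: m ∨ 2 ≤ passes (u :: v :: m) u z →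
      z ≠ pos u v σ → area (pos u v σ) z p ≠ 0)
    (hgen₂ : ∀ z, z ∈ pos u v σ :: u :: v :: m ∨ 2 ≤ passes (u :: v :: m) u z →
      z ≠ pos u v (2 * σ) → area (pos u v (2 * σ)) z p ≠ 0) :
    IsRegular (pos u v σ :: p :: pos u v (2 * σ) :: v :: (m ++ [u])) := by
  have huv := hreg.head_ne
  have hR := isRegular_iff.1 hreg
  rw [start_cons] at hR
  have hcut := passes_cut huv h0 h1 m
  set s₁ := pos u v σ with hs₁
  set s₂ := pos u v (2 * σ) with hs₂
  have hs₁₂ : s₂ ≠ s₁ := by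
    intro e
    have : σ • (v - u) = 0 := by
      have : s₂ - s₁ = σ • (v - u) := by rw [hs₁, hs₂]; simp only [pos]; module
      rw [← this, e, sub_self]
    exact (smul_eq_zero.1 this).elim h0.ne' (sub_ne_zero.2 huv.symm)
  have harea : area s₁ p s₂ ≠ 0 := by
    rw [← area_rotate, ← area_rotate, ← neg_ne_zero, ← area_swap]
    exact hgen₁ s₂ (Or.inl (by simp)) hs₁₂
  have hdisj := disjoint_hseg_of_area_ne_zero harea
  have hs₁m : s₁ ∈ hseg u v := pos_mem_hseg u v h0.le (by linarith)
  have hs₂m : s₂ ∈ hseg u v := pos_mem_hseg u v (by linarith) h1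
  have hone : ∀ x ∈ hseg u v, passes (u :: v :: m) u x = 1 := by
    intro x hx
    rw [passes_cons, start_cons, through_of_mem hx, passes_eq_zero.2 (hfree x hx)]
  have hvert : ∀ z ∈ u :: v :: m, z ≠ s₁ ∧ z ≠ s₂ := by
    intro z hz
    rcases List.mem_cons.1 hz with rfl | hz
    · exact ⟨pos_ne huv h0, pos_ne huv (by linarith)⟩
    · constructor <;> rintro rfl
      · exact hfree _ hs₁m (mem_path_of_mem hz)
      · exact hfree _ hs₂m (mem_path_of_mem hz)
  set R : Plane → ℕ := passes (s₂ :: v :: (m ++ [u])) s₁ with hRdef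
  have hRle : ∀ x, through (hseg s₁ s₂) x + R x = passes (u :: v :: m) u x := fun x => by
    rw [← hcut, passes_cons]; rfl
  have new₁ : ∀ x ∈ hseg s₁ p, x ≠ s₁ → passes (u :: v :: m) u x ≤ 1 ∧ x ∉ u :: v :: m := by
    intro x hx hne
    refine ⟨?_, fun hmem => hgen₁ x (Or.inl (by simp at hmem ⊢; tauto)) hne (area_of_mem_hseg_left hx)⟩
    by_contra hc
    exact hgen₁ x (Or.inr (by omega)) hne (area_of_mem_hseg_left hx)
  have hs₂p : s₂ ∉ hseg p s₂ := right_notMem_hseg (by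
    rintro rfl; rw [area_self'] at harea; exact harea rfl)
  have new₂ : ∀ x ∈ hseg p s₂, passes (u :: v :: m) u x ≤ 1 ∧ x ∉ u :: v :: m := by
    intro x hx
    have hne : x ≠ s₂ := by rintro rfl; exact hs₂p hx
    refine ⟨?_, fun hmem => hgen₂ x (Or.inl (by simp at hmem ⊢; tauto)) hne (area_of_mem_hseg_right hx)⟩
    by_contra hc
    exact hgen₂ x (Or.inr (by omega)) hne (area_of_mem_hseg_right hx)
  have hRs₁ : R s₁ = 0 := by
    have := hRle s₁
    rw [hone _ hs₁m, through_of_mem (left_mem_hseg _ _)] at this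
    omega
  have hsum : ∀ x, passes (s₁ :: p :: s₂ :: v :: (m ++ [u])) s₁ x =
      through (hseg s₁ p) x + through (hseg p s₂) x + R x := fun x => by
    rw [passes_cons, passes_cons]; simp only [start_cons]; rw [add_assoc]
  have hnew : ∀ x, through (hseg s₁ p) x + through (hseg p s₂) x ≤ 1 := by
    intro x
    by_cases hx : x ∈ hseg s₁ p
    · rw [through_of_notMem fun hx' => Set.disjoint_left.1 hdisj hx hx']
      exact through_le_one _ _
    · rw [through_of_notMem hx, zero_add]; exact through_le_one _ _
  rw [isRegular_iff, start_cons]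
  refine ⟨by simp, fun x => ?_, fun z hz => ?_⟩
  · rw [hsum]
    have h2 := hnew x
    have h3 := hRle x
    have h4 := hR.2.1 x
    by_cases e : x = s₁
    · rw [e] at h2 ⊢; omega
    by_cases hx : x ∈ hseg s₁ p
    · have := (new₁ x hx e).1; omega
    by_cases hx' : x ∈ hseg p s₂
    · have := (new₂ x hx').1; omega
    rw [through_of_notMem hx, through_of_notMem hx']; omega
  · rw [hsum]
    have h2 := hnew z
    have h3 := hRle z
    have hold : z ∈ u :: v :: m → through (hseg s₁ p) z + through (hseg p s₂) z + R z ≤ 1 := by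
      intro hz
      rw [through_of_notMem fun h => (new₁ z h (hvert z hz).1).2 hz,
        through_of_notMem fun h => (new₂ z h).2 hz]
      have := hR.2.2 z hz; omega
    simp only [List.mem_cons, List.mem_append, List.not_mem_nil, or_false] at hz hold
    rcases hz with rfl | rfl | rfl | hz
    · omega
    -- The apex is extremal in the first coordinate, so the old polygon does not pass through it.
    · have hRp : R z = 0 := by
        by_contra hc
        have h5 : z ∈ path (u :: v :: m) u := by rw [mem_path_iff]; omega
        have h6 : path (u :: v :: m) u ⊆ {x | x 0 < z 0} :=
          path_subset_convex (convex_halfSpace_lt (LinearMap.proj 0 : Plane →ₗ[ℝ] ℝ).isLinear _) hp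
            (hp u (by simp))
        exact lt_irrefl _ (show z 0 < z 0 from h6 h5)
      omega
    · have h5 : s₂ ∉ hseg s₁ p := fun h => harea (by
        rw [← area_rotate, ← area_rotate, ← neg_eq_zero, ← area_swap, area_of_mem_hseg_left h])
      rw [through_of_notMem h5, through_of_notMem hs₂p]
      have := hone _ hs₂m; omega
    · exact hold (by tauto)

end KnotTheory


/-! ### The extremal arc of the second summand -/

namespace KnotTheory

/-- The forbidden positions form finitely many lines, while the apex may vary in a half-plane. -/
theorem exists_generic_apex {u v : Plane} {m : List Plane} (hreg : IsRegular (u :: v :: m)) (σ : ℝ) :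
    ∃ (p : Plane) (c : ℝ), c < p 0 ∧ (∀ z ∈ u :: v :: m, z 0 < c) ∧ area u v p ≠ 0 ∧
      (∀ z, z ∈ pos u v (2 * σ) :: u :: v :: m ∨ 2 ≤ passes (u :: v :: m) u z →
        z ≠ pos u v σ → area (pos u v σ) z p ≠ 0) ∧
      ∀ z, z ∈ pos u v σ :: u :: v :: m ∨ 2 ≤ passes (u :: v :: m) u z →
        z ≠ pos u v (2 * σ) → area (pos u v (2 * σ)) z p ≠ 0 := by
  obtain ⟨c, hc, hcb⟩ := exists_coordinate_bound (u :: v :: m) 0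
  have hD : ({z | z ∈ pos u v σ :: pos u v (2 * σ) :: u :: v :: m} ∪
      {z | 2 ≤ passes (u :: v :: m) u z}).Finite :=
    (List.finite_toSet _).union hreg.finite_double
  obtain ⟨p, hp, hS⟩ := exists_mem_ne_zero (O := {p : Plane | c < p 0})
    (isOpen_lt continuous_const (continuous_apply 0)) ⟨fun _ => c + 1, by simp⟩
    (((Set.finite_singleton (areaMap u v)).union (hD.image (areaMap (pos u v σ)))).union
      (hD.image (areaMap (pos u v (2 * σ)))))
  refine ⟨p, c, hp, fun z hz => (abs_lt.1 (hcb z hz)).2, ?_, fun z hz hne => ?_, fun z hz hne => ?_⟩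
  · exact hS _ (Or.inl (Or.inl rfl)) (exists_area_ne_zero hreg.head_ne)
  · refine hS _ (Or.inl (Or.inr ⟨z, ?_, rfl⟩)) (exists_area_ne_zero hne.symm)
    exact hz.imp (fun h => by rw [Set.mem_ofPred_eq]; simp at h ⊢; tauto) id
  · refine hS _ (Or.inr ⟨z, ?_, rfl⟩) (exists_area_ne_zero hne.symm)
    exact hz.imp (fun h => by rw [Set.mem_ofPred_eq]; simp at h ⊢; tauto) id

/-- The two pieces at the apex come first in the order and lie above the old polygon, so they are
never the lower strand at a first encounter; their projections do not cross each other. The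
remaining pieces of `uv` have no crossings. What is left is the order of the old diagram. -/
theorem bad_apex_subset {u v w : Space} {m : List Space} {σ θ τ : ℝ} (h0 : 0 < σ) (h1 : 2 * σ < 1)
    (huv : proj u ≠ proj v)
    (hfree : ∀ x ∈ hseg u v, ∀ y ∈ path (v :: m) u, proj x ≠ proj y)
    (habove : ∀ y ∈ segment ℝ (pos u v σ) (pos u v (2 * σ)), ∀ r : ℝ, 0 < r → r ≤ 1 →
      ∀ x ∈ path (u :: v :: m) u, proj x = proj (y + r • (w - y)) → x 2 < (y + r • (w - y)) 2)
    (harea : area (proj (pos u v σ)) (proj w) (proj (pos u v (2 * σ))) ≠ 0)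
    (hθ0 : 0 < θ) (hθ1 : θ ≤ 1) (hτ0 : 0 ≤ τ) (hτ1 : τ < 1) :
    bad ((pos u v σ, pos (pos u v σ) w θ) ::
      edges (pos w (pos u v (2 * σ)) τ :: pos u v (2 * σ) :: v :: (m ++ [u])) (pos u v σ)) ⊆
      bad (edges (v :: m) u) := by
  set s₁ := pos u v σ with hs₁
  set s₂ := pos u v (2 * σ) with hs₂
  have e1 : edges (pos w s₂ τ :: s₂ :: v :: (m ++ [u])) s₁ =
      (pos w s₂ τ, s₂) :: (s₂, v) :: (edges (v :: m) u ++ [(u, s₁)]) := by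
    have := edges_append (v :: m) [] u s₁
    rw [List.cons_append] at this
    rw [edges_cons, edges_cons, this]; simp
  have hd := disjoint_hseg_of_area_ne_zero harea
  have a₁ : ∀ x ∈ openSegment ℝ s₁ (pos s₁ w θ), ∀ y ∈ path (u :: v :: m) u, proj x = proj y →
      y 2 < x 2 := by
    intro x hx y hy hxy
    obtain ⟨t, g0, g1, e⟩ := Tangle.mem_openSegment_iff.1 hx
    have e2 : x = s₁ + (t * θ) • (w - s₁) := by rw [e]; simp only [pos]; module
    rw [e2] at hxy ⊢
    exact habove s₁ (left_mem_segment _ _ _) _ (by positivity) (by nlinarith) y hy hxy.symm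
  have a₂ : ∀ x ∈ openSegment ℝ (pos w s₂ τ) s₂, ∀ y ∈ path (u :: v :: m) u, proj x = proj y →
      y 2 < x 2 := by
    intro x hx y hy hxy
    obtain ⟨t, g0, g1, e⟩ := Tangle.mem_openSegment_iff.1 hx
    have e2 : x = s₂ + ((1 - τ) * (1 - t)) • (w - s₂) := by rw [e]; simp only [pos]; module
    rw [e2] at hxy ⊢
    exact habove s₂ (right_mem_segment _ _ _) _ (mul_pos (by linarith) (by linarith))
      (by nlinarith) y hy hxy.symm
  have o₂ : openSegment ℝ s₂ v ⊆ hseg u v := by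
    have := hseg_pos_subset u v (s := 2 * σ) (t := 1) (by linarith) h1 le_rfl
    rw [pos_one] at this
    exact (openSegment_subset_hseg _ _).trans this
  have o₁ : openSegment ℝ u s₁ ⊆ hseg u v := by
    have := hseg_pos_subset u v (s := 0) (t := σ) le_rfl h0 (by linarith)
    rw [pos_zero] at this
    exact (openSegment_subset_hseg _ _).trans this
  have hold : ∀ t ∈ (s₂, v) :: (edges (v :: m) u ++ [(u, s₁)]),
      openSegment ℝ t.1 t.2 ⊆ path (u :: v :: m) u := by
    intro t ht
    simp only [List.mem_cons, List.mem_append, List.not_mem_nil, or_false] at ht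
    rcases ht with rfl | ht | rfl
    · exact o₂.trans Set.subset_union_left
    · exact (openSegment_subset_path ht).trans Set.subset_union_right
    · exact o₁.trans Set.subset_union_left
  rintro ⟨x, y⟩ ⟨s, t, hst, hx, hy, hxy, hlt⟩
  dsimp only at hx hy hxy hlt
  rw [e1, pair_sublist_cons_iff, pair_sublist_cons_iff, pair_sublist_cons_iff,
    pair_sublist_append_iff, List.mem_cons, List.mem_append, List.mem_singleton] at hst
  rcases hst with ⟨rfl, rfl | ht⟩ | ⟨rfl, ht⟩ | ⟨rfl, ht | rfl⟩ | hst | ⟨hs, ht⟩ | hst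
  · exfalso
    have t₁ : proj x ∈ hseg (proj s₁) (proj w) := by
      rw [proj_hseg]
      have := hseg_pos_subset s₁ w (s := 0) (t := θ) le_rfl hθ0 hθ1
      rw [pos_zero] at this
      exact ⟨x, this (openSegment_subset_hseg _ _ hx), rfl⟩
    have t₂ : proj x ∈ hseg (proj w) (proj s₂) := by
      rw [hxy, proj_hseg]
      have := hseg_pos_subset w s₂ (s := τ) (t := 1) hτ0 hτ1 le_rfl
      rw [pos_one] at this
      exact ⟨y, this (openSegment_subset_hseg _ _ hy), rfl⟩
    exact Set.disjoint_left.1 hd t₁ t₂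
  · exact absurd (a₁ x hx y (hold t ht hy) hxy) hlt.not_gt
  · exact absurd (a₂ x hx y (hold t ht hy) hxy) hlt.not_gt
  · exact absurd hxy (hfree x (o₂ hx) y (openSegment_subset_path ht hy))
  · rw [proj_injOn_hseg huv (o₂ hx) (o₁ hy) hxy] at hlt
    exact absurd hlt (lt_irrefl _)
  · exact ⟨s, t, hst, hx, hy, hxy, hlt⟩
  · subst ht
    exact absurd hxy.symm (hfree y (o₁ hy) x (openSegment_subset_path hs hx))
  · exact absurd hst.length_le (by simp)

theorem passes_arc_le {E : Type*} [AddCommGroup E] [Module ℝ E] {a p b P Q : E}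
    (hP : P ∈ openSegment ℝ a p) (hQ : Q ∈ openSegment ℝ p b) (ha : a ≠ p) (hb : p ≠ b)
    (l : List E) (x : E) : passes (Q :: (b :: l ++ [a])) P x ≤ passes (a :: p :: b :: l) a x := by
  have e1 := passes_append (Q :: b :: l) [] a P x
  have e2 := passes_subdivide hP ha (b :: l) a x
  have e3 := passes_subdivide hQ hb l a x
  have g1 : passes (a :: P :: p :: b :: l) a x =
      through (hseg a P) x + (through (hseg P p) x + passes (p :: b :: l) a x) := rfl
  have g2 : passes (p :: Q :: b :: l) a x =
      through (hseg p Q) x + passes (Q :: b :: l) a x := rfl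
  have g3 : passes [a] P x = through (hseg a P) x := by simp
  rw [List.cons_append] at e1
  omega

/-- An arc that represents the knot, has an extremal position with respect to the first
coordinate, and has no more bad pairs than the given polygon. -/
theorem exists_extremal_tangle {u v : Space} {m : List Space} (h : IsSimple (u :: v :: m))
    (hreg : IsRegular ((u :: v :: m).map proj))
    (hfree : ∀ x ∈ hseg u v, ∀ y ∈ path (v :: m) u, proj x ≠ proj y) :
    ∃ (T : Tangle) (w e : Space) (C : List Space), T.f = LinearMap.proj 0 ∧ T.B = C ++ [e] ∧
      T.f T.Q < T.f w ∧ Isotopic (w :: T.verts) (u :: v :: m) ∧ proj T.Q ≠ proj T.P ∧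
      (∀ x, passes ((T.Q :: T.B).map proj) (proj T.P) x ≤ 2) ∧
      (∀ z ∈ T.Q :: T.B, passes ((T.Q :: T.B).map proj) (proj T.P) (proj z) ≤ 1) ∧
      bad ((e, T.P) :: edges (T.Q :: C) e) ⊆ bad (edges (v :: m) u) := by
  have hreg' := hreg
  rw [List.map_cons, List.map_cons] at hreg'
  have huv := hreg'.head_ne
  set σ : ℝ := 1 / 3 with hσ
  have h0 : 0 < σ := by norm_num [hσ]
  have h1 : 2 * σ < 1 := by norm_num [hσ]
  obtain ⟨p, c, hcp, hcb, harea, hgen₁, hgen₂⟩ := exists_generic_apex hreg' σ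
  obtain ⟨w, hwp, habove⟩ := exists_height hfree harea h0 (by linarith) h1
  have hfree' : ∀ x ∈ hseg (proj u) (proj v), x ∉ path (proj v :: m.map proj) (proj u) := by
    intro x hx hx'
    rw [proj_hseg] at hx
    rw [← List.map_cons, proj_path] at hx'
    obtain ⟨y, hy, rfl⟩ := hx
    obtain ⟨z, hz, e⟩ := hx'
    exact hfree y hy z hz e.symm
  have hregW := isRegular_apex hreg' hfree' h0 h1 (fun z hz => (hcb z hz).trans hcp) hgen₁ hgen₂
  have hiW := isotopic_apex h h0 h1 (by rwa [hwp]) habove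
  have hsW := hiW.isSimple_iff.1 h
  set s₁ := pos u v σ with hs₁
  set s₂ := pos u v (2 * σ) with hs₂
  have hcut := hregW.finite_double
  have hareaW : area (proj s₁) (proj w) (proj s₂) ≠ 0 := by
    rw [← area_rotate, ← area_rotate, ← neg_ne_zero, ← area_swap, hs₁, hs₂, proj_pos, proj_pos, hwp]
    refine hgen₁ _ (Or.inl (by simp)) fun e => ?_
    have : σ • (proj v - proj u) = 0 := by
      have : pos (proj u) (proj v) (2 * σ) - pos (proj u) (proj v) σ = σ • (proj v - proj u) := by
        simp only [pos]; module
      rw [← this, e, sub_self]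
    exact (smul_eq_zero.1 this).elim h0.ne' (sub_ne_zero.2 huv.symm)
  -- first coordinates
  have hc3 : ∀ z ∈ u :: v :: m, z 0 < c := by
    intro z hz
    have := hcb (proj z) (by rw [← List.map_cons, ← List.map_cons]; exact List.mem_map_of_mem hz)
    simpa [proj] using this
  have hcs : ∀ t, 0 ≤ t → t < 1 → pos u v t 0 < c := by
    intro t g0 g1
    have h3 := hc3 u (by simp)
    have h4 := hc3 v (by simp)
    simp only [pos, Pi.add_apply, Pi.smul_apply, Pi.sub_apply, smul_eq_mul]
    nlinarith
  have hc1 : s₁ 0 < c := hcs σ h0.le (by linarith)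
  have hc2 : s₂ 0 < c := hcs (2 * σ) (by linarith) h1
  have hw0 : w 0 = p 0 := by rw [← hwp]; simp [proj]
  -- the level of the end points
  obtain ⟨ε, ⟨hε0, hε1⟩, hεD⟩ := (Set.Ioo_infinite (sub_pos.2 hcp)).exists_notMem_finite
    (hcut.image fun z => p 0 - z 0)
  -- These parameters put `P` and `Q`, on the two edges at `w`, at the same first coordinate `p 0 -
  -- ε`. The choice of `ε` avoids the levels of the finitely many double points, so that `Q` does
  -- not project to one.
  set θ := ε / (p 0 - s₁ 0) with hθ
  set τ := ε / (p 0 - s₂ 0) with hτ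
  have hθ0 : 0 < θ := div_pos hε0 (by linarith)
  have hθ1 : θ < 1 := (div_lt_one (by linarith)).2 (by linarith)
  have hτ0 : 0 < τ := div_pos hε0 (by linarith)
  have hτ1 : τ < 1 := (div_lt_one (by linarith)).2 (by linarith)
  set P := pos s₁ w (1 - θ) with hP
  set Q := pos w s₂ τ with hQ
  have hP0 : P 0 = p 0 - ε := by
    have : θ * (p 0 - s₁ 0) = ε := div_mul_cancel₀ _ (by linarith)
    simp only [hP, pos, Pi.add_apply, Pi.smul_apply, Pi.sub_apply, smul_eq_mul, hw0]
    linear_combination -this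
  have hQ0 : Q 0 = p 0 - ε := by
    have : τ * (p 0 - s₂ 0) = ε := div_mul_cancel₀ _ (by linarith)
    simp only [hQ, pos, Pi.add_apply, Pi.smul_apply, Pi.sub_apply, smul_eq_mul, hw0]
    linear_combination -this
  have oP : P ∈ openSegment ℝ s₁ w := pos_mem_openSegment' _ _ (by linarith) (by linarith)
  have oQ : Q ∈ openSegment ℝ w s₂ := pos_mem_openSegment' _ _ hτ0 hτ1
  have hPQ : proj Q ≠ proj P := by
    intro e
    have t₁ : proj P ∈ hseg (proj s₁) (proj w) := by
      rw [proj_hseg]; exact ⟨P, openSegment_subset_hseg _ _ oP, rfl⟩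
    have t₂ : proj P ∈ hseg (proj w) (proj s₂) := by
      rw [← e, proj_hseg]; exact ⟨Q, openSegment_subset_hseg _ _ oQ, rfl⟩
    exact Set.disjoint_left.1 (disjoint_hseg_of_area_ne_zero hareaW) t₁ t₂
  -- subdivisions
  have i1 : Isotopic (s₁ :: w :: s₂ :: v :: (m ++ [u])) (s₁ :: w :: Q :: s₂ :: v :: (m ++ [u])) :=
    isotopic_subdivide_append (l₁ := [s₁]) hsW oQ
  have i2 := isotopic_subdivide (i1.isSimple_iff.1 hsW) oP
  have hs2 := i2.isSimple_iff.1 (i1.isSimple_iff.1 hsW)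
  have i3 : Isotopic (s₁ :: P :: w :: Q :: s₂ :: v :: (m ++ [u]))
      (w :: Q :: s₂ :: v :: (m ++ [u]) ++ [s₁, P]) := isotopic_append_comm (l₁ := [s₁, P]) hs2
  have hs3 := i3.isSimple_iff.1 hs2
  have hB : ∀ z ∈ s₂ :: v :: (m ++ [u]) ++ [s₁], z 0 < c := by
    intro z hz
    simp only [List.cons_append, List.mem_cons, List.mem_append, List.not_mem_nil, or_false] at hz
    rcases hz with rfl | rfl | (hz | rfl) | rfl
    · exact hc2
    · exact hc3 _ (by simp)
    · exact hc3 _ (by simp [hz])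
    · exact hc3 _ (by simp)
    · exact hc1
  have hverts : w :: Q :: s₂ :: v :: (m ++ [u]) ++ [s₁, P] =
      w :: ((Q :: (s₂ :: v :: (m ++ [u]) ++ [s₁])) ++ [P]) := by simp
  let T : Tangle :=
    { f := LinearMap.proj 0, Q := Q, B := s₂ :: v :: (m ++ [u]) ++ [s₁], P := P
      level := by simp only [LinearMap.proj_apply]; rw [hP0, hQ0]
      below := fun z hz => by
        simp only [LinearMap.proj_apply]; rw [hQ0]; linarith [hB z hz]
      ne_nil := by simp
      simple := by
        rw [hverts, isSimple_cons_iff, List.cons_append, simplePath_cons, ← List.cons_append,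
          simplePath_append] at hs3
        exact hs3.2.1.1
      ne := fun e => hPQ (by rw [e]) }
  have hpass : ∀ x, passes ((Q :: (s₂ :: v :: (m ++ [u]) ++ [s₁])).map proj) (proj P) x ≤
      passes ((s₁ :: w :: s₂ :: v :: (m ++ [u])).map proj) (proj s₁) x := by
    intro x
    have hoP : proj P ∈ openSegment ℝ (proj s₁) (proj w) := by
      rw [hP, proj_pos s₁ w]; exact pos_mem_openSegment' _ _ (sub_pos.2 hθ1) (sub_lt_self 1 hθ0)
    have hoQ : proj Q ∈ openSegment ℝ (proj w) (proj s₂) := by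
      rw [hQ, proj_pos w s₂]; exact pos_mem_openSegment' _ _ hτ0 hτ1
    have hne₁ : proj s₁ ≠ proj w := ne_of_area_ne_zero hareaW
    have hne₂ : proj w ≠ proj s₂ := by
      intro e; rw [e, area_self'] at hareaW; exact hareaW rfl
    have e1 : (Q :: (s₂ :: v :: (m ++ [u]) ++ [s₁])).map proj =
        proj Q :: (proj s₂ :: (v :: (m ++ [u])).map proj ++ [proj s₁]) := by simp
    rw [e1, List.map_cons, List.map_cons, List.map_cons]
    exact passes_arc_le hoP hoQ hne₁ hne₂ _ x
  have hR := isRegular_iff.1 hregW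
  have hWmap : (s₁ :: w :: s₂ :: v :: (m ++ [u])).map proj =
      pos (proj u) (proj v) σ :: p :: pos (proj u) (proj v) (2 * σ) :: proj v ::
        (m.map proj ++ [proj u]) := by
    simp [hs₁, hs₂, proj_pos, hwp]
  rw [hWmap] at hpass
  have hs₁p : proj s₁ = pos (proj u) (proj v) σ := by rw [hs₁, proj_pos]
  rw [hs₁p] at hpass
  rw [start_cons] at hR
  refine ⟨T, w, s₁, s₂ :: v :: (m ++ [u]), rfl, rfl, ?_, ?_, hPQ, fun x => ?_, fun z hz => ?_, ?_⟩
  · simp only [T, LinearMap.proj_apply]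
    rw [hQ0, hw0]; linarith
  · have e2 : w :: T.verts = w :: ((Q :: (s₂ :: v :: (m ++ [u]) ++ [s₁])) ++ [P]) := rfl
    rw [e2, ← hverts]
    exact (hiW.trans (i1.trans (i2.trans i3))).symm
  · exact (hpass x).trans (hR.2.1 x)
  · refine (hpass _).trans ?_
    rcases List.mem_cons.1 hz with rfl | hz
    · by_contra hc
      refine hεD ⟨proj Q, ?_, ?_⟩
      · rw [Set.mem_ofPred_eq, start_cons]
        change ¬ passes _ _ (proj Q) ≤ 1 at hc
        omega
      · have : proj Q 0 = Q 0 := by simp [proj]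
        simp only [this, hQ0]; ring
    · refine hR.2.2 _ ?_
      rw [← hWmap]
      refine List.mem_map_of_mem ?_
      have hz' : z ∈ s₂ :: v :: (m ++ [u]) ++ [s₁] := hz
      simp only [List.cons_append, List.mem_cons, List.mem_append, List.not_mem_nil, or_false] at hz' ⊢
      tauto
  · exact bad_apex_subset h0 h1 huv hfree habove hareaW (by linarith) (by linarith) hτ0.le hτ1

end KnotTheory


namespace KnotTheory

/-! ### The connected sum of two diagrams -/

theorem bad_map_subset (ψ : Space →ᵃ[ℝ] Space)
    (hψ : ∀ x y, proj (ψ x) = proj (ψ y) → proj x = proj y ∧ (ψ x 2 < ψ y 2 → x 2 < y 2))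
    (es : List (Space × Space)) : bad (es.map (Prod.map ψ ψ)) ⊆ Prod.map ψ ψ '' bad es := by
  rintro ⟨x, y⟩ ⟨s, t, hst, hx, hy, hxy, hlt⟩
  obtain ⟨r, hr, hr'⟩ := List.sublist_map_iff.1 hst
  obtain ⟨s', t', rfl⟩ : ∃ s' t', r = [s', t'] := by
    have := congrArg List.length hr'
    match r, this with
    | [s', t'], _ => exact ⟨s', t', rfl⟩
  simp only [List.map_cons, List.map_nil, List.cons.injEq, and_true] at hr'
  obtain ⟨rfl, rfl⟩ := hr'
  simp only [Prod.map_fst, Prod.map_snd] at hx hy hxy hlt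
  rw [← image_openSegment] at hx hy
  obtain ⟨x', hx', rfl⟩ := hx
  obtain ⟨y', hy', rfl⟩ := hy
  obtain ⟨h1, h2⟩ := hψ x' y' hxy
  exact ⟨(x', y'), ⟨s', t', hr, hx', hy', h1, h2 hlt⟩, rfl⟩

/-- A linear map that commutes with the vertical projection and a similarity of the plane. -/
noncomputable def similarity (α β κ : ℝ) : Space →ₗ[ℝ] Space :=
  Matrix.toLin' !![α, -β, 0; β, α, 0; 0, κ, 1]

theorem similarity_apply (α β κ : ℝ) (x : Space) :
    similarity α β κ x = ![α * x 0 - β * x 1, β * x 0 + α * x 1, κ * x 1 + x 2] := by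
  ext i
  fin_cases i <;>
    simp [similarity, Matrix.toLin'_apply, Matrix.mulVec, dotProduct, Fin.sum_univ_three]
  ring

theorem det_similarity (α β κ : ℝ) : LinearMap.det (similarity α β κ) = α ^ 2 + β ^ 2 := by
  rw [similarity, LinearMap.det_toLin', Matrix.det_fin_three]
  simp; ring

/-- The similarity of the plane under `similarity`, composed with translations. -/
noncomputable def planeSimilarity (α β : ℝ) (q m : Plane) : Plane →ᵃ[ℝ] Plane where
  toFun x := m + Matrix.toLin' !![α, -β; β, α] (x - q)
  linear := Matrix.toLin' !![α, -β; β, α]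
  map_vadd' p v := by simp only [vadd_eq_add, map_sub, map_add]; abel

theorem planeSimilarity_apply (α β : ℝ) (q m x : Plane) : planeSimilarity α β q m x =
    ![m 0 + (α * (x 0 - q 0) - β * (x 1 - q 1)), m 1 + (β * (x 0 - q 0) + α * (x 1 - q 1))] := by
  have : planeSimilarity α β q m x = m + Matrix.toLin' !![α, -β; β, α] (x - q) := rfl
  rw [this]
  ext i
  fin_cases i <;> simp [Matrix.toLin'_apply, dotProduct, Fin.sum_univ_two]
  ring

theorem planeSimilarity_injective {α β : ℝ} (h : 0 < α ^ 2 + β ^ 2) (q m : Plane) :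
    Function.Injective (planeSimilarity α β q m) := by
  intro x y e
  rw [planeSimilarity_apply, planeSimilarity_apply] at e
  have e0 := congrFun e 0
  have e1 := congrFun e 1
  simp only [Matrix.cons_val_zero, Matrix.cons_val_one] at e0 e1
  have h0 : (α ^ 2 + β ^ 2) * (x 0 - y 0) = 0 := by linear_combination α * e0 + β * e1
  have h1 : (α ^ 2 + β ^ 2) * (x 1 - y 1) = 0 := by linear_combination -β * e0 + α * e1
  ext i; fin_cases i
  · exact sub_eq_zero.1 ((mul_eq_zero.1 h0).resolve_left h.ne')
  · exact sub_eq_zero.1 ((mul_eq_zero.1 h1).resolve_left h.ne')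

set_option maxHeartbeats 1000000 in
/-- The projection of a polygon with an inserted arc is regular, and its bad pairs come from the
polygon and the arc, if the projection of the arc is away from the projection of the polygon. -/
theorem insert_regular {a b P Q e : Space} {l C : List Space} {ψ : Space →ᵃ[ℝ] Space}
    {φ : Plane →ᵃ[ℝ] Plane} (hφ : Function.Injective φ) (hφψ : ∀ x, proj (ψ x) = φ (proj x))
    (hψ : ∀ x y, proj (ψ x) = proj (ψ y) → proj x = proj y ∧ (ψ x 2 < ψ y 2 → x 2 < y 2))
    (hreg : IsRegular ((a :: b :: l).map proj))
    (hfree : ∀ x ∈ hseg a b, ∀ y ∈ path (b :: l) a, proj x ≠ proj y)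
    {σ τ : ℝ} (hσ : 0 < σ) (hστ : σ < τ) (hτ : τ < 1) (hQ : ψ Q = pos a b σ) (hP : ψ P = pos a b τ)
    (hPQ : proj Q ≠ proj P)
    (hle : ∀ x, passes ((Q :: (C ++ [e])).map proj) (proj P) x ≤ 2)
    (hvert : ∀ z ∈ Q :: (C ++ [e]), passes ((Q :: (C ++ [e])).map proj) (proj P) (proj z) ≤ 1)
    (hside : ∀ z ∈ path (Q :: (C ++ [e])) P, area (proj a) (proj b) (proj (ψ z)) = 0 → z = Q)
    (hfar : ∀ z ∈ path (Q :: (C ++ [e])) P, proj (ψ z) ∉ path ((b :: l).map proj) (proj a)) :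
    IsRegular ((ψ e :: ψ P :: b :: l ++ a :: ψ Q :: C.map ψ).map proj) ∧
      bad (edges (ψ e :: ψ P :: b :: l ++ a :: ψ Q :: C.map ψ) (ψ e)) ⊆
        bad (edges (b :: l) a) ∪ Prod.map ψ ψ '' bad ((e, P) :: edges (Q :: C) e) := by
  have hreg' := hreg
  rw [List.map_cons, List.map_cons] at hreg'
  have hab := hreg'.head_ne
  have hab' : a ≠ b := fun h => hab (by rw [h])
  have hinj := proj_injOn_hseg hab
  have sub₁ : hseg a (ψ Q) ⊆ hseg a b := by
    have := hseg_pos_subset a b le_rfl hσ (by linarith)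
    rwa [pos_zero, ← hQ] at this
  have sub₂ : hseg (ψ P) b ⊆ hseg a b := by
    have := hseg_pos_subset a b (by linarith) hτ le_rfl
    rwa [pos_one, ← hP] at this
  have hQm : ψ Q ∈ hseg a b := hQ ▸ pos_mem_hseg a b hσ.le (by linarith)
  have hPm : ψ P ∈ hseg a b := hP ▸ pos_mem_hseg a b (by linarith) hτ
  have hQ₁ : ψ Q ∉ hseg a (ψ Q) := right_notMem_hseg (hQ ▸ pos_ne hab' hσ)
  have hQ₂ : ψ Q ∉ hseg (ψ P) b := by
    have h1 := pos_one a b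
    intro h
    rw [hP] at h
    nth_rewrite 2 [← h1] at h
    obtain ⟨r, hr, -, h⟩ := exists_of_mem_hseg_pos hτ h
    rw [hQ, pos, pos, add_right_inj] at h
    have := smul_left_injective ℝ (sub_ne_zero.2 hab'.symm) h
    linarith
  -- points of the arc and of the polygon have different projections
  have hmixed : ∀ z ∈ path (Q :: (C ++ [e])) P, ∀ y, y ∈ hseg (ψ P) b ∨ y ∈ path (b :: l) a ∨
      y ∈ hseg a (ψ Q) → proj (ψ z) ≠ proj y := by
    have key : ∀ z ∈ path (Q :: (C ++ [e])) P, ∀ y ∈ hseg a b, proj (ψ z) = proj y → ψ Q = y := by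
      intro z hz y hy hzy
      have h1 : z = Q := hside z hz (by
        rw [hzy]; exact area_of_mem_hseg (by rw [proj_hseg]; exact ⟨y, hy, rfl⟩))
      subst h1
      exact hinj hQm hy hzy
    rintro z hz y (hy | hy | hy) hzy
    · exact hQ₂ (key z hz y (sub₂ hy) hzy ▸ hy)
    · refine hfar z hz ?_
      rw [hzy, proj_path]; exact ⟨y, hy, rfl⟩
    · exact hQ₁ (key z hz y (sub₁ hy) hzy ▸ hy)
  constructor
  -- `A` counts the passes of the arc and `G` those of the remaining polygon. They are never both
  -- positive, so the bounds can be checked for each separately.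
  · set A : Plane → ℕ := passes (((Q :: (C ++ [e])).map proj).map φ) (φ (proj P)) with hA
    set G : Plane → ℕ := fun x => through (hseg (proj (ψ P)) (proj b)) x +
      passes ((b :: l).map proj) (proj a) x + through (hseg (proj a) (proj (ψ Q))) x with hG
    have hAe : ∀ x, A x = passes ((ψ Q :: C.map ψ).map proj) (proj (ψ e)) x +
        through (hseg (proj (ψ e)) (proj (ψ P))) x := by
      intro x
      have h1 : ((Q :: (C ++ [e])).map proj).map φ = (ψ Q :: C.map ψ).map proj ++ [proj (ψ e)] := by
        simp [hφψ, Function.comp_def]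
      rw [hA, h1, passes_append, ← hφψ]; simp
    have hsum : ∀ x, passes ((ψ e :: ψ P :: b :: l ++ a :: ψ Q :: C.map ψ).map proj)
        (proj (ψ e)) x = A x + G x := by
      intro x
      have h1 : (ψ e :: ψ P :: b :: l ++ a :: ψ Q :: C.map ψ).map proj =
          (proj (ψ e) :: proj (ψ P) :: (b :: l).map proj) ++ proj a :: (ψ Q :: C.map ψ).map proj := by
        simp
      rw [h1, passes_append, passes_cons, passes_cons, passes_cons (proj a), hAe]
      simp only [hG, List.map_cons, start_cons]
      ring
    have hGU : ∀ x, G x ≤ passes ((a :: b :: l).map proj) (proj a) x := by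
      intro x
      have oQ : proj (ψ Q) ∈ openSegment ℝ (proj a) (proj b) := by
        rw [hQ, proj_pos]; exact pos_mem_openSegment' _ _ hσ (by linarith)
      have oP : proj (ψ P) ∈ openSegment ℝ (proj (ψ Q)) (proj b) := by
        rw [hP, hQ, proj_pos, proj_pos]
        refine Tangle.mem_openSegment_iff.2 ⟨(τ - σ) / (1 - σ),
          div_pos (by linarith) (by linarith), (div_lt_one (by linarith)).2 (by linarith), ?_⟩
        have h1 : proj b - pos (proj a) (proj b) σ = (1 - σ) • (proj b - proj a) := by
          simp only [pos]; module
        rw [h1, smul_smul, div_mul_cancel₀ _ (by linarith)]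
        simp only [pos]; module
      have hne : proj (ψ Q) ≠ proj b := by
        have := pos_ne (a := proj b) (b := proj a) hab.symm (t := 1 - σ) (by linarith)
        rw [hQ, proj_pos]
        exact fun h => this (h.symm.trans (by simp only [pos]; module))
      have h2 : passes ((a :: b :: l).map proj) (proj a) x =
          through (hseg (proj a) (proj b)) x + passes ((b :: l).map proj) (proj a) x := rfl
      rw [h2, through_hseg_subdivide oQ hab, through_hseg_subdivide oP hne]
      simp only [hG]; omega
    have hR := isRegular_iff.1 hreg
    simp only [List.map_cons, start_cons] at hR
    have hAmem : ∀ x, 0 < A x → ∃ z ∈ path (Q :: (C ++ [e])) P, x = proj (ψ z) := by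
      intro x hx
      rw [hA, ← mem_path_iff, path_map, proj_path] at hx
      obtain ⟨_, ⟨z, hz, rfl⟩, rfl⟩ := hx
      exact ⟨z, hz, (hφψ z).symm⟩
    have hGmem : ∀ x, 0 < G x → ∃ y, (y ∈ hseg (ψ P) b ∨ y ∈ path (b :: l) a ∨
        y ∈ hseg a (ψ Q)) ∧ x = proj y := by
      intro x hx
      by_contra hc
      push Not at hc
      have g1 : x ∉ hseg (proj (ψ P)) (proj b) := by
        rw [proj_hseg]; rintro ⟨y, hy, rfl⟩; exact hc y (Or.inl hy) rfl
      have g2 : x ∉ path ((b :: l).map proj) (proj a) := by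
        rw [proj_path]; rintro ⟨y, hy, rfl⟩; exact hc y (Or.inr (Or.inl hy)) rfl
      have g3 : x ∉ hseg (proj a) (proj (ψ Q)) := by
        rw [proj_hseg]; rintro ⟨y, hy, rfl⟩; exact hc y (Or.inr (Or.inr hy)) rfl
      simp only [hG, through_of_notMem g1, through_of_notMem g3, passes_eq_zero.2 g2] at hx
      omega
    have hAG : ∀ x, A x = 0 ∨ G x = 0 := by
      intro x
      by_contra hc
      push Not at hc
      obtain ⟨z, hz, rfl⟩ := hAmem x (by omega)
      obtain ⟨y, hy, hzy⟩ := hGmem _ (Nat.pos_of_ne_zero hc.2)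
      exact hmixed z hz y hy hzy
    have hA2 : ∀ x, A x ≤ 2 := by
      intro x
      rcases Nat.eq_zero_or_pos (A x) with h0 | h0
      · omega
      · obtain ⟨z, -, rfl⟩ := hAmem x h0
        rw [hφψ, hA, passes_map hφ]; exact hle _
    have harc : ∀ z ∈ Q :: (C ++ [e]), A (proj (ψ z)) + G (proj (ψ z)) ≤ 1 := by
      intro z hz
      have h1 : A (proj (ψ z)) ≤ 1 := by rw [hφψ, hA, passes_map hφ]; exact hvert z hz
      have h2 : 0 < A (proj (ψ z)) := by
        rw [hφψ, hA, passes_map hφ, ← mem_path_iff]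
        exact mem_path_of_mem (List.mem_map_of_mem hz)
      rcases hAG (proj (ψ z)) with h3 | h3 <;> omega
    have hold : ∀ x, x ∈ (a :: b :: l).map proj → A x + G x ≤ 1 := by
      intro x hx
      have h1 := (hGU x).trans (hR.2.2 x hx)
      have h2 : 0 < G x := by
        rw [List.map_cons, List.mem_cons] at hx
        rcases hx with rfl | hx
        · simp only [hG, through_of_mem (left_mem_hseg _ _)]; omega
        · have := mem_path_iff.1 (mem_path_of_mem (e := proj a) hx)
          simp only [hG]; omega
      rcases hAG x with h3 | h3 <;> omega
    rw [isRegular_iff]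
    have hst : start ((ψ e :: ψ P :: b :: l ++ a :: ψ Q :: C.map ψ).map proj) 0 = proj (ψ e) := rfl
    rw [hst]
    refine ⟨by simp, fun x => ?_, fun x hx => ?_⟩
    · rw [hsum]
      have h1 := (hGU x).trans (hR.2.1 x)
      have h2 := hA2 x
      rcases hAG x with h3 | h3 <;> omega
    · rw [hsum]
      simp only [List.map_cons, List.cons_append, List.map_append, List.mem_cons, List.mem_append,
        List.map_map, List.mem_map] at hx hold
      rcases hx with rfl | rfl | rfl | hx | rfl | rfl | ⟨z, hz, rfl⟩
      · exact harc e (by simp)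
      -- The half-open arc excludes its end `P` and meets the line `ab` only at `Q`, so the image of
      -- `P` is counted in `G` alone.
      · have h1 : A (proj (ψ P)) = 0 := by
          by_contra hc
          obtain ⟨z, hz, hzP⟩ := hAmem _ (Nat.pos_of_ne_zero hc)
          have h2 : z = Q := hside z hz (by
            rw [← hzP]; exact area_of_mem_hseg (by rw [proj_hseg]; exact ⟨_, hPm, rfl⟩))
          rw [h2, hφψ, hφψ] at hzP
          exact hPQ (hφ hzP).symm
        have h2 : passes ((a :: b :: l).map proj) (proj a) (proj (ψ P)) ≤ 1 := by
          rw [List.map_cons, passes_cons]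
          have : proj (ψ P) ∉ path ((b :: l).map proj) (proj a) := by
            rw [proj_path]; rintro ⟨y, hy, h⟩; exact hfree _ hPm y hy h.symm
          rw [passes_eq_zero.2 this]; exact through_le_one _ _
        have := hGU (proj (ψ P)); omega
      · exact hold _ (by simp)
      · exact hold _ (Or.inr (Or.inr hx))
      · exact hold _ (by simp)
      · exact harc Q (by simp)
      · exact harc z (by simp [hz])
  -- The last edge `eP` of the arc is now passed first, before the first summand, and its other
  -- edges last. Deleting the edges of the first summand leaves exactly the order in which the bad
  -- pairs of the arc were counted.
  · have e1 : edges (ψ e :: ψ P :: b :: l ++ a :: ψ Q :: C.map ψ) (ψ e) =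
        (ψ e, ψ P) :: (ψ P, b) :: (edges (b :: l) a ++ (a, ψ Q) ::
          (edges (Q :: C) e).map (Prod.map ψ ψ)) := by
      have h1 : ψ e :: ψ P :: b :: l ++ a :: ψ Q :: C.map ψ =
          ψ e :: ψ P :: ((b :: l) ++ a :: (Q :: C).map ψ) := by simp
      rw [h1, edges_cons, edges_cons, edges_append, edges_cons a, edges_map]; rfl
    have harc : ∀ s ∈ (e, P) :: edges (Q :: C) e, ∀ x ∈ openSegment ℝ (ψ s.1) (ψ s.2),
        ∃ z ∈ path (Q :: (C ++ [e])) P, ψ z = x := by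
      intro s hs x hx
      rw [← image_openSegment] at hx
      obtain ⟨z, hz, rfl⟩ := hx
      refine ⟨z, openSegment_subset_path (s := s) ?_ hz, rfl⟩
      rw [← List.cons_append, edges_append]
      simp only [edges_cons, List.mem_cons, List.mem_append, edges_nil, start_nil] at hs ⊢
      tauto
    have hps := hmixed
    have arcs : ∀ {s t : Space × Space} {x y : Space},
        [s, t].Sublist ((ψ e, ψ P) :: (edges (Q :: C) e).map (Prod.map ψ ψ)) →
        x ∈ openSegment ℝ s.1 s.2 → y ∈ openSegment ℝ t.1 t.2 → proj x = proj y → x 2 < y 2 →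
        (x, y) ∈ Prod.map ψ ψ '' bad ((e, P) :: edges (Q :: C) e) := fun hst hx hy hxy hlt =>
      bad_map_subset ψ hψ _ ⟨_, _, hst, hx, hy, hxy, hlt⟩
    have hm : ∀ s ∈ (edges (Q :: C) e).map (Prod.map ψ ψ), ∀ x ∈ openSegment ℝ s.1 s.2,
        ∃ z ∈ path (Q :: (C ++ [e])) P, ψ z = x := by
      intro s hs x hx
      obtain ⟨s', hs', rfl⟩ := List.mem_map.1 hs
      exact harc s' (List.mem_cons_of_mem _ hs') x hx
    have h0 := harc (e, P) (by simp)
    have o₁ : openSegment ℝ a (ψ Q) ⊆ hseg a (ψ Q) := openSegment_subset_hseg _ _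
    have o₂ : openSegment ℝ (ψ P) b ⊆ hseg (ψ P) b := openSegment_subset_hseg _ _
    rintro ⟨x, y⟩ ⟨s, t, hst, hx, hy, hxy, hlt⟩
    dsimp only at hx hy hxy hlt
    rw [e1, pair_sublist_cons_iff, pair_sublist_cons_iff, pair_sublist_append_iff,
      pair_sublist_cons_iff] at hst
    simp only [List.mem_cons, List.mem_append] at hst
    rcases hst with ⟨rfl, rfl | ht | rfl | ht⟩ | ⟨rfl, ht | rfl | ht⟩ | hst | ⟨hs, rfl | ht⟩ |
      ⟨rfl, ht⟩ | hst
    · obtain ⟨z, hz, rfl⟩ := h0 x hx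
      exact absurd hxy (hps z hz y (Or.inl (o₂ hy)))
    · obtain ⟨z, hz, rfl⟩ := h0 x hx
      exact absurd hxy (hps z hz y (Or.inr (Or.inl (openSegment_subset_path ht hy))))
    · obtain ⟨z, hz, rfl⟩ := h0 x hx
      exact absurd hxy (hps z hz y (Or.inr (Or.inr (o₁ hy))))
    · exact Or.inr (arcs (pair_sublist_cons_iff.2 (Or.inl ⟨rfl, ht⟩)) hx hy hxy hlt)
    · exact absurd hxy (hfree x (sub₂ (o₂ hx)) y (openSegment_subset_path ht hy))
    · rw [hinj (sub₂ (o₂ hx)) (sub₁ (o₁ hy)) hxy] at hlt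
      exact absurd hlt (lt_irrefl _)
    · obtain ⟨z, hz, rfl⟩ := hm t ht y hy
      exact absurd hxy.symm (hps z hz x (Or.inl (o₂ hx)))
    · exact Or.inl ⟨s, t, hst, hx, hy, hxy, hlt⟩
    · exact absurd hxy.symm (hfree y (sub₁ (o₁ hy)) x (openSegment_subset_path hs hx))
    · obtain ⟨z, hz, rfl⟩ := hm t ht y hy
      exact absurd hxy.symm (hps z hz x (Or.inr (Or.inl (openSegment_subset_path hs hx))))
    · obtain ⟨z, hz, rfl⟩ := hm t ht y hy
      exact absurd hxy.symm (hps z hz x (Or.inr (Or.inr (o₁ hx))))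
    · exact Or.inr (arcs (pair_sublist_cons_iff.2 (Or.inr hst)) hx hy hxy hlt)

end KnotTheory


/-! ### Insertion of the extremal arc into the first summand -/

namespace KnotTheory

theorem continuous_proj : Continuous proj := LinearMap.continuous_of_finiteDimensional projL

/-- An arc in extremal position can be inserted into a crossing-free edge in such a way that no
bad pairs are added to those of the polygon and of the arc. -/
theorem exists_insertedInto_regular {a b : Space} {l : List Space} (h : IsSimple (a :: b :: l))
    (hreg : IsRegular ((a :: b :: l).map proj))
    (hfree : ∀ x ∈ hseg a b, ∀ y ∈ path (b :: l) a, proj x ≠ proj y)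
    {T : Tangle} {e : Space} {C : List Space} (hf : T.f = LinearMap.proj 0) (hB : T.B = C ++ [e])
    (hPQ : proj T.Q ≠ proj T.P)
    (hle : ∀ x, passes ((T.Q :: T.B).map proj) (proj T.P) x ≤ 2)
    (hvert : ∀ z ∈ T.Q :: T.B, passes ((T.Q :: T.B).map proj) (proj T.P) (proj z) ≤ 1) :
    ∃ (F F' : List Space) (g : Space × Space → Space × Space), T.InsertedInto (a :: b :: l) F ∧
      Isotopic F F' ∧ IsRegular (F'.map proj) ∧
      bad (edges F' (start F' 0)) ⊆
        bad (edges (b :: l) a) ∪ g '' bad ((e, T.P) :: edges (T.Q :: C) e) := by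
  have hreg' := hreg
  rw [List.map_cons, List.map_cons] at hreg'
  have hab := hreg'.head_ne
  have hlev : T.P 0 = T.Q 0 := by have := T.level; rwa [hf] at this
  have hy : T.P 1 - T.Q 1 ≠ 0 := fun h0 =>
    hPQ (proj_eq_iff.2 ⟨hlev.symm, (sub_eq_zero.1 h0).symm⟩)
  set y := T.P 1 - T.Q 1 with hydef
  -- Since `P - Q` has first coordinate zero, these coefficients solve `M (P - Q) = b - a`: the
  -- similarity adjusts the horizontal direction, and the vertical shear `κ` adjusts the slope
  -- without changing the order of heights over a point.
  set α := (b 1 - a 1) / y with hα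
  set β := -(b 0 - a 0) / y with hβ
  set κ := ((b 2 - a 2) - (T.P 2 - T.Q 2)) / y with hκ
  have hαy : α * y = b 1 - a 1 := div_mul_cancel₀ _ hy
  have hβy : β * y = -(b 0 - a 0) := div_mul_cancel₀ _ hy
  have hκy : κ * y = (b 2 - a 2) - (T.P 2 - T.Q 2) := div_mul_cancel₀ _ hy
  have hαβ : 0 < α ^ 2 + β ^ 2 := by
    refine lt_of_le_of_ne (by positivity) fun h0 => hab ?_
    have hα0 : α = 0 := by nlinarith [sq_nonneg α, sq_nonneg β]
    have hβ0 : β = 0 := by nlinarith [sq_nonneg α, sq_nonneg β]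
    rw [hα0, zero_mul] at hαy
    rw [hβ0, zero_mul] at hβy
    exact proj_eq_iff.2 ⟨by linarith, by linarith⟩
  set M := similarity α β κ with hM
  have hMdet : 0 < LinearMap.det M := by rw [hM, det_similarity]; exact hαβ
  have hMd : M (T.P - T.Q) = b - a := by
    rw [hM, similarity_apply]
    ext i
    fin_cases i
    · simp only [Pi.sub_apply, hlev]; simp; linarith
    · simp only [Pi.sub_apply, hlev]; simp; linarith
    · simp only [Pi.sub_apply, hlev]; simp; linarith
  -- the place of the insertion
  set m := pos a b (1 / 2) with hm
  have hmo : m ∈ openSegment ℝ a b := pos_mem_openSegment' _ _ (by norm_num) (by norm_num)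
  have hmnot : proj m ∉ path ((b :: l).map proj) (proj a) ∪ {proj a} := by
    rintro (h1 | h1)
    · rw [proj_path] at h1
      obtain ⟨z, hz, hzm⟩ := h1
      exact hfree m (openSegment_subset_hseg _ _ hmo) z hz hzm.symm
    · rw [hm, proj_pos] at h1
      exact pos_ne hab (by norm_num) h1.symm
  -- It is not enough that the copy is small in space: its projection has to stay in a disc that
  -- avoids the projection of the rest of the polygon.
  obtain ⟨ρ, hρ, hball⟩ := Metric.isOpen_iff.1
    (isClosed_path_union ((b :: l).map proj) (proj a)).isOpen_compl (proj m) hmnot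
  obtain ⟨s, hs, hfits⟩ := T.exists_fits_in h (injective_of_det_pos hMdet)
    ⟨1, one_pos, by rw [hMd, one_smul]⟩ hmo (Metric.isOpen_ball.preimage continuous_proj)
    (show m ∈ proj ⁻¹' Metric.ball (proj m) ρ from Metric.mem_ball_self hρ)
  obtain ⟨F, hFball⟩ := hfits s hs le_rfl
  obtain ⟨σ, r, hσ, hr, hσr, hmσ, hPσ, -⟩ := F.positions
  set ψ := T.place m (s • M) with hψ
  have hψa : ∀ x, ψ x = ![m 0 + s * (α * (x 0 - T.Q 0) - β * (x 1 - T.Q 1)),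
      m 1 + s * (β * (x 0 - T.Q 0) + α * (x 1 - T.Q 1)),
      m 2 + s * (κ * (x 1 - T.Q 1) + (x 2 - T.Q 2))] := by
    intro x
    rw [hψ, Tangle.place_apply, LinearMap.smul_apply, hM, similarity_apply]
    ext i; fin_cases i <;> simp
  set φ := planeSimilarity (s * α) (s * β) (proj T.Q) (proj m) with hφ
  have hφψ : ∀ x, proj (ψ x) = φ (proj x) := by
    intro x
    rw [hφ, planeSimilarity_apply, hψa]
    ext i
    fin_cases i <;> simp [proj] <;> ring
  have hφinj : Function.Injective φ := planeSimilarity_injective (by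
    have : (s * α) ^ 2 + (s * β) ^ 2 = s ^ 2 * (α ^ 2 + β ^ 2) := by ring
    rw [this]; positivity) _ _
  have hψord : ∀ x y, proj (ψ x) = proj (ψ y) →
      proj x = proj y ∧ (ψ x 2 < ψ y 2 → x 2 < y 2) := by
    intro x y hxy
    have h1 : proj x = proj y := by rw [hφψ, hφψ] at hxy; exact hφinj hxy
    refine ⟨h1, fun hlt => ?_⟩
    obtain ⟨-, e1⟩ := proj_eq_iff.1 h1
    rw [hψa, hψa] at hlt
    simp only [Matrix.cons_val, e1] at hlt
    have := lt_of_mul_lt_mul_left (lt_of_add_lt_add_left hlt) hs.le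
    linarith
  have hside : ∀ z ∈ path (T.Q :: (C ++ [e])) T.P, area (proj a) (proj b) (proj (ψ z)) = 0 →
      z = T.Q := by
    intro z hz h0
    rw [← hB] at hz
    refine Tangle.eq_Q_of_mem hz ?_
    rw [hf, LinearMap.proj_apply, LinearMap.proj_apply]
    -- The signed distance from the projected line `ab` is a nonzero multiple of the level of `z`
    -- relative to `Q`; thus extremality of the arc puts its copy on one side of the edge.
    have h1 : area (proj a) (proj b) (proj (ψ z)) =
        -(s * y * (α ^ 2 + β ^ 2)) * (z 0 - T.Q 0) := by
      have d0 : b 0 - a 0 = -(β * y) := by linarith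
      have d1 : b 1 - a 1 = α * y := hαy.symm
      have m0 : m 0 = a 0 + 1 / 2 * (b 0 - a 0) := by simp [hm, pos]
      have m1 : m 1 = a 1 + 1 / 2 * (b 1 - a 1) := by simp [hm, pos]
      rw [hψa]
      simp only [area, proj, Matrix.cons_val_zero, Matrix.cons_val_one]
      rw [m0, m1, d0, d1]; ring
    rw [h1] at h0
    have h2 : -(s * y * (α ^ 2 + β ^ 2)) ≠ 0 :=
      neg_ne_zero.2 (mul_ne_zero (mul_ne_zero hs.ne' hy) hαβ.ne')
    exact sub_eq_zero.1 ((mul_eq_zero.1 h0).resolve_left h2)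
  have hfar : ∀ z ∈ path (T.Q :: (C ++ [e])) T.P,
      proj (ψ z) ∉ path ((b :: l).map proj) (proj a) := by
    intro z hz hmem
    rw [← hB] at hz
    have hconv : Convex ℝ {x : Plane | x ∈ Metric.ball (proj m) ρ} := convex_ball _ _
    have h1 : path (((T.Q :: T.B).map proj).map φ) (φ (proj T.P)) ⊆ Metric.ball (proj m) ρ := by
      refine path_subset_convex hconv (fun x hx => ?_) ?_
      · rw [List.map_map, List.mem_map] at hx
        obtain ⟨x, hx, rfl⟩ := hx
        rw [Function.comp_apply, ← hφψ]
        exact hFball x (by rw [Tangle.verts]; exact List.mem_append_left _ hx)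
      · rw [← hφψ]
        exact hFball T.P (by simp [Tangle.verts])
    refine hball (h1 ?_) (Or.inl hmem)
    rw [path_map, proj_path, hφψ]
    exact ⟨_, ⟨z, hz, rfl⟩, rfl⟩
  have hQpos : ψ T.Q = pos a b σ := by rw [hψ, Tangle.place_Q, hmσ]; rfl
  obtain ⟨hR, hbad⟩ := insert_regular (C := C) (e := e) hφinj hφψ hψord hreg hfree hσ
    (lt_add_of_pos_right σ hr) hσr hQpos hPσ hPQ (hB ▸ hle) (hB ▸ hvert) hside hfar
  have hI : T.InsertedInto (a :: b :: l) (T.insert a (b :: l) m (s • M)) :=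
    ⟨a, b, l, m, s • M, rfl, det_smul_pos hMdet hs, F, rfl⟩
  refine ⟨_, ψ e :: ψ T.P :: b :: l ++ a :: ψ T.Q :: C.map ψ, Prod.map ψ ψ, hI, ?_, hR, hbad⟩
  have e1 : T.insert a (b :: l) m (s • M) =
      (a :: ψ T.Q :: C.map ψ) ++ (ψ e :: ψ T.P :: b :: l) := by
    rw [Tangle.insert_eq, hB]; simp [hψ]
  have hs' := hI.isSimple_right
  rw [e1] at hs' ⊢
  exact isotopic_append_comm hs'

end KnotTheory

/-! ### Subadditivity of the ascending number -/

theorem proposition2p4 (K₁ K₂ K : KnotTheory.Knot)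
    (hK : KnotTheory.IsConnectedSum K K₁ K₂) :
    KnotTheory.ascendingNumber K ≤
      KnotTheory.ascendingNumber K₁ + KnotTheory.ascendingNumber K₂ := by
  open KnotTheory in
  obtain ⟨f, c, P, Q, A, B, k, k₁, k₂, hP, hQ, hA, hB, hk, hk₁, hk₂, hKk, hKk₁, hKk₂⟩ := hK
  obtain ⟨l₁, hl₁, hi₁, hr₁, hn₁⟩ := exists_isotopic_le_ascendingNumber hKk₁
  obtain ⟨l₂, hl₂, hi₂, hr₂, hn₂⟩ := exists_isotopic_le_ascendingNumber hKk₂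
  obtain ⟨a, b, m, hs₁, hi₁', hr₁', hfree₁, hbad₁⟩ := exists_edge_without_crossings hl₁ hr₁
  obtain ⟨u, v, n, hs₂, hi₂', hr₂', hfree₂, hbad₂⟩ := exists_edge_without_crossings hl₂ hr₂
  obtain ⟨T, w, e, C, hf, hTB, hw, hW, hPQ, hle, hvert, hbadT⟩ :=
    exists_extremal_tangle hs₂ hr₂' hfree₂
  obtain ⟨F, F', g, hF, hFF', hreg, hbad⟩ :=
    exists_insertedInto_regular hs₁ hr₁' hfree₁ hf hTB hPQ hle hvert
  -- The connected sum is compared with the joined diagram; here the orientations of both minimal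
  -- polygons must agree with those of the arcs of `k`.
  have hiso : Isotopic k.verts F := by
    rw [hk]
    exact isotopic_insertedInto_of_connectedSum hP hQ hA hB (hk ▸ k.simple) (hk₁ ▸ k₁.simple)
      (hk₂ ▸ k₂.simple) hw (hk₂ ▸ hW.trans (hi₂'.trans hi₂)) (hk₁ ▸ hi₁'.trans hi₁) hF
  have hF's : IsSimple F' := hFF'.isSimple_iff.1 hF.isSimple_right
  have heq : Equivalent ⟨F', hF's⟩ K :=
    ((hiso.trans hFF').symm.equivalent hF's k.simple).trans _ _ _ (hKk.symm _ _)
  -- Finiteness is essential, as `ncard` of an infinite set is `0` and would not be monotone.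
  have fin₁ := hr₁.finite_bad hl₁
  have fin₂ := (hr₂.finite_bad hl₂).subset (hbadT.trans hbad₂)
  calc ascendingNumber K ≤ (bad (edges F' (start F' 0))).ncard := ascendingNumber_le hF's hreg heq
    _ ≤ (bad (edges (b :: m) a) ∪ g '' bad ((e, T.P) :: edges (T.Q :: C) e)).ncard :=
        Set.ncard_le_ncard hbad ((fin₁.subset hbad₁).union (fin₂.image g))
    _ ≤ (bad (edges (b :: m) a)).ncard + (g '' bad ((e, T.P) :: edges (T.Q :: C) e)).ncard :=
        Set.ncard_union_le _ _
    _ ≤ ascendingNumber K₁ + ascendingNumber K₂ :=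
        add_le_add ((Set.ncard_le_ncard hbad₁ fin₁).trans hn₁)
          ((Set.ncard_image_le fin₂).trans ((Set.ncard_le_ncard (hbadT.trans hbad₂)
            (hr₂.finite_bad hl₂)).trans hn₂))
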